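/- **Setting.** Let $d\in\mathbb N$, let $(E,\rho)$ be a compact metric space with $\rho\le 1$, and let $\Omega=E^{\mathbb Z^d}$ with the product topology and the shifts $(\theta_x\eta)(y)=\eta(y-x)$. For $x\in\mathbb Z^d$ let $(\Omega\times\Omega)_x$ be the set of pairs $(\eta,\xi)$ with $\eta(x)\ne\xi(x)$ and $\eta(y)=\xi(y)$ for all $y\neq x$. For $f:\Omega\to\mathbb R$ put $$\delta_f(x)=\sup_{(\eta,\xi)\in(\Omega\times\Omega)_x}\frac{f(\eta)-f(\xi)}{\rho(\eta(x),\xi(x))},\qquad |||f|||=\sum_{x\in\mathbb Z^d}\delta_f(x)\in[0,\infty]$$ (with $\delta_f(x)=0$ if $(\Omega\times\Omega)_x=\emptyset$). *Environment.* Let $(\eta_t)_{t\ge0}$ be a Feller process on $\Omega$ with càdlàg paths, semigroup $S^E_t$ on $C(\Omega)$, generator $L^E$ and path measures $\mathbb P_\eta$, which is translation invariant: for all $x$ and $\eta$, the law of $(\theta_x\eta_t)_{t\ge0}$ under $\mathbb P_\eta$ is $\mathbb P_{\theta_x\eta}$. *Rates.* Let $\alpha(\cdot,z)\ge 0$, $z\in\mathbb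 Z^d$, be continuous functions on $\Omega$ with $\sum_z\|z\|\sup_\eta\alpha(\eta,z)<\infty$ and $\sum_z|||\alpha(\cdot,z)|||<\infty$. *Environment process.* Let $S^{EP}_t$ be the Feller semigroup on $C(\Omega)$ whose generator has the same domain as $L^E$ and is given by $$L^{EP}f(\eta)=L^Ef(\eta)+\sum_{z\in\mathbb Z^d}\alpha(\eta,z)\,[f(\theta_{-z}\eta)-f(\eta)].$$ *Coupling.* For all $\eta,\xi\in\Omega$ let $\widehat{\mathbb P}_{\eta,\xi}$ be the law of a càdlàg process $(\eta^1_t,\eta^2_t)_{t\ge0}$ on $\Omega\times\Omega$ whose components have laws $\mathbb P_\eta$ and $\mathbb P_\xi$. Assume that it is translation invariant (the law of $(\theta_x\eta^1_t,\theta_x\eta^2_t)_{t\ge 0}$ under $\widehat{\mathbb P}_{\eta,\xi}$ is $\widehat{\mathbb P}_{\theta_x\eta,\theta_x\xi}$) and has the strong marginal Markov property: with $(\mathcal F_t)$ the canonical filtration of the coupled process, for every stopping time $\tau$, $t\ge 0$, $f\in C(\Omega)$ and $i=1,2$, $$\widehat{\mathbb E}_{\eta,\xi}\big[\mathbf 1_{t\ge\tau}f(\eta^i_t)\,\big|\,\mathcal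 F_\tau\big]=\mathbf 1_{t\ge\tau}\,S^E_{t-\tau}f(\eta^i_\tau)\quad\text{a.s.}$$ Write $$G(t)=\sum_{x\in\mathbb Z^d}\ \sup_{(\eta,\xi)\in(\Omega\times\Omega)_0}\widehat{\mathbb E}_{\eta,\xi}\,\rho(\eta^1_t(x),\eta^2_t(x)).$$ **Theorem.** (a) If $\int_0^\infty t^d\,\sup_{\eta,\xi\in\Omega}\widehat{\mathbb E}_{\eta,\xi}\rho(\eta^1_t(0),\eta^2_t(0))\,dt<\infty$, then there is a constant $C_a\in(0,\infty)$ such that for every continuous $f:\Omega\to\mathbb R$ with $|||f|||<\infty$ $$\sup_{\eta,\xi\in\Omega}\int_0^\infty|S^{EP}_tf(\eta)-S^{EP}_tf(\xi)|\,dt\le C_a\,|||f|||.$$ (b) If $\int_0^\infty t^d\,G(t)\,dt<\infty$ and $\int_0^1G(t)\,dt<\infty$, then there is a constant $C_b\in(0,\infty)$ such that for every continuous $f:\Omega\to\mathbb R$ with $|||f|||<\infty$ $$\sum_{x\in\mathbb Z^d}\ \sup_{(\eta,\xi)\in(\Omega\times\Omega)_x}\int_0^\infty|S^{EP}_tf(\eta)-S^{EP}_tf(\xi)|\,dt\le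 C_b\,|||f|||.$$ -/

import Mathlib

open MeasureTheory Filter Topology
open scoped NNReal ENNReal

namespace RWDRE

/-! ### Feller semigroups and their generators -/

/-- A Feller (strongly continuous Markov) semigroup on `C(X, ℝ)`, for `X` a compact space. -/
structure FellerSemigroup (X : Type*) [TopologicalSpace X] [CompactSpace X] where
  /-- the operator at time `t` -/
  op : ℝ≥0 → C(X, ℝ) →L[ℝ] C(X, ℝ)
  op_zero : op 0 = ContinuousLinearMap.id ℝ C(X, ℝ)
  op_add : ∀ s t : ℝ≥0, op (s + t) = (op s).comp (op t)
  op_one : ∀ t : ℝ≥0, op t 1 = 1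
  op_nonneg : ∀ (t : ℝ≥0) (f : C(X, ℝ)), 0 ≤ f → 0 ≤ op t f
  op_continuous : ∀ f : C(X, ℝ), Tendsto (fun t => op t f) (𝓝 0) (𝓝 f)

/-- `S.Generates f g` says that `f` belongs to the domain of the generator `L` of `S` and that
`L f = g`, i.e. `(S_t f - f) / t → g` uniformly as `t ↓ 0`. -/
def FellerSemigroup.Generates {X : Type*} [TopologicalSpace X] [CompactSpace X]
    (S : FellerSemigroup X) (f g : C(X, ℝ)) : Prop :=
  Tendsto (fun t : ℝ≥0 => (t : ℝ)⁻¹ • (S.op t f - f)) (𝓝[>] 0) (𝓝 g)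

/-! ### Path space -/

/-- Right-continuous paths with left limits. -/
def IsCadlag {X : Type*} [TopologicalSpace X] (ω : ℝ≥0 → X) : Prop :=
  ∀ t : ℝ≥0, ContinuousWithinAt ω (Set.Ici t) t ∧ ∃ l : X, Tendsto ω (𝓝[<] t) (𝓝 l)

/-- The path space of càdlàg functions `[0, ∞) → X`. -/
def CadlagPath (X : Type*) [TopologicalSpace X] : Type _ :=
  {ω : ℝ≥0 → X // IsCadlag ω}

/-- The position at time `t`. -/
def CadlagPath.at {X : Type*} [TopologicalSpace X] (t : ℝ≥0) (ω : CadlagPath X) : X := ω.1 t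

/-- The σ-algebra on path space generated by the evaluations. -/
instance CadlagPath.instMeasurableSpace (X : Type*) [TopologicalSpace X] [MeasurableSpace X] :
    MeasurableSpace (CadlagPath X) :=
  ⨆ t : ℝ≥0, MeasurableSpace.comap (CadlagPath.at t) inferInstance

/-- The canonical filtration `𝓕_t = σ(ω_s, s ≤ t)`. -/
def canonicalFiltration (X : Type*) [TopologicalSpace X] [MeasurableSpace X] :
    Filtration ℝ≥0 (CadlagPath.instMeasurableSpace X) where
  seq t := ⨆ s : ℝ≥0, ⨆ _ : s ≤ t, MeasurableSpace.comap (CadlagPath.at s) inferInstance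
  mono' _ _ h := iSup_mono fun _ => iSup_mono' fun hs => ⟨hs.trans h, le_rfl⟩
  le' _ := iSup_le fun s => iSup_le fun _ =>
    le_iSup (fun s : ℝ≥0 => MeasurableSpace.comap (CadlagPath.at (X := X) s) inferInstance) s

/-- The image of a path under a continuous map. -/
def CadlagPath.map {X Y : Type*} [TopologicalSpace X] [TopologicalSpace Y] (g : C(X, Y))
    (ω : CadlagPath X) : CadlagPath Y :=
  ⟨fun t => g (ω.1 t), fun t =>
    ⟨g.continuous.continuousAt.comp_continuousWithinAt (ω.2 t).1,
      let ⟨l, hl⟩ := (ω.2 t).2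
      ⟨g l, (g.continuous.tendsto l).comp hl⟩⟩⟩

/-! ### Configurations, shifts, Lipschitz seminorm -/

/-- Sites of the lattice `ℤ^d`; the norm is the supremum norm. -/
abbrev Site (d : ℕ) : Type := Fin d → ℤ

/-- The configuration space `Ω = E^{ℤ^d}` with the product topology and product σ-algebra. -/
abbrev Config (d : ℕ) (E : Type*) : Type _ := Site d → E

/-- The shift `(θ_x η)(y) = η (y - x)`. -/
def shift {d : ℕ} {E : Type*} [TopologicalSpace E] (x : Site d) : C(Config d E, Config d E) where
  toFun η := fun y => η (y - x)
  continuous_toFun := continuous_pi fun y => continuous_apply (y - x)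

/-- The set `(Ω × Ω)_x` of pairs of configurations that differ at `x` and only there. -/
def diffAt {d : ℕ} {E : Type*} (x : Site d) : Set (Config d E × Config d E) :=
  {p | p.1 x ≠ p.2 x ∧ ∀ y, y ≠ x → p.1 y = p.2 y}

/-- The Lipschitz constant `δ_f(x)` of `f` with respect to the variable `η(x)`
(with values in `[0, ∞]`; it is `0` if there is no pair in `(Ω × Ω)_x`). -/
noncomputable def lipConst {d : ℕ} {E : Type*} [MetricSpace E] (f : Config d E → ℝ)
    (x : Site d) : ℝ≥0∞ :=
  ⨆ p ∈ diffAt (E := E) x, ENNReal.ofReal ((f p.1 - f p.2) / dist (p.1 x) (p.2 x))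

/-- The seminorm `|||f||| = ∑_x δ_f(x)`, with values in `[0, ∞]`. -/
noncomputable def tripleNorm {d : ℕ} {E : Type*} [MetricSpace E] (f : Config d E → ℝ) : ℝ≥0∞ :=
  ∑' x : Site d, lipConst f x

/-! ### The environment and its couplings -/

section Environment

variable (d : ℕ) (E : Type*) [MetricSpace E] [CompactSpace E] [MeasurableSpace E]

/-- An environment: a Feller process on `Ω = E^{ℤ^d}`, given by its semigroup `S^E` and its path
space measures `P_η`. -/
structure Environment where
  /-- the semigroup `S^E` -/
  semigroup : FellerSemigroup (Config d E)
  /-- the path space measure `P_η` of the process started from `η` -/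
  law : Config d E → Measure (CadlagPath (Config d E))
  isProbabilityMeasure : ∀ η, IsProbabilityMeasure (law η)
  start : ∀ η, ∀ᵐ ω ∂(law η), CadlagPath.at 0 ω = η
  markov : ∀ (η : Config d E) (f : C(Config d E, ℝ)) (s t : ℝ≥0), s ≤ t →
    condExp (canonicalFiltration (Config d E) s) (law η) (fun ω => f (CadlagPath.at t ω))
      =ᵐ[law η] fun ω => semigroup.op (t - s) f (CadlagPath.at s ω)

variable {d E}

/-- Translation invariance: `P_η(θ_x η_· ∈ ·) = P_{θ_x η}(η_· ∈ ·)`. -/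
def Environment.IsTranslationInvariant (env : Environment d E) : Prop :=
  ∀ (x : Site d) (η : Config d E),
    (env.law η).map (CadlagPath.map (shift x)) = env.law (shift x η)

/-- A coupling of the environment: for each pair `(η, ξ)` the law of a process
`(η¹_t, η²_t)_{t ≥ 0}` whose components have the laws `P_η` and `P_ξ`. -/
structure Coupling (env : Environment d E) where
  /-- the law of the coupled process started from `(η, ξ)` -/
  law : Config d E → Config d E → Measure (CadlagPath (Config d E × Config d E))
  isProbabilityMeasure : ∀ η ξ, IsProbabilityMeasure (law η ξ)
  marginal_fst : ∀ η ξ, (law η ξ).map (CadlagPath.map ContinuousMap.fst) = env.law η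
  marginal_snd : ∀ η ξ, (law η ξ).map (CadlagPath.map ContinuousMap.snd) = env.law ξ

/-- Translation invariance of a coupling. -/
def Coupling.IsTranslationInvariant {env : Environment d E} (cpl : Coupling env) : Prop :=
  ∀ (x : Site d) (η ξ : Config d E),
    (cpl.law η ξ).map (CadlagPath.map ((shift x).prodMap (shift x))) =
      cpl.law (shift x η) (shift x ξ)

/-- The strong marginal Markov property: for every stopping time `τ` of the canonical filtration
of the coupled process, `E[1_{t ≥ τ} f(η^i_t) | 𝓕_τ] = 1_{t ≥ τ} (S_{t-τ} f)(η^i_τ)`, `i = 1, 2`. -/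
def Coupling.StrongMarginalMarkov {env : Environment d E} (cpl : Coupling env) : Prop :=
  ∀ (η ξ : Config d E) (f : C(Config d E, ℝ))
    (τ : CadlagPath (Config d E × Config d E) → WithTop ℝ≥0)
    (hτ : IsStoppingTime (canonicalFiltration (Config d E × Config d E)) τ) (t : ℝ≥0),
    (condExp hτ.measurableSpace (cpl.law η ξ)
        ({ω | τ ω ≤ t}.indicator fun ω => f (CadlagPath.at t ω).1)
      =ᵐ[cpl.law η ξ]
        {ω | τ ω ≤ t}.indicator fun ω =>
          env.semigroup.op (t - (τ ω).untopD 0) f (CadlagPath.at ((τ ω).untopD 0) ω).1) ∧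
    (condExp hτ.measurableSpace (cpl.law η ξ)
        ({ω | τ ω ≤ t}.indicator fun ω => f (CadlagPath.at t ω).2)
      =ᵐ[cpl.law η ξ]
        {ω | τ ω ≤ t}.indicator fun ω =>
          env.semigroup.op (t - (τ ω).untopD 0) f (CadlagPath.at ((τ ω).untopD 0) ω).2)

/-- `Ê_{η,ξ} ρ(η¹_t(x), η²_t(x))`. -/
noncomputable def Coupling.meanDist {env : Environment d E} (cpl : Coupling env)
    (η ξ : Config d E) (t : ℝ≥0) (x : Site d) : ℝ≥0∞ :=
  ∫⁻ ω, edist ((CadlagPath.at t ω).1 x) ((CadlagPath.at t ω).2 x) ∂(cpl.law η ξ)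

/-- `∫_0^∞ t^d sup_{η,ξ} Ê_{η,ξ} ρ(η¹_t(0), η²_t(0)) dt < ∞`. -/
def Coupling.Assumption1a {env : Environment d E} (cpl : Coupling env) : Prop :=
  ∫⁻ t in Set.Ioi (0 : ℝ), ENNReal.ofReal (t ^ d) *
    (⨆ η : Config d E, ⨆ ξ : Config d E, cpl.meanDist η ξ t.toNNReal 0) < ∞

/-- `∑_x sup_{(η,ξ) ∈ (Ω × Ω)_0} Ê_{η,ξ} ρ(η¹_t(x), η²_t(x))`. -/
noncomputable def Coupling.totalDiscrepancy {env : Environment d E} (cpl : Coupling env)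
    (t : ℝ≥0) : ℝ≥0∞ :=
  ∑' x : Site d, ⨆ p ∈ diffAt (E := E) (0 : Site d), cpl.meanDist p.1 p.2 t x

/-- `∫_0^∞ t^d ∑_x sup_{(η,ξ) ∈ (Ω × Ω)_0} Ê_{η,ξ} ρ(η¹_t(x), η²_t(x)) dt < ∞`. -/
def Coupling.Assumption1b {env : Environment d E} (cpl : Coupling env) : Prop :=
  ∫⁻ t in Set.Ioi (0 : ℝ), ENNReal.ofReal (t ^ d) * cpl.totalDiscrepancy t.toNNReal < ∞

/-- Integrability at small times, where the weight `t^d` degenerates: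
`∫_0^1 ∑_x sup_{(η,ξ) ∈ (Ω × Ω)_0} Ê_{η,ξ} ρ(η¹_t(x), η²_t(x)) dt < ∞`. -/
def Coupling.SmallTimeIntegrable {env : Environment d E} (cpl : Coupling env) : Prop :=
  ∫⁻ t in Set.Ioc (0 : ℝ) 1, cpl.totalDiscrepancy t.toNNReal < ∞

end Environment

/-! ### The environment process -/

/-- `T` is the semigroup `S^EP` of the environment process: its generator is
`L^EP f(η) = L^E f(η) + ∑_z α(η, z) [f(θ_{-z} η) - f(η)]`, with the same domain as the generator
`L^E` of `S`. Here `α z η` is the rate `α(η, z)`. -/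
def IsEnvironmentProcessSemigroup {d : ℕ} {E : Type*} [MetricSpace E] [CompactSpace E]
    (S : FellerSemigroup (Config d E)) (α : Site d → C(Config d E, ℝ))
    (T : FellerSemigroup (Config d E)) : Prop :=
  ∀ f h : C(Config d E, ℝ), T.Generates f h ↔
    ∃ g : C(Config d E, ℝ), S.Generates f g ∧
      ∀ η, h η = g η + ∑' z : Site d, α z η * (f (shift (-z) η) - f η)

end RWDRE

namespace RWDRE

set_option linter.unusedSectionVars false

/-! ### Feller semigroups: continuity, density of the domain, variation of constants. -/

namespace FellerSemigroup

variable {X : Type*} [TopologicalSpace X] [CompactSpace X]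

/-! Write `S` for the semigroup of the environment and `T` for that of the environment process.
Fictitious zero jumps make the total jump rate a constant `Λ` (`clockRate`), so the generator of `T`
is that of `S` plus `K - Λ` with `K` bounded and positive. For `|φ| ≤ 1` put `ζ_r = φ(r) f + ‖f‖`
and `H_s = ∫_s^t T_{r-s} ζ_r dr`. Duhamel's formula gives the mild equation `H_s = ∫_s^t e^{-Λ(u-s)}
S_{u-s}(ζ_u + K H_u) du` (`backward_eq`). If `φ` is the sign of `T_s f(η) - T_s f(ξ)`, then `H_0(η)
- H_0(ξ)` is the integral of `|T_s f(η) - T_s f(ξ)|` up to time `t` (`exists_tilt`). It thus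
suffices to bound oscillations of `H`, all of which are at most `Ψ = fluctuation T f t`.

Comparison. In the coupled environment, run one walk that jumps at the smaller of the two rates seen
from its position and is killed at the remaining rate. The mild equation is iterated along the jumps
of this walk for each marginal separately, using only the marginal Markov property. The two
expansions differ in the source, at the cost of Lipschitz constants times discrepancies, and at the
killing. Both marginals are killed at the same rate, which is bounded linearly by the discrepancy
around the walk, and one killing costs at most `Ψ`. The walk depends on the environment, so its
position cannot be averaged independently of the discrepancies. Instead, the probability of being at
`y` at time `u` is bounded by a deterministic `n u y` with `∑_y n u y ≤ C max(1,u)^d`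
(`exists_site_bound`), which is the origin of the weight `t^d`. This bound comes from a weight at
spatial scale `u` that is superharmonic up to a rate of order `1/u` and needs only a first moment of
the jumps (`exists_superharmonic_weight`). The outcome is `ofReal_op_backward_sub_le`.

Absorption. If the comparison is started at a large time `a`, the coefficient of `Ψ` is a tail of
the assumed integral and is at most `1/2`. Before `a` nothing is compared: with probability
`e^{-Λa}` the clock does not ring, and otherwise `Ψ` is paid. Hence `Ψ ≤ a N + (1 - e) Ψ + e (B +
Ψ/2)` with `e = e^{-Λa}`, `N = |||f|||` and `B` the part of the comparison bound free of `Ψ`. Since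
`Ψ` is finite for finite `t`, it is bounded uniformly in `t` by a multiple of `|||f|||`
(`fluctuation_le_of_half`, `exists_fluctuation_le`). This is part (a). For part (b) the same
absorption is run with differences decomposed into single-site changes. The resulting bound on `Ψ`
is inserted into the comparison started at time `0`, which is then summed over the site of the
initial discrepancy. -/

theorem op_mono (S : FellerSemigroup X) (t : ℝ≥0) {f g : C(X, ℝ)} (h : f ≤ g) :
    S.op t f ≤ S.op t g := by
  have := S.op_nonneg t (g - f) (sub_nonneg.2 h)
  rwa [map_sub, sub_nonneg] at this

theorem op_const (S : FellerSemigroup X) (t : ℝ≥0) (c : ℝ) :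
    S.op t (ContinuousMap.const X c) = ContinuousMap.const X c := by
  have h : ContinuousMap.const X c = c • (1 : C(X, ℝ)) := by ext; simp
  rw [h, map_smul, S.op_one]

theorem op_apply_le (S : FellerSemigroup X) (t : ℝ≥0) {f : C(X, ℝ)} {c : ℝ} (h : ∀ x, f x ≤ c)
    (x : X) : S.op t f x ≤ c := by
  have := S.op_mono t (f := f) (g := ContinuousMap.const X c) h
  rw [op_const] at this
  exact this x

theorem le_op_apply (S : FellerSemigroup X) (t : ℝ≥0) {f : C(X, ℝ)} {c : ℝ} (h : ∀ x, c ≤ f x)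
    (x : X) : c ≤ S.op t f x := by
  have := S.op_mono t (f := ContinuousMap.const X c) (g := f) h
  rw [op_const] at this
  exact this x

theorem norm_op_apply_le (S : FellerSemigroup X) (t : ℝ≥0) (f : C(X, ℝ)) :
    ‖S.op t f‖ ≤ ‖f‖ := by
  rw [ContinuousMap.norm_le _ (norm_nonneg _)]
  intro x
  rw [Real.norm_eq_abs, abs_le]
  exact ⟨S.le_op_apply t (fun y => (abs_le.1 (f.norm_coe_le_norm y)).1) x,
    S.op_apply_le t (fun y => (abs_le.1 (f.norm_coe_le_norm y)).2) x⟩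

/-- Contractivity reduces continuity at any time to continuity at `0`. With truncated subtraction,
`(t - s) + (s - t)` is `|t - s|`. -/
theorem norm_op_sub_op_le (S : FellerSemigroup X) (f : C(X, ℝ)) (s t : ℝ≥0) :
    ‖S.op s f - S.op t f‖ ≤ ‖S.op ((t - s) + (s - t)) f - f‖ := by
  rcases le_total s t with h | h
  · have e : S.op t f = S.op s (S.op (t - s) f) := by
      rw [← ContinuousLinearMap.comp_apply, ← S.op_add, add_tsub_cancel_of_le h]
    rw [tsub_eq_zero_of_le h, add_zero, e, ← map_sub, norm_sub_rev (S.op (t - s) f)]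
    exact S.norm_op_apply_le _ _
  · have e : S.op s f = S.op t (S.op (s - t) f) := by
      rw [← ContinuousLinearMap.comp_apply, ← S.op_add, add_tsub_cancel_of_le h]
    rw [tsub_eq_zero_of_le h, zero_add, e, ← map_sub]
    exact S.norm_op_apply_le _ _

theorem continuous_op_apply (S : FellerSemigroup X) (f : C(X, ℝ)) :
    Continuous fun t => S.op t f := by
  rw [continuous_iff_continuousAt]
  intro t
  rw [ContinuousAt, tendsto_iff_norm_sub_tendsto_zero]
  have h1 : Tendsto (fun s : ℝ≥0 => (t - s) + (s - t)) (𝓝 t) (𝓝 0) := by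
    have : Continuous fun s : ℝ≥0 => (t - s) + (s - t) := by fun_prop
    simpa using this.tendsto t
  have h2 : Tendsto (fun s : ℝ≥0 => ‖S.op ((t - s) + (s - t)) f - f‖) (𝓝 t) (𝓝 0) :=
    tendsto_iff_norm_sub_tendsto_zero.1 ((S.op_continuous f).comp h1)
  exact squeeze_zero (fun _ => norm_nonneg _) (fun s => S.norm_op_sub_op_le f s t) h2

theorem continuous_op (S : FellerSemigroup X) :
    Continuous fun p : ℝ≥0 × C(X, ℝ) => S.op p.1 p.2 := by
  rw [continuous_iff_continuousAt]
  rintro ⟨t, f⟩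
  rw [ContinuousAt, tendsto_iff_norm_sub_tendsto_zero]
  have h1 : Tendsto (fun p : ℝ≥0 × C(X, ℝ) => ‖p.2 - f‖ + ‖S.op p.1 f - S.op t f‖)
      (𝓝 (t, f)) (𝓝 0) := by
    have : Continuous fun p : ℝ≥0 × C(X, ℝ) => ‖p.2 - f‖ + ‖S.op p.1 f - S.op t f‖ := by
      have := (S.continuous_op_apply f).comp (continuous_fst (X := ℝ≥0) (Y := C(X, ℝ)))
      simp only [Function.comp_def] at this
      fun_prop
    simpa using this.tendsto (t, f)
  refine squeeze_zero (fun _ => norm_nonneg _) (fun p => ?_) h1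
  calc ‖S.op p.1 p.2 - S.op t f‖ = ‖S.op p.1 (p.2 - f) + (S.op p.1 f - S.op t f)‖ := by
        rw [map_sub]; congr 1; abel
    _ ≤ _ := (norm_add_le _ _).trans (by gcongr; exact S.norm_op_apply_le _ _)

theorem _root_.Continuous.fellerOp {Y : Type*} [TopologicalSpace Y] (S : FellerSemigroup X)
    {a : Y → ℝ} {f : Y → C(X, ℝ)} (ha : Continuous a) (hf : Continuous f) :
    Continuous fun y => S.op (a y).toNNReal (f y) :=
  S.continuous_op.comp ((continuous_real_toNNReal.comp ha).prodMk hf)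

theorem op_toNNReal_add (S : FellerSemigroup X) {s t : ℝ} (hs : 0 ≤ s) (ht : 0 ≤ t)
    (f : C(X, ℝ)) : S.op (s + t).toNNReal f = S.op s.toNNReal (S.op t.toNNReal f) := by
  rw [Real.toNNReal_add hs ht, S.op_add, ContinuousLinearMap.comp_apply]

/-- The difference quotient formulation of `Generates` along real times. -/
theorem Generates.tendsto_real {S : FellerSemigroup X} {f g : C(X, ℝ)} (h : S.Generates f g) :
    Tendsto (fun t : ℝ => t⁻¹ • (S.op t.toNNReal f - f)) (𝓝[>] 0) (𝓝 g) := by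
  have h1 : Tendsto Real.toNNReal (𝓝[>] 0) (𝓝[>] 0) := by
    refine tendsto_nhdsWithin_iff.2 ⟨?_, ?_⟩
    · have := (continuous_real_toNNReal.tendsto 0)
      rw [Real.toNNReal_zero] at this
      exact this.mono_left nhdsWithin_le_nhds
    · filter_upwards [self_mem_nhdsWithin] with t ht
      exact Real.toNNReal_pos.2 ht
  refine (h.comp h1).congr' ?_
  filter_upwards [self_mem_nhdsWithin] with t ht
  simp [Real.coe_toNNReal t (le_of_lt ht)]

theorem generates_of_tendsto_real {S : FellerSemigroup X} {f g : C(X, ℝ)}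
    (h : Tendsto (fun t : ℝ => t⁻¹ • (S.op t.toNNReal f - f)) (𝓝[>] 0) (𝓝 g)) :
    S.Generates f g := by
  have h1 : Tendsto ((↑) : ℝ≥0 → ℝ) (𝓝[>] 0) (𝓝[>] 0) := by
    refine tendsto_nhdsWithin_iff.2 ⟨?_, ?_⟩
    · exact (NNReal.continuous_coe.tendsto 0).mono_left nhdsWithin_le_nhds
    · filter_upwards [self_mem_nhdsWithin] with t ht
      exact_mod_cast ht
  refine (h.comp h1).congr fun t => ?_
  simp

theorem Generates.op {S : FellerSemigroup X} {f g : C(X, ℝ)} (h : S.Generates f g) (s : ℝ≥0) :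
    S.Generates (S.op s f) (S.op s g) := by
  refine (((S.op s).continuous.tendsto g).comp h).congr fun t => ?_
  simp only [Function.comp_apply, map_smul, map_sub]
  rw [← ContinuousLinearMap.comp_apply, ← S.op_add, add_comm, S.op_add,
    ContinuousLinearMap.comp_apply]

/-- By the semigroup law, `S_t - 1` turns the integral over `[0, ε]` into the integral over `[ε, ε +
t]` minus that over `[0, t]`; divided by `t`, both converge. These averages supply the dense set of
domain elements. -/
theorem generates_integral (S : FellerSemigroup X) (f : C(X, ℝ)) {ε : ℝ} (hε : 0 < ε) :
    S.Generates (∫ s in (0 : ℝ)..ε, S.op s.toNNReal f) (S.op ε.toNNReal f - f) := by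
  apply generates_of_tendsto_real
  have hc : Continuous fun s : ℝ => S.op s.toNNReal f := continuous_id.fellerOp S continuous_const
  have hF : ∀ a : ℝ, HasDerivWithinAt (fun u : ℝ => ∫ s in (0 : ℝ)..u, S.op s.toNNReal f)
      (S.op a.toNNReal f) (Set.Ioi a) a := fun a =>
    (intervalIntegral.integral_hasDerivAt_right (hc.intervalIntegrable _ _)
      (hc.stronglyMeasurableAtFilter _ _) hc.continuousAt).hasDerivWithinAt
  have hsh : ∀ a : ℝ, Tendsto (fun t : ℝ => t⁻¹ • ((∫ s in (0 : ℝ)..(a + t), S.op s.toNNReal f)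
      - ∫ s in (0 : ℝ)..a, S.op s.toNNReal f)) (𝓝[>] 0) (𝓝 (S.op a.toNNReal f)) := by
    intro a
    have h0 := (hasDerivWithinAt_iff_tendsto_slope' (by simp)).1 (hF a)
    have h1 : Tendsto (fun r : ℝ => a + r) (𝓝[>] 0) (𝓝[>] a) := by
      refine tendsto_nhdsWithin_iff.2 ⟨?_, ?_⟩
      · have : Continuous fun r : ℝ => a + r := by fun_prop
        simpa using (this.tendsto 0).mono_left nhdsWithin_le_nhds
      · filter_upwards [self_mem_nhdsWithin] with r hr
        simpa using hr
    refine (h0.comp h1).congr fun t => ?_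
    simp [slope_def_module]
  have h2 := (hsh ε).sub (hsh 0)
  rw [Real.toNNReal_zero, S.op_zero, ContinuousLinearMap.id_apply] at h2
  refine h2.congr' ?_
  filter_upwards [self_mem_nhdsWithin] with t (ht : 0 < t)
  rw [← smul_sub]
  congr 1
  have e1 : S.op t.toNNReal (∫ s in (0 : ℝ)..ε, S.op s.toNNReal f)
      = ∫ s in t..(ε + t), S.op s.toNNReal f := by
    rw [← ContinuousLinearMap.intervalIntegral_comp_comm _ (hc.intervalIntegrable _ _)]
    have := intervalIntegral.integral_comp_add_right (a := 0) (b := ε)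
      (fun s : ℝ => S.op s.toNNReal f) t
    rw [zero_add] at this
    rw [← this]
    refine intervalIntegral.integral_congr fun s hs => ?_
    rw [Set.uIcc_of_le hε.le] at hs
    rw [← S.op_toNNReal_add ht.le hs.1, add_comm]
  rw [e1, zero_add, intervalIntegral.integral_same, sub_zero]
  rw [← intervalIntegral.integral_interval_sub_left (hc.intervalIntegrable 0 (ε + t))
    (hc.intervalIntegrable 0 t)]
  abel

/-- The domain of the generator is dense. -/
theorem dense_generates (S : FellerSemigroup X) : Dense {f : C(X, ℝ) | ∃ g, S.Generates f g} := by
  intro f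
  have hc : Continuous fun s : ℝ => S.op s.toNNReal f := continuous_id.fellerOp S continuous_const
  have hF : HasDerivWithinAt (fun u : ℝ => ∫ s in (0 : ℝ)..u, S.op s.toNNReal f)
      f (Set.Ioi 0) 0 := by
    have := (intervalIntegral.integral_hasDerivAt_right (hc.intervalIntegrable 0 0)
      (hc.stronglyMeasurableAtFilter _ _) hc.continuousAt).hasDerivWithinAt (s := Set.Ioi 0)
    simpa [S.op_zero] using this
  have h0 := (hasDerivWithinAt_iff_tendsto_slope' (by simp)).1 hF
  refine mem_closure_of_tendsto h0 ?_
  filter_upwards [self_mem_nhdsWithin] with ε hε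
  refine ⟨(ε - 0)⁻¹ • (S.op ε.toNNReal f - f), ?_⟩
  have h1 := S.generates_integral f hε
  simp only [slope_def_module, intervalIntegral.integral_same, sub_zero]
  refine (h1.const_smul ε⁻¹).congr fun t => ?_
  rw [map_smul, ← smul_sub, smul_comm]

/-- Variation of constants: `T` is the perturbation of `S` by the bounded operator `B`, and
`K = B + Λ`. -/
theorem duhamel {S T : FellerSemigroup X} {K : C(X, ℝ) →L[ℝ] C(X, ℝ)} {Λ : ℝ}
    (hT : ∀ f h : C(X, ℝ), T.Generates f h → S.Generates f (h - (K f - Λ • f)))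
    (f : C(X, ℝ)) {t : ℝ} (ht : 0 ≤ t) :
    T.op t.toNNReal f = Real.exp (-Λ * t) • S.op t.toNNReal f +
      ∫ s in (0 : ℝ)..t, Real.exp (-Λ * (t - s)) •
        S.op (t - s).toNNReal (K (T.op s.toNNReal f)) := by
  have hcK : Continuous fun p : C(X, ℝ) × ℝ => Real.exp (-Λ * (t - p.2)) •
        S.op (t - p.2).toNNReal (K (T.op p.2.toNNReal p.1)) := by
    have h1 : Continuous fun p : C(X, ℝ) × ℝ => T.op p.2.toNNReal p.1 :=
      continuous_snd.fellerOp T continuous_fst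
    have h2 : Continuous fun p : C(X, ℝ) × ℝ => S.op (t - p.2).toNNReal
        (K (T.op p.2.toNNReal p.1)) :=
      (continuous_const.sub continuous_snd).fellerOp S (K.continuous.comp h1)
    fun_prop
  -- For `f` in the domain, differentiate the interpolation `s ↦ e^{-Λ(t-s)} S_{t-s} T_s f` and
  -- integrate; both sides are continuous in `f`, so density gives the rest.
  refine (T.dense_generates).induction (P := fun f => T.op t.toNNReal f = Real.exp (-Λ * t) •
      S.op t.toNNReal f + ∫ s in (0 : ℝ)..t, Real.exp (-Λ * (t - s)) •
        S.op (t - s).toNNReal (K (T.op s.toNNReal f))) ?_ ?_ f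
  · rintro f ⟨h, hf⟩
    have hcf : Continuous fun s : ℝ => T.op s.toNNReal f := continuous_id.fellerOp T continuous_const
    have hcont : Continuous fun s : ℝ => Real.exp (-Λ * (t - s)) •
        S.op (t - s).toNNReal (T.op s.toNNReal f) := by
      have := (continuous_const.sub continuous_id (X := ℝ) (f := fun _ => t)).fellerOp S hcf
      exact Continuous.smul (f := fun s : ℝ => Real.exp (-Λ * (t - s))) (by fun_prop) this
    have hderiv : ∀ s ∈ Set.Ioo (0 : ℝ) t, HasDerivWithinAt (fun s : ℝ =>
        Real.exp (-Λ * (t - s)) • S.op (t - s).toNNReal (T.op s.toNNReal f))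
        (Real.exp (-Λ * (t - s)) • S.op (t - s).toNNReal (K (T.op s.toNNReal f)))
        (Set.Ioi s) s := by
      intro s hs
      set g := T.op s.toNNReal f with hg
      have hgen : T.Generates g (T.op s.toNNReal h) := hf.op _
      have hgenS := hT _ _ hgen
      have e1 : HasDerivWithinAt (fun r : ℝ => Real.exp (-Λ * (t - r)))
          (Λ * Real.exp (-Λ * (t - s))) (Set.Ioi s) s := by
        have : HasDerivAt (fun r : ℝ => Real.exp (-Λ * (t - r)))
            (Real.exp (-Λ * (t - s)) * (-Λ * (0 - 1))) s :=
          (((hasDerivAt_const s t).sub (hasDerivAt_id s)).const_mul (-Λ)).exp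
        exact this.hasDerivWithinAt.congr_deriv (by ring)
      -- The quotient between `s` and `r > s` equals `S_{t-r}` applied to the difference of the
      -- quotients of `T` and `S` at `g` over the time `r - s`. Only right derivatives at `0` and
      -- joint continuity of `S` are therefore needed.
      have e2 : HasDerivWithinAt (fun r : ℝ => S.op (t - r).toNNReal (T.op r.toNNReal f))
          (S.op (t - s).toNNReal (K g - Λ • g)) (Set.Ioi s) s := by
        rw [hasDerivWithinAt_iff_tendsto_slope' (by simp)]
        have h1 : Tendsto (fun r : ℝ => r - s) (𝓝[>] s) (𝓝[>] 0) := by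
          refine tendsto_nhdsWithin_iff.2 ⟨?_, ?_⟩
          · have : Continuous fun r : ℝ => r - s := by fun_prop
            simpa using (this.tendsto s).mono_left nhdsWithin_le_nhds
          · filter_upwards [self_mem_nhdsWithin] with r (hr : s < r)
            exact sub_pos.2 hr
        have d1 := hgen.tendsto_real.comp h1
        have d2 := hgenS.tendsto_real.comp h1
        have d3 := d1.sub d2
        rw [sub_sub_cancel] at d3
        have d4 : Tendsto (fun r : ℝ => (t - r).toNNReal) (𝓝[>] s) (𝓝 (t - s).toNNReal) := by
          have : Continuous fun r : ℝ => (t - r).toNNReal := by fun_prop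
          exact (this.tendsto s).mono_left nhdsWithin_le_nhds
        have d5 := (S.continuous_op.tendsto ((t - s).toNNReal, K g - Λ • g)).comp
          (d4.prodMk_nhds d3)
        refine d5.congr' ?_
        filter_upwards [self_mem_nhdsWithin,
          mem_nhdsWithin_of_mem_nhds (Iio_mem_nhds hs.2)] with r (hr : s < r) (hrt : r < t)
        have hr' : (0 : ℝ) ≤ r - s := (sub_pos.2 hr).le
        simp only [Function.comp_apply, slope_def_module]
        rw [← smul_sub, map_smul, sub_sub_sub_cancel_right, map_sub, hg,
          ← T.op_toNNReal_add hr' hs.1.le, sub_add_cancel, ← S.op_toNNReal_add (by linarith) hr',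
          sub_add_sub_cancel]
      refine (e1.smul e2).congr_deriv ?_
      rw [map_sub, map_smul, smul_sub, smul_smul, mul_comm Λ]
      abel
    have := intervalIntegral.integral_eq_sub_of_hasDeriv_right_of_le ht hcont.continuousOn hderiv
      ((hcK.comp (continuous_const.prodMk continuous_id)).intervalIntegrable _ _)
    rw [this]
    simp [S.op_zero, T.op_zero]
  · refine isClosed_eq (T.op _).continuous ?_
    have h1 : Continuous fun f => Real.exp (-Λ * t) • S.op t.toNNReal f := by fun_prop
    refine h1.add ?_
    exact intervalIntegral.continuous_parametric_intervalIntegral_of_continuous hcK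
      continuous_const
end FellerSemigroup

/-! ### The backward equation with a source, in mild form. -/

namespace FellerSemigroup

variable {X : Type*} [TopologicalSpace X] [CompactSpace X]

theorem stronglyMeasurable_op (S : FellerSemigroup X) {Y : Type*} [MeasurableSpace Y]
    {a : Y → ℝ} {ζ : Y → C(X, ℝ)} (ha : Measurable a) (hζ : StronglyMeasurable ζ) :
    StronglyMeasurable fun y => S.op (a y).toNNReal (ζ y) :=
  S.continuous_op.comp_stronglyMeasurable (ha.real_toNNReal.stronglyMeasurable.prodMk hζ)

/-- The solution `∫_s^b T_{r-s} ζ_r dr` of the backward equation with source `ζ`. -/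
noncomputable def backward (T : FellerSemigroup X) (ζ : ℝ → C(X, ℝ)) (b s : ℝ) : C(X, ℝ) :=
  ∫ r in Set.Ioc s b, T.op (r - s).toNNReal (ζ r)

section backward

variable {S T : FellerSemigroup X} {ζ : ℝ → C(X, ℝ)} {c : ℝ} {b : ℝ}

theorem stronglyMeasurable_backward (hζ : StronglyMeasurable ζ) :
    StronglyMeasurable (T.backward ζ b) := by
  have h1 : T.backward ζ b = fun s => ∫ r, {p : ℝ × ℝ | p.1 < p.2 ∧ p.2 ≤ b}.indicator
      (fun p => T.op (p.2 - p.1).toNNReal (ζ p.2)) (s, r) := by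
    funext s
    rw [backward, ← integral_indicator measurableSet_Ioc]
    rfl
  rw [h1]
  refine StronglyMeasurable.integral_prod_right (f := fun s r => {p : ℝ × ℝ | p.1 < p.2 ∧ p.2 ≤ b}.indicator
      (fun p => T.op (p.2 - p.1).toNNReal (ζ p.2)) (s, r)) ?_
  refine StronglyMeasurable.indicator ?_ ?_
  · exact T.stronglyMeasurable_op (measurable_snd.sub measurable_fst)
      (hζ.comp_measurable measurable_snd)
  · exact (measurableSet_lt measurable_fst measurable_snd).inter
      (measurableSet_le measurable_snd measurable_const)

theorem integrable_op_source (hζ : StronglyMeasurable ζ) (hc : ∀ r, ‖ζ r‖ ≤ c) (s a : ℝ) :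
    IntegrableOn (fun r => T.op (r - s).toNNReal (ζ r)) (Set.Ioc a b) := by
  refine Measure.integrableOn_of_bounded (M := c) (by simp) ?_ ?_
  · exact (T.stronglyMeasurable_op (measurable_id.sub_const s) hζ).aestronglyMeasurable
  · exact Eventually.of_forall fun r => (T.norm_op_apply_le _ _).trans (hc r)

theorem backward_apply (hζ : StronglyMeasurable ζ) (hc : ∀ r, ‖ζ r‖ ≤ c) (s : ℝ) (x : X) :
    T.backward ζ b s x = ∫ r in Set.Ioc s b, T.op (r - s).toNNReal (ζ r) x :=
  ((ContinuousMap.evalCLM ℝ x).integral_comp_comm (integrable_op_source hζ hc s s)).symm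

theorem norm_backward_le (hc : ∀ r, ‖ζ r‖ ≤ c) {s : ℝ} (hs : 0 ≤ s) :
    ‖T.backward ζ b s‖ ≤ c * |b| := by
  have hc0 : 0 ≤ c := (norm_nonneg _).trans (hc 0)
  have := norm_setIntegral_le_of_norm_le_const (μ := volume) (s := Set.Ioc s b)
    (f := fun r => T.op (r - s).toNNReal (ζ r)) (C := c) (by simp)
    (fun r _ => (T.norm_op_apply_le _ _).trans (hc r))
  refine this.trans ?_
  gcongr
  rw [Real.volume_real_Ioc]
  exact max_le ((sub_le_self _ hs).trans (le_abs_self b)) (abs_nonneg _)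

/-- The backward equation in mild form relative to the unperturbed semigroup. -/
theorem backward_eq {K : C(X, ℝ) →L[ℝ] C(X, ℝ)} {Λ : ℝ} (hΛ : 0 ≤ Λ)
    (hT : ∀ f h : C(X, ℝ), T.Generates f h → S.Generates f (h - (K f - Λ • f)))
    (hζ : StronglyMeasurable ζ) (hc : ∀ r, ‖ζ r‖ ≤ c) (s : ℝ) :
    T.backward ζ b s = ∫ u in Set.Ioc s b, Real.exp (-Λ * (u - s)) •
      S.op (u - s).toNNReal (ζ u + K (T.backward ζ b u)) := by
  have hc0 : 0 ≤ c := (norm_nonneg _).trans (hc 0)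
  set μ := volume.restrict (Set.Ioc s b) with hμ
  -- Duhamel's formula for `T_{r-s} ζ_r` produces a double integral over `s < u ≤ r ≤ b`. The
  -- indicator in `G'` extends it to a square, where Fubini applies.
  let G : ℝ → ℝ → C(X, ℝ) := fun u r => Real.exp (-Λ * (u - s)) •
      S.op (u - s).toNNReal (K (T.op (r - u).toNNReal (ζ r)))
  let G' : ℝ → ℝ → C(X, ℝ) := fun r u => {p : ℝ × ℝ | p.2 ≤ p.1}.indicator
    (fun p => G p.2 p.1) (r, u)
  have hexp : ∀ u, s < u → ‖Real.exp (-Λ * (u - s))‖ ≤ 1 := by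
    intro u hu
    rw [Real.norm_eq_abs, abs_of_nonneg (Real.exp_pos _).le, Real.exp_le_one_iff]
    nlinarith
  have hmG : StronglyMeasurable fun p : ℝ × ℝ => G p.2 p.1 := by
    have h1 : StronglyMeasurable fun p : ℝ × ℝ => T.op (p.1 - p.2).toNNReal (ζ p.1) :=
      T.stronglyMeasurable_op (measurable_fst.sub measurable_snd)
        (hζ.comp_measurable measurable_fst)
    have h2 := S.stronglyMeasurable_op (a := fun p : ℝ × ℝ => p.2 - s)
      (measurable_snd.sub_const s) (K.continuous.comp_stronglyMeasurable h1)
    have h3 : Measurable fun p : ℝ × ℝ => Real.exp (-Λ * (p.2 - s)) := by fun_prop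
    exact h3.stronglyMeasurable.smul h2
  have hmG' : StronglyMeasurable (Function.uncurry G') :=
    hmG.indicator (measurableSet_le measurable_snd measurable_fst)
  have hbG : ∀ u r, s < u → ‖G u r‖ ≤ ‖K‖ * c := by
    intro u r hu
    calc ‖G u r‖ ≤ 1 * (‖K‖ * c) := by
          simp only [G]
          rw [norm_smul]
          gcongr
          · exact hexp u hu
          · exact (S.norm_op_apply_le _ _).trans ((K.le_opNorm _).trans (by
              gcongr; exact (T.norm_op_apply_le _ _).trans (hc r)))
      _ = _ := one_mul _
  have hiG' : Integrable (Function.uncurry G') (μ.prod μ) := by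
    refine Integrable.of_bound hmG'.aestronglyMeasurable (‖K‖ * c) ?_
    have h1 : ∀ᵐ p ∂(μ.prod μ), p ∈ (Set.Ioc s b) ×ˢ (Set.Ioc s b) := by
      rw [hμ, Measure.prod_restrict]
      exact ae_restrict_mem (measurableSet_Ioc.prod measurableSet_Ioc)
    filter_upwards [h1] with p hp
    refine (norm_indicator_le_norm_self _ _).trans (hbG _ _ hp.2.1)
  have hiζ : IntegrableOn (fun r => Real.exp (-Λ * (r - s)) • S.op (r - s).toNNReal (ζ r))
      (Set.Ioc s b) := by
    refine Measure.integrableOn_of_bounded (M := 1 * c) (by simp) ?_ ?_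
    · have h3 : Measurable fun r : ℝ => Real.exp (-Λ * (r - s)) := by fun_prop
      exact (h3.stronglyMeasurable.smul (S.stronglyMeasurable_op (measurable_id.sub_const s)
        hζ)).aestronglyMeasurable
    · filter_upwards [ae_restrict_mem measurableSet_Ioc] with r hr
      rw [norm_smul]
      gcongr
      · exact hexp r hr.1
      · exact (S.norm_op_apply_le _ _).trans (hc r)
  have hduh : ∀ r ∈ Set.Ioc s b, T.op (r - s).toNNReal (ζ r)
      = Real.exp (-Λ * (r - s)) • S.op (r - s).toNNReal (ζ r) + ∫ u in Set.Ioc s b, G' r u := by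
    intro r hr
    rw [duhamel hT (ζ r) (sub_pos.2 hr.1).le]
    congr 1
    have h1 := intervalIntegral.integral_comp_sub_left (a := s) (b := r) (fun w =>
      Real.exp (-Λ * (r - s - w)) • S.op (r - s - w).toNNReal (K (T.op w.toNNReal (ζ r)))) r
    rw [sub_self] at h1
    rw [← h1, intervalIntegral.integral_of_le hr.1.le]
    have h2 : ∀ u, G' r u = (Set.Iic r).indicator (fun u => G u r) u := fun u => rfl
    simp only [h2]
    rw [setIntegral_indicator measurableSet_Iic]
    have h3 : Set.Ioc s b ∩ Set.Iic r = Set.Ioc s r := by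
      ext u; simp only [Set.mem_inter_iff, Set.mem_Ioc, Set.mem_Iic]
      constructor
      · rintro ⟨⟨h, -⟩, h'⟩; exact ⟨h, h'⟩
      · rintro ⟨h, h'⟩; exact ⟨⟨h, h'.trans hr.2⟩, h'⟩
    rw [h3]
    refine setIntegral_congr_fun measurableSet_Ioc fun u _ => ?_
    simp only [G]
    rw [show r - s - (r - u) = u - s by ring]
  have hinner : ∀ u ∈ Set.Ioc s b, ∫ r in Set.Ioc s b, G' r u
      = Real.exp (-Λ * (u - s)) • S.op (u - s).toNNReal (K (T.backward ζ b u)) := by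
    intro u hu
    have h2 : ∀ r, G' r u = (Set.Ici u).indicator (fun r => G u r) r := fun r => rfl
    simp only [h2]
    rw [setIntegral_indicator measurableSet_Ici]
    have h3 : Set.Ioc s b ∩ Set.Ici u = Set.Icc u b := by
      ext r; simp only [Set.mem_inter_iff, Set.mem_Ioc, Set.mem_Ici, Set.mem_Icc]
      constructor
      · rintro ⟨⟨-, h⟩, h'⟩; exact ⟨h', h⟩
      · rintro ⟨h, h'⟩; exact ⟨⟨hu.1.trans_le h, h'⟩, h⟩
    rw [h3, integral_Icc_eq_integral_Ioc, backward,
      ← K.integral_comp_comm (integrable_op_source hζ hc u u),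
      ← (S.op _).integral_comp_comm (K.integrable_comp (integrable_op_source hζ hc u u)),
      ← integral_smul]
  have hG'sw := integral_integral_swap hiG'
  calc T.backward ζ b s = ∫ r in Set.Ioc s b, (Real.exp (-Λ * (r - s)) •
        S.op (r - s).toNNReal (ζ r) + ∫ u in Set.Ioc s b, G' r u) :=
        setIntegral_congr_fun measurableSet_Ioc hduh
    _ = (∫ r in Set.Ioc s b, Real.exp (-Λ * (r - s)) • S.op (r - s).toNNReal (ζ r)) +
        ∫ r in Set.Ioc s b, ∫ u in Set.Ioc s b, G' r u :=
        integral_add hiζ hiG'.integral_prod_left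
    _ = (∫ r in Set.Ioc s b, Real.exp (-Λ * (r - s)) • S.op (r - s).toNNReal (ζ r)) +
        ∫ u in Set.Ioc s b, ∫ r in Set.Ioc s b, G' r u := by rw [hG'sw]
    _ = ∫ u in Set.Ioc s b, (Real.exp (-Λ * (u - s)) • S.op (u - s).toNNReal (ζ u) +
        ∫ r in Set.Ioc s b, G' r u) := (integral_add hiζ hiG'.integral_prod_right).symm
    _ = _ := by
        refine setIntegral_congr_fun measurableSet_Ioc fun u hu => ?_
        simp only [hinner u hu, map_add, smul_add]

theorem integrable_mild {K : C(X, ℝ) →L[ℝ] C(X, ℝ)} {Λ : ℝ} (hΛ : 0 ≤ Λ)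
    (hζ : StronglyMeasurable ζ) (hc : ∀ r, ‖ζ r‖ ≤ c) {s : ℝ} (hs : 0 ≤ s) :
    IntegrableOn (fun u => Real.exp (-Λ * (u - s)) •
      S.op (u - s).toNNReal (ζ u + K (T.backward ζ b u))) (Set.Ioc s b) := by
  refine Measure.integrableOn_of_bounded (M := 1 * (c + ‖K‖ * (c * |b|))) (by simp) ?_ ?_
  · have h3 : Measurable fun r : ℝ => Real.exp (-Λ * (r - s)) := by fun_prop
    refine (h3.stronglyMeasurable.smul (S.stronglyMeasurable_op (measurable_id.sub_const s)
      (hζ.add (K.continuous.comp_stronglyMeasurable ?_)))).aestronglyMeasurable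
    exact stronglyMeasurable_backward hζ
  · filter_upwards [ae_restrict_mem measurableSet_Ioc] with r hr
    rw [norm_smul]
    gcongr
    · rw [Real.norm_eq_abs, abs_of_nonneg (Real.exp_pos _).le, Real.exp_le_one_iff]
      nlinarith [hr.1]
    · refine (S.norm_op_apply_le _ _).trans ((norm_add_le _ _).trans ?_)
      gcongr
      · exact hc r
      · exact (K.le_opNorm _).trans (by gcongr; exact norm_backward_le hc (hs.trans hr.1.le))

/-- The backward equation started at time `0`, split at an intermediate time. -/
theorem backward_split {K : C(X, ℝ) →L[ℝ] C(X, ℝ)} {Λ : ℝ} (hΛ : 0 ≤ Λ)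
    (hT : ∀ f h : C(X, ℝ), T.Generates f h → S.Generates f (h - (K f - Λ • f)))
    (hζ : StronglyMeasurable ζ) (hc : ∀ r, ‖ζ r‖ ≤ c) {a : ℝ} (ha : 0 ≤ a) (hab : a ≤ b) :
    T.backward ζ b 0 = (∫ u in Set.Ioc 0 a, Real.exp (-Λ * u) •
      S.op u.toNNReal (ζ u + K (T.backward ζ b u))) +
      Real.exp (-Λ * a) • S.op a.toNNReal (T.backward ζ b a) := by
  have hi := integrable_mild (S := S) (T := T) (b := b) (K := K) hΛ hζ hc le_rfl
  have h0 := backward_eq (b := b) hΛ hT hζ hc 0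
  simp only [sub_zero] at hi h0
  rw [← Set.Ioc_union_Ioc_eq_Ioc ha hab] at h0 hi
  rw [setIntegral_union (Set.Ioc_disjoint_Ioc_of_le le_rfl) measurableSet_Ioc
    (hi.mono_set Set.subset_union_left) (hi.mono_set Set.subset_union_right)] at h0
  rw [h0]
  congr 1
  -- The integral left over `(a, b]` is `e^{-Λa} S_a` applied to the mild equation at time `a`.
  conv_rhs => rw [backward_eq (b := b) hΛ hT hζ hc a]
  rw [← (S.op _).integral_comp_comm (integrable_mild hΛ hζ hc ha), ← integral_smul]
  refine setIntegral_congr_fun measurableSet_Ioc fun u hu => ?_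
  rw [map_smul, smul_smul, ← Real.exp_add, ← S.op_toNNReal_add ha (sub_pos.2 hu.1).le,
    add_sub_cancel]
  congr 2
  ring

end backward

end FellerSemigroup

/-! ### Oscillation of a continuous function through single-site changes. -/

section Telescoping

variable {d : ℕ} {E : Type*} [MetricSpace E]

@[simp] theorem shift_apply (x y : Site d) (η : Config d E) : shift x η y = η (y - x) := rfl

/-- Changing one site at a time. -/
theorem ofReal_sub_le_tsum {h : Config d E → ℝ} (hh : Continuous h) {k : Site d → ℝ≥0∞}
    {η ξ : Config d E} (hk : ∀ (x : Site d) (p q : Config d E), p x = η x → q x = ξ x →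
      (∀ y, y ≠ x → p y = q y) → ENNReal.ofReal (h p - h q) ≤ k x) :
    ENNReal.ofReal (h η - h ξ) ≤ ∑' x, k x := by
  classical
  -- The configuration equal to `η` on a finite set and to `ξ` elsewhere changes at one site when
  -- the set grows by one. It converges to `η` in the product topology as the set exhausts the
  -- lattice.
  have hfin : ∀ s : Finset (Site d),
      ENNReal.ofReal (h (s.piecewise η ξ) - h ξ) ≤ ∑ x ∈ s, k x := by
    intro s
    induction s using Finset.induction_on with
    | empty => simp
    | insert a s ha ih =>
      rw [Finset.sum_insert ha]
      have e : h ((insert a s).piecewise η ξ) - h ξ =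
          (h ((insert a s).piecewise η ξ) - h (s.piecewise η ξ)) +
          (h (s.piecewise η ξ) - h ξ) := by ring
      rw [e]
      refine ENNReal.ofReal_add_le.trans (add_le_add ?_ ih)
      refine hk a _ _ (by simp) (by simp [ha]) fun y hy => ?_
      by_cases hys : y ∈ s <;> simp [Finset.piecewise, hys, hy]
  have hlim : Tendsto (fun s : Finset (Site d) => s.piecewise η ξ) atTop (𝓝 η) := by
    rw [tendsto_pi_nhds]
    intro y
    refine tendsto_const_nhds.congr' ?_
    filter_upwards [eventually_ge_atTop {y}] with s hs
    have : y ∈ s := hs (by simp)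
    simp [this]
  have hlim2 : Tendsto (fun s : Finset (Site d) => ENNReal.ofReal (h (s.piecewise η ξ) - h ξ))
      atTop (𝓝 (ENNReal.ofReal (h η - h ξ))) :=
    (ENNReal.continuous_ofReal.tendsto _).comp (((hh.tendsto η).comp hlim).sub_const _)
  exact le_of_tendsto hlim2 (Eventually.of_forall fun s => (hfin s).trans (ENNReal.sum_le_tsum s))

theorem ofReal_sub_le_lipConst {h : Config d E → ℝ} {x : Site d} {p : Config d E × Config d E}
    (hp : p ∈ diffAt x) :
    ENNReal.ofReal (h p.1 - h p.2) ≤ lipConst h x * edist (p.1 x) (p.2 x) := by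
  have hd : 0 < dist (p.1 x) (p.2 x) := dist_pos.2 hp.1
  have e : h p.1 - h p.2 = (h p.1 - h p.2) / dist (p.1 x) (p.2 x) * dist (p.1 x) (p.2 x) := by
    field_simp
  rw [e, ENNReal.ofReal_mul' hd.le, edist_dist]
  gcongr
  exact le_iSup₂_of_le (f := fun (p : Config d E × Config d E) (_ : p ∈ diffAt x) =>
    ENNReal.ofReal ((h p.1 - h p.2) / dist (p.1 x) (p.2 x))) p hp le_rfl

theorem ofReal_sub_le_tsum_lipConst {h : Config d E → ℝ} (hh : Continuous h) (η ξ : Config d E) :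
    ENNReal.ofReal (h η - h ξ) ≤ ∑' x, lipConst h x * edist (η x) (ξ x) := by
  refine ofReal_sub_le_tsum hh fun x p q hp hq hpq => ?_
  by_cases hx : p x = q x
  · have : p = q := funext fun y => by
      by_cases hy : y = x
      · rw [hy, hx]
      · exact hpq y hy
    simp [this]
  · rw [← hp, ← hq]
    exact ofReal_sub_le_lipConst (p := (p, q)) ⟨hx, hpq⟩

/-- Absorption needs the oscillation over arbitrary pairs, while the hypothesis of part (b) concerns
single-site pairs only; this is the bridge. -/
theorem ofReal_sub_le_tsum_iSup {h : Config d E → ℝ} (hh : Continuous h) (η ξ : Config d E) :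
    ENNReal.ofReal (h η - h ξ) ≤
      ∑' x, ⨆ p ∈ diffAt (E := E) x, ENNReal.ofReal (h p.1 - h p.2) := by
  refine ofReal_sub_le_tsum hh fun x p q hp hq hpq => ?_
  by_cases hx : p x = q x
  · have : p = q := funext fun y => by
      by_cases hy : y = x
      · rw [hy, hx]
      · exact hpq y hy
    simp [this]
  · exact le_iSup₂_of_le (f := fun (p : Config d E × Config d E) (_ : p ∈ diffAt x) =>
      ENNReal.ofReal (h p.1 - h p.2)) (p, q) ⟨hx, hpq⟩ le_rfl

theorem ofReal_sub_le_tripleNorm (hρ : ∀ a b : E, dist a b ≤ 1) {h : Config d E → ℝ}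
    (hh : Continuous h) (η ξ : Config d E) :
    ENNReal.ofReal (h η - h ξ) ≤ tripleNorm h := by
  refine (ofReal_sub_le_tsum_lipConst hh η ξ).trans (ENNReal.tsum_le_tsum fun x => ?_)
  have : edist (η x) (ξ x) ≤ 1 := by
    rw [edist_dist]; exact ENNReal.ofReal_le_one.2 (hρ _ _)
  calc lipConst h x * edist (η x) (ξ x) ≤ lipConst h x * 1 := by gcongr
    _ = _ := mul_one _

end Telescoping

/-! ### Uniformised jump rates and the bounded jump operator. -/

theorem ofReal_tsum_le {ι : Type*} {f : ι → ℝ} (hf : Summable f) :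
    ENNReal.ofReal (∑' i, f i) ≤ ∑' i, ENNReal.ofReal (f i) := by
  have h := (ENNReal.continuous_ofReal.tendsto _).comp hf.hasSum
  refine le_of_tendsto h (Eventually.of_forall fun s => ?_)
  refine le_trans ?_ (ENNReal.sum_le_tsum s)
  simp only [Function.comp_apply]
  classical
  induction s using Finset.induction_on with
  | empty => simp
  | insert a s ha ih =>
    rw [Finset.sum_insert ha, Finset.sum_insert ha]
    exact ENNReal.ofReal_add_le.trans (by gcongr)

theorem hasSum_tsum_clm_apply {ι V : Type*} [NormedAddCommGroup V] [NormedSpace ℝ V]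
    [CompleteSpace V] {M : ι → V →L[ℝ] V} {c : ι → ℝ} (hc : Summable c) (h : ∀ i, ‖M i‖ ≤ c i)
    (f : V) : HasSum (fun i => M i f) ((∑' i, M i) f) :=
  (Summable.of_norm_bounded hc h).hasSum.mapL (ContinuousLinearMap.apply ℝ V f)

section Rates

variable {d : ℕ} {E : Type*} [MetricSpace E] [CompactSpace E]

/-- The rates of the genuine jumps. -/
noncomputable def properRate (α : Site d → C(Config d E, ℝ)) (z : Site d) : C(Config d E, ℝ) :=
  if z = 0 then 0 else α z

/-- The total rate of a Poisson clock that dominates all jumps. -/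
noncomputable def clockRate (α : Site d → C(Config d E, ℝ)) : ℝ := ∑' z, ‖properRate α z‖

/-- The rates after adding fictitious jumps from a site to itself such that the total rate is
constant. -/
noncomputable def uniformRate (α : Site d → C(Config d E, ℝ)) (z : Site d) : C(Config d E, ℝ) :=
  properRate α z + if z = 0 then ContinuousMap.const _ (clockRate α) - ∑' z, properRate α z else 0

theorem norm_comp_le {X Y : Type*} [TopologicalSpace X] [CompactSpace X] [TopologicalSpace Y]
    [CompactSpace Y] (f : C(Y, ℝ)) (g : C(X, Y)) : ‖f.comp g‖ ≤ ‖f‖ := by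
  rw [ContinuousMap.norm_le _ (norm_nonneg _)]
  exact fun x => f.norm_coe_le_norm _

/-- The operator `h ↦ a · (h ∘ θ_{-z})`. -/
noncomputable def mulShift (a : C(Config d E, ℝ)) (z : Site d) :
    C(Config d E, ℝ) →L[ℝ] C(Config d E, ℝ) :=
  LinearMap.mkContinuous
    { toFun := fun f => a * f.comp (shift (-z))
      map_add' := fun f g => by ext; simp [mul_add]
      map_smul' := fun c f => by ext; simp } ‖a‖
    fun f => (norm_mul_le _ _).trans (by gcongr; exact norm_comp_le _ _)

theorem norm_mulShift_le (a : C(Config d E, ℝ)) (z : Site d) : ‖mulShift a z‖ ≤ ‖a‖ :=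
  LinearMap.mkContinuous_norm_le _ (norm_nonneg _) _

/-- The operator `h ↦ ∑_z A_z · (h ∘ θ_{-z})`. -/
noncomputable def jumpOp (A : Site d → C(Config d E, ℝ)) : C(Config d E, ℝ) →L[ℝ] C(Config d E, ℝ) :=
  ∑' z, mulShift (A z) z

variable {α A : Site d → C(Config d E, ℝ)}

theorem one_le_norm_site {z : Site d} (hz : z ≠ 0) : 1 ≤ ‖z‖ := by
  obtain ⟨i, hi⟩ := Function.ne_iff.1 hz
  refine le_trans ?_ (norm_le_pi_norm z i)
  rw [Int.norm_eq_abs]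
  exact_mod_cast Int.one_le_abs hi

/-- The first moment does not control the rate of the zero jump, which `properRate` discards because
it does not act; all other jumps have `‖z‖ ≥ 1`. -/
theorem summable_properRate (hα : Summable fun z : Site d => ‖z‖ * ‖α z‖) :
    Summable fun z => ‖properRate α z‖ := by
  refine Summable.of_nonneg_of_le (fun _ => norm_nonneg _) (fun z => ?_) hα
  by_cases hz : z = 0
  · simp [properRate, hz]
  · simp only [properRate, hz, if_false]
    exact le_mul_of_one_le_left (norm_nonneg _) (one_le_norm_site hz)

theorem properRate_nonneg (hα : ∀ z η, 0 ≤ α z η) (z : Site d) (η : Config d E) :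
    0 ≤ properRate α z η := by
  unfold properRate; split_ifs
  · simp
  · exact hα z η

theorem hasSum_properRate_apply (hα : Summable fun z : Site d => ‖z‖ * ‖α z‖) (η : Config d E) :
    HasSum (fun z => properRate α z η) ((∑' z, properRate α z) η) :=
  ((ContinuousMap.evalCLM ℝ η).hasSum (summable_properRate hα).of_norm.hasSum)

theorem properRate_le (z : Site d) (η : Config d E) :
    properRate α z η ≤ ‖properRate α z‖ := (le_abs_self _).trans ((properRate α z).norm_coe_le_norm η)

theorem uniformRate_nonneg (hα0 : ∀ z η, 0 ≤ α z η)
    (hα : Summable fun z : Site d => ‖z‖ * ‖α z‖) (z : Site d) (η : Config d E) :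
    0 ≤ uniformRate α z η := by
  rw [uniformRate, ContinuousMap.add_apply]
  refine add_nonneg (properRate_nonneg hα0 z η) ?_
  split_ifs
  · rw [ContinuousMap.sub_apply, ContinuousMap.const_apply, sub_nonneg]
    exact (hasSum_le (fun z => properRate_le z η) (hasSum_properRate_apply hα η)
      (summable_properRate hα).hasSum)
  · simp

theorem summable_norm_uniformRate (hα : Summable fun z : Site d => ‖z‖ * ‖α z‖) :
    Summable fun z => ‖uniformRate α z‖ := by
  refine Summable.of_nonneg_of_le (fun _ => norm_nonneg _) (fun z => norm_add_le _ _)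
    ((summable_properRate hα).add ?_)
  refine summable_of_ne_finset_zero (s := {0}) fun z hz => ?_
  simp [Finset.mem_singleton.not.1 hz]

theorem hasSum_uniformRate (hα : Summable fun z : Site d => ‖z‖ * ‖α z‖) (η : Config d E) :
    HasSum (fun z => uniformRate α z η) (clockRate α) := by
  have h2 : HasSum (fun z : Site d => (if z = 0 then ContinuousMap.const _ (clockRate α) -
      ∑' z, properRate α z else 0 : C(Config d E, ℝ)) η)
      (clockRate α - (∑' z, properRate α z) η) := by
    convert hasSum_ite_eq (0 : Site d) (clockRate α - (∑' z, properRate α z) η) using 2 with z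
    split_ifs <;> simp
  have := (hasSum_properRate_apply hα η).add h2
  rwa [add_sub_cancel] at this

theorem hasSum_jumpOp (hA : Summable fun z => ‖A z‖) (f : C(Config d E, ℝ)) (η : Config d E) :
    HasSum (fun z => A z η * f (shift (-z) η)) (jumpOp A f η) := by
  have h1 : HasSum (fun z => mulShift (A z) z f) (jumpOp A f) :=
    hasSum_tsum_clm_apply hA (fun z => norm_mulShift_le (A z) z) f
  exact h1.mapL (ContinuousMap.evalCLM ℝ η)

/-- Zero jumps do not move `f`, so `α` and `uniformRate α` give the same jump part, and the
constancy of the total rate turns the loss term into `-Λ f`. This is the hypothesis of `duhamel`. -/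
theorem generates_sub {S T : FellerSemigroup (Config d E)}
    (hT : IsEnvironmentProcessSemigroup S α T)
    (hα : Summable fun z : Site d => ‖z‖ * ‖α z‖) (f h : C(Config d E, ℝ))
    (hf : T.Generates f h) :
    S.Generates f (h - (jumpOp (uniformRate α) f - clockRate α • f)) := by
  obtain ⟨g, hg, hgh⟩ := (hT f h).1 hf
  convert hg using 1
  ext η
  rw [ContinuousMap.sub_apply, hgh η, ContinuousMap.sub_apply, ContinuousMap.smul_apply]
  have h1 := hasSum_jumpOp (summable_norm_uniformRate hα) f η
  have h2 := (hasSum_uniformRate hα η).mul_right (f η)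
  have h3 := h1.sub h2
  have h4 : (fun z => α z η * (f (shift (-z) η) - f η)) =
      fun z => uniformRate α z η * f (shift (-z) η) - uniformRate α z η * f η := by
    funext z
    by_cases hz : z = 0
    · subst hz
      have : shift (-0) η = η := by ext y; simp
      rw [this]; ring
    · simp [uniformRate, properRate, hz]; ring
  rw [h4, h3.tsum_eq, smul_eq_mul]
  ring

/-- The Lipschitz weights controlling the discrepancy of the rates. -/
noncomputable def rateWeight (α : Site d → C(Config d E, ℝ)) (y : Site d) : ℝ≥0∞ :=
  2 * ∑' z, lipConst (α z) y

theorem tsum_rateWeight (α : Site d → C(Config d E, ℝ)) :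
    ∑' y, rateWeight α y = 2 * ∑' z, tripleNorm (α z) := by
  simp only [rateWeight, ENNReal.tsum_mul_left, tripleNorm]
  rw [ENNReal.tsum_comm]

/-- The genuine jumps contribute the Lipschitz bounds once. The compensating rate at `0` contributes
them again with the configurations exchanged, whence the factor `2` in `rateWeight`. -/
theorem tsum_uniformRate_sub_le (hα : Summable fun z : Site d => ‖z‖ * ‖α z‖)
    (η ξ : Config d E) :
    ∑' z, ENNReal.ofReal (uniformRate α z η - uniformRate α z ξ) ≤
      ∑' y, rateWeight α y * edist (η y) (ξ y) := by
  have hp : ∀ (η ξ : Config d E) z, ENNReal.ofReal (properRate α z η - properRate α z ξ) ≤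
      ∑' y, lipConst (α z) y * edist (η y) (ξ y) := by
    intro η ξ z
    unfold properRate
    split_ifs
    · simp
    · exact ofReal_sub_le_tsum_lipConst (α z).continuous η ξ
  have h0 : ENNReal.ofReal ((∑' z, properRate α z) ξ - (∑' z, properRate α z) η) ≤
      ∑' z, ∑' y, lipConst (α z) y * edist (η y) (ξ y) := by
    have h1 := (hasSum_properRate_apply hα ξ).sub (hasSum_properRate_apply hα η)
    rw [← h1.tsum_eq]
    refine (ofReal_tsum_le h1.summable).trans (ENNReal.tsum_le_tsum fun z => ?_)
    simpa only [edist_comm] using hp ξ η z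
  have h1 : ∀ z, ENNReal.ofReal (uniformRate α z η - uniformRate α z ξ) ≤
      (∑' y, lipConst (α z) y * edist (η y) (ξ y)) + if z = 0 then
        ∑' z, ∑' y, lipConst (α z) y * edist (η y) (ξ y) else 0 := by
    intro z
    rw [uniformRate, ContinuousMap.add_apply, ContinuousMap.add_apply, add_sub_add_comm]
    refine ENNReal.ofReal_add_le.trans (add_le_add (hp η ξ z) ?_)
    split_ifs
    · simpa using h0
    · simp
  refine (ENNReal.tsum_le_tsum h1).trans ?_
  rw [ENNReal.tsum_add, tsum_ite_eq, ← two_mul, ENNReal.tsum_comm, ← ENNReal.tsum_mul_left]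
  refine le_of_eq (tsum_congr fun y => ?_)
  rw [ENNReal.tsum_mul_right, rateWeight, mul_assoc]

end Rates

/-! ### Measurability on path space. -/

namespace CadlagPath

section Basic

variable {X Y : Type*} [TopologicalSpace X] [MeasurableSpace X] [TopologicalSpace Y]
  [MeasurableSpace Y]

theorem measurable_at (t : ℝ≥0) : Measurable (CadlagPath.at (X := X) t) :=
  (comap_measurable (CadlagPath.at t)).mono
    (le_iSup (fun s : ℝ≥0 => MeasurableSpace.comap (CadlagPath.at (X := X) s) inferInstance) t)
    le_rfl

theorem measurable_at_filtration {s t : ℝ≥0} (h : s ≤ t) :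
    Measurable[canonicalFiltration X t] (CadlagPath.at (X := X) s) :=
  (comap_measurable (CadlagPath.at s)).mono
    (le_iSup₂ (f := fun (s : ℝ≥0) (_ : s ≤ t) =>
      MeasurableSpace.comap (CadlagPath.at (X := X) s) inferInstance) s h) le_rfl

theorem measurable_iff {Z : Type*} {m : MeasurableSpace Z} {F : Z → CadlagPath X} :
    Measurable F ↔ ∀ t, Measurable fun z => CadlagPath.at t (F z) := by
  constructor
  · exact fun h t => (measurable_at t).comp h
  · intro h
    refine measurable_iff_comap_le.2 ?_
    rw [CadlagPath.instMeasurableSpace, MeasurableSpace.comap_iSup]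
    refine iSup_le fun t => ?_
    rw [MeasurableSpace.comap_comp]
    exact (h t).comap_le

theorem measurable_map [OpensMeasurableSpace X] [BorelSpace Y] (g : C(X, Y)) :
    Measurable (CadlagPath.map g) :=
  measurable_iff.2 fun t => g.continuous.measurable.comp (measurable_at t)

/-- By right-continuity, time may be approximated from above by a grid of mesh `1/(n+1)`, which has
countably many points. The `+ 1` after the floor keeps the approximation to the right of `t`. -/
theorem measurable_eval [TopologicalSpace.PseudoMetrizableSpace X] [BorelSpace X] :
    Measurable fun p : ℝ≥0 × CadlagPath X => CadlagPath.at p.1 p.2 := by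
  have happ : ∀ n : ℕ, Measurable fun p : ℝ≥0 × CadlagPath X =>
      CadlagPath.at (((⌊((n : ℝ≥0) + 1) * p.1⌋₊ : ℝ≥0) + 1) / ((n : ℝ≥0) + 1)) p.2 := by
    intro n
    have h1 : Measurable fun q : ℕ × CadlagPath X =>
        CadlagPath.at (((q.1 : ℝ≥0) + 1) / ((n : ℝ≥0) + 1)) q.2 :=
      measurable_from_prod_countable_right fun k =>
        measurable_at (((k : ℝ≥0) + 1) / ((n : ℝ≥0) + 1))
    have h2 : Measurable fun p : ℝ≥0 × CadlagPath X =>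
        ((⌊((n : ℝ≥0) + 1) * p.1⌋₊ : ℕ), p.2) :=
      (Nat.measurable_floor.comp (measurable_fst.const_mul _)).prodMk measurable_snd
    exact h1.comp h2
  refine measurable_of_tendsto_metrizable happ ?_
  rw [tendsto_pi_nhds]
  rintro ⟨t, ω⟩
  have hr := (ω.2 t).1
  refine Tendsto.comp (f := fun n : ℕ =>
    (((⌊((n : ℝ≥0) + 1) * t⌋₊ : ℝ≥0) + 1) / ((n : ℝ≥0) + 1))) hr ?_
  refine tendsto_nhdsWithin_iff.2 ⟨?_, Eventually.of_forall fun n => ?_⟩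
  · have hu : Tendsto (fun n : ℕ => t + 1 / ((n : ℝ≥0) + 1)) atTop (𝓝 t) := by
      have h0 : Tendsto (fun n : ℕ => 1 / ((n : ℝ≥0) + 1)) atTop (𝓝 0) :=
        tendsto_one_div_add_atTop_nhds_zero_nat
      simpa using h0.const_add t
    refine tendsto_of_tendsto_of_tendsto_of_le_of_le tendsto_const_nhds hu (fun n => ?_)
      fun n => ?_
    · rw [le_div_iff₀ (by positivity), mul_comm]
      exact (Nat.lt_floor_add_one _).le
    · simp only
      rw [add_div]
      gcongr
      rw [div_le_iff₀ (by positivity), mul_comm t]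
      exact Nat.floor_le (by positivity)
  · rw [Set.mem_Ici, le_div_iff₀ (by positivity), mul_comm]
    exact (Nat.lt_floor_add_one _).le

/-- The path stopped at the deterministic time `v`. -/
def stopAt (v : ℝ≥0) (ω : CadlagPath X) : CadlagPath X :=
  ⟨fun t => ω.1 (min t v), fun t => by
    constructor
    · have hc : Continuous fun s : ℝ≥0 => min s v := by fun_prop
      refine ((ω.2 (min t v)).1).comp (f := fun s => min s v) hc.continuousWithinAt fun s hs => ?_
      exact min_le_min_right v hs
    · rcases le_or_gt t v with h | h
      · obtain ⟨l, hl⟩ := (ω.2 t).2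
        refine ⟨l, hl.congr' ?_⟩
        filter_upwards [self_mem_nhdsWithin] with s (hs : s < t)
        rw [min_eq_left (hs.le.trans h)]
      · refine ⟨ω.1 v, tendsto_const_nhds.congr' ?_⟩
        filter_upwards [mem_nhdsWithin_of_mem_nhds (Ioi_mem_nhds h)] with s (hs : v < s)
        rw [min_eq_right hs.le]⟩

theorem at_stopAt (v t : ℝ≥0) (ω : CadlagPath X) :
    CadlagPath.at t (stopAt v ω) = CadlagPath.at (min t v) ω := rfl

theorem measurable_stopAt (v : ℝ≥0) :
    Measurable[canonicalFiltration X v] (stopAt (X := X) v) :=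
  (measurable_iff (m := canonicalFiltration X v)).2 fun t =>
    measurable_at_filtration (min_le_right t v)

/-- A measurable functional that depends only on the path up to time `v` is `𝓕_v`-measurable. -/
theorem measurable_of_stopAt {Z : Type*} [MeasurableSpace Z] {v : ℝ≥0} {F : CadlagPath X → Z}
    (hF : Measurable F) (h : ∀ ω, F (stopAt v ω) = F ω) :
    Measurable[canonicalFiltration X v] F := by
  have : F = F ∘ stopAt v := funext fun ω => (h ω).symm
  rw [this]
  exact hF.comp (measurable_stopAt v)

end Basic

end CadlagPath

/-! ### The Markov property of one marginal in the filtration of the whole process. -/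

section MarkovProperty

variable {X Y : Type*} [TopologicalSpace X] [MeasurableSpace X] [BorelSpace X]
  [TopologicalSpace Y] [CompactSpace Y]

/-- The image `π(ω_·)` of the process has the Markov property with semigroup `S` with respect to
the filtration of the whole process. -/
def IsMarginallyMarkov (S : FellerSemigroup Y) (P : Measure (CadlagPath X)) (π : C(X, Y)) : Prop :=
  ∀ (v t : ℝ≥0), v ≤ t → ∀ f : C(Y, ℝ),
    condExp (canonicalFiltration X v) P (fun ω => f (π (CadlagPath.at t ω)))
      =ᵐ[P] fun ω => S.op (t - v) f (π (CadlagPath.at v ω))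

variable {S : FellerSemigroup Y} {P : Measure (CadlagPath X)} [IsProbabilityMeasure P] {π : C(X, Y)}

theorem measurable_observable (f : C(Y, ℝ)) (t : ℝ≥0) :
    Measurable fun ω : CadlagPath X => f (π (CadlagPath.at t ω)) :=
  (f.continuous.comp π.continuous).measurable.comp (CadlagPath.measurable_at t)

theorem integrable_observable (f : C(Y, ℝ)) (t : ℝ≥0) :
    Integrable (fun ω : CadlagPath X => f (π (CadlagPath.at t ω))) P :=
  Integrable.of_bound (measurable_observable f t).aestronglyMeasurable ‖f‖
    (Eventually.of_forall fun _ => f.norm_coe_le_norm _)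

/-- For indicators of `𝓕_v`-events this is the definition of conditional expectation; simple
functions and monotone limits follow. Working in `ℝ≥0∞` avoids integrability questions for the
arrival densities that will serve as `Q`. -/
theorem IsMarginallyMarkov.lintegral_mul (h : IsMarginallyMarkov S P π) {v t : ℝ≥0} (hvt : v ≤ t)
    {f : C(Y, ℝ)} (hf : 0 ≤ f) {Q : CadlagPath X → ℝ≥0∞}
    (hQ : Measurable[canonicalFiltration X v] Q) :
    ∫⁻ ω, Q ω * ENNReal.ofReal (f (π (CadlagPath.at t ω))) ∂P =
      ∫⁻ ω, Q ω * ENNReal.ofReal (S.op (t - v) f (π (CadlagPath.at v ω))) ∂P := by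
  have hle : canonicalFiltration X v ≤ CadlagPath.instMeasurableSpace X :=
    (canonicalFiltration X).le v
  have hm1 : Measurable fun ω : CadlagPath X => ENNReal.ofReal (f (π (CadlagPath.at t ω))) :=
    (measurable_observable f t).ennreal_ofReal
  have hm2 : Measurable fun ω : CadlagPath X =>
      ENNReal.ofReal (S.op (t - v) f (π (CadlagPath.at v ω))) :=
    (measurable_observable _ v).ennreal_ofReal
  refine Measurable.ennreal_induction (mα := canonicalFiltration X v)
    (motive := fun Q => ∫⁻ ω, Q ω * ENNReal.ofReal (f (π (CadlagPath.at t ω))) ∂P =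
      ∫⁻ ω, Q ω * ENNReal.ofReal (S.op (t - v) f (π (CadlagPath.at v ω))) ∂P) ?_ ?_ ?_ hQ
  · intro c B hB
    have hB' := hle B hB
    have e : ∀ g : CadlagPath X → ℝ≥0∞, Measurable g →
        ∫⁻ ω, B.indicator (fun _ => c) ω * g ω ∂P = c * ∫⁻ ω in B, g ω ∂P := by
      intro g hg
      rw [← lintegral_const_mul _ hg, ← lintegral_indicator hB']
      refine lintegral_congr fun ω => ?_
      by_cases hω : ω ∈ B <;> simp [hω]
    rw [e _ hm1, e _ hm2]
    congr 1
    rw [← ofReal_integral_eq_lintegral_ofReal (integrable_observable f t).integrableOn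
        (Eventually.of_forall fun ω => hf _),
      ← ofReal_integral_eq_lintegral_ofReal (integrable_observable _ v).integrableOn
        (Eventually.of_forall fun ω => S.op_nonneg _ f hf _)]
    congr 1
    rw [← setIntegral_condExp hle (integrable_observable f t) hB]
    exact setIntegral_congr_ae hB' ((h v t hvt f).mono fun ω hω _ => hω)
  · intro f g _ hf' hg' ih1 ih2
    have hf'' := hf'.mono hle le_rfl
    simp only [Pi.add_apply, add_mul]
    rw [lintegral_add_left (hf''.fun_mul hm1), lintegral_add_left (hf''.fun_mul hm2), ih1, ih2]
  · intro f hf' hmono ih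
    have hf'' : ∀ n, Measurable (f n) := fun n => (hf' n).mono hle le_rfl
    simp only [ENNReal.iSup_mul]
    rw [lintegral_iSup (fun n => (hf'' n).fun_mul hm1),
      lintegral_iSup (fun n => (hf'' n).fun_mul hm2)]
    · simp only [ih]
    · exact fun i j hij ω => by simp only; gcongr; exact hmono hij ω
    · exact fun i j hij ω => by simp only; gcongr; exact hmono hij ω

end MarkovProperty

/-! ### Consequences of translation invariance and of the marginal Markov property. -/

section Environment

variable {d : ℕ} {E : Type*} [MetricSpace E] [CompactSpace E] [SecondCountableTopology E]
  [MeasurableSpace E] [BorelSpace E] {env : Environment d E}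

theorem Environment.integral_at (env : Environment d E) (η : Config d E) (t : ℝ≥0)
    (f : C(Config d E, ℝ)) :
    ∫ ω, f (CadlagPath.at t ω) ∂(env.law η) = env.semigroup.op t f η := by
  have := env.isProbabilityMeasure η
  have h := env.markov η f 0 t zero_le
  rw [← integral_condExp ((canonicalFiltration (Config d E)).le 0), integral_congr_ae h, tsub_zero]
  have h2 : ∀ᵐ ω ∂(env.law η), env.semigroup.op t f (CadlagPath.at 0 ω) =
      env.semigroup.op t f η := (env.start η).mono fun ω hω => by rw [hω]
  rw [integral_congr_ae h2]
  simp

/-- The semigroup is read off from the one-time marginals of the path measures, so it inherits their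
invariance. This lets the environment be seen from any fixed site. -/
theorem Environment.IsTranslationInvariant.op_comp_shift (henv : env.IsTranslationInvariant)
    (x : Site d) (t : ℝ≥0) (f : C(Config d E, ℝ)) :
    env.semigroup.op t (f.comp (shift x)) = (env.semigroup.op t f).comp (shift x) := by
  ext η
  rw [ContinuousMap.comp_apply, ← env.integral_at, ← env.integral_at, ← henv x η,
    integral_map (CadlagPath.measurable_map _).aemeasurable]
  · rfl
  · exact (f.continuous.measurable.comp (CadlagPath.measurable_at t)).aestronglyMeasurable

variable {cpl : Coupling env}

theorem Coupling.lintegral_fst (cpl : Coupling env) (η ξ : Config d E) (t : ℝ≥0)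
    {f : C(Config d E, ℝ)} (hf : 0 ≤ f) :
    ∫⁻ ω, ENNReal.ofReal (f (CadlagPath.at t ω).1) ∂(cpl.law η ξ) =
      ENNReal.ofReal (env.semigroup.op t f η) := by
  have := cpl.isProbabilityMeasure η ξ
  rw [← env.integral_at, ← cpl.marginal_fst η ξ,
    integral_map (φ := CadlagPath.map ContinuousMap.fst) (f := fun ω => f (CadlagPath.at t ω))
    (CadlagPath.measurable_map _).aemeasurable
    (f.continuous.measurable.comp (CadlagPath.measurable_at t)).aestronglyMeasurable]
  exact (ofReal_integral_eq_lintegral_ofReal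
    (integrable_observable (π := ContinuousMap.fst) f t) (Eventually.of_forall fun ω => hf _)).symm

theorem Coupling.lintegral_snd (cpl : Coupling env) (η ξ : Config d E) (t : ℝ≥0)
    {f : C(Config d E, ℝ)} (hf : 0 ≤ f) :
    ∫⁻ ω, ENNReal.ofReal (f (CadlagPath.at t ω).2) ∂(cpl.law η ξ) =
      ENNReal.ofReal (env.semigroup.op t f ξ) := by
  have := cpl.isProbabilityMeasure η ξ
  rw [← env.integral_at, ← cpl.marginal_snd η ξ,
    integral_map (φ := CadlagPath.map ContinuousMap.snd) (f := fun ω => f (CadlagPath.at t ω))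
    (CadlagPath.measurable_map _).aemeasurable
    (f.continuous.measurable.comp (CadlagPath.measurable_at t)).aestronglyMeasurable]
  exact (ofReal_integral_eq_lintegral_ofReal
    (integrable_observable (π := ContinuousMap.snd) f t) (Eventually.of_forall fun ω => hf _)).symm

/-- Constant stopping times suffice: the common walk is described by densities at deterministic
times, never by a random killing time. -/
theorem Coupling.StrongMarginalMarkov.fst (h : cpl.StrongMarginalMarkov) (η ξ : Config d E) :
    IsMarginallyMarkov env.semigroup (cpl.law η ξ) ContinuousMap.fst := by
  intro v t hvt f
  have := (h η ξ f (fun _ => (v : WithTop ℝ≥0)) (isStoppingTime_const _ v) t).1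
  rw [IsStoppingTime.measurableSpace_const] at this
  have hvt' : (v : WithTop ℝ≥0) ≤ t := WithTop.coe_le_coe.2 hvt
  simp only [hvt', Set.ofPred_true, Set.indicator_univ, WithTop.untopD_coe] at this
  exact this

theorem Coupling.StrongMarginalMarkov.snd (h : cpl.StrongMarginalMarkov) (η ξ : Config d E) :
    IsMarginallyMarkov env.semigroup (cpl.law η ξ) ContinuousMap.snd := by
  intro v t hvt f
  have := (h η ξ f (fun _ => (v : WithTop ℝ≥0)) (isStoppingTime_const _ v) t).2
  rw [IsStoppingTime.measurableSpace_const] at this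
  have hvt' : (v : WithTop ℝ≥0) ≤ t := WithTop.coe_le_coe.2 hvt
  simp only [hvt', Set.ofPred_true, Set.indicator_univ, WithTop.untopD_coe] at this
  exact this

theorem Coupling.IsTranslationInvariant.meanDist_shift (h : cpl.IsTranslationInvariant)
    (η ξ : Config d E) (t : ℝ≥0) (x y : Site d) :
    cpl.meanDist (shift y η) (shift y ξ) t x = cpl.meanDist η ξ t (x - y) := by
  rw [Coupling.meanDist, ← h y η ξ, lintegral_map _ (CadlagPath.measurable_map _)]
  · rfl
  · have hc : Continuous fun p : Config d E × Config d E => edist (p.1 x) (p.2 x) := by fun_prop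
    exact hc.measurable.comp (CadlagPath.measurable_at t)

end Environment

/-! ### A nearly superharmonic weight under a first moment condition. -/

section Weight

variable {d : ℕ}

theorem tsum_pi_prod (d : ℕ) (f : ℤ → ℝ≥0∞) :
    ∑' y : Fin d → ℤ, ∏ i, f (y i) = (∑' k, f k) ^ d := by
  induction d with
  | zero => simp
  | succ d ih =>
    rw [← (Fin.consEquiv fun _ : Fin (d + 1) => ℤ).tsum_eq, ENNReal.tsum_prod', pow_succ', ← ih]
    simp only [Fin.prod_univ_succ, Fin.consEquiv_apply, Fin.cons_zero, Fin.cons_succ]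
    simp_rw [ENNReal.tsum_mul_left, ENNReal.tsum_mul_right]

/-- Each half-line is a geometric series of ratio `r = e^{-1/t}`, and `e^{1/t} ≥ 1 + 1/t` gives
`1/(1-r) ≤ 1 + t ≤ 2t`. -/
theorem tsum_exp_neg_abs_le {t : ℝ} (ht : 1 ≤ t) :
    ∑' k : ℤ, ENNReal.ofReal (Real.exp (-|(k : ℝ)| / t)) ≤ ENNReal.ofReal (4 * t) := by
  have ht0 : 0 < t := by linarith
  set r : ℝ := Real.exp (-1 / t) with hr
  have hr1 : r < 1 := Real.exp_lt_one_iff.2 (by rw [neg_div]; simp [ht0])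
  have hr0 : 0 ≤ r := (Real.exp_pos _).le
  have hgeo : ∑' n : ℕ, ENNReal.ofReal (r ^ n) ≤ ENNReal.ofReal (2 * t) := by
    rw [← ENNReal.ofReal_tsum_of_nonneg (fun n => pow_nonneg hr0 n)
      (summable_geometric_of_lt_one hr0 hr1), tsum_geometric_of_lt_one hr0 hr1]
    apply ENNReal.ofReal_le_ofReal
    have h1 : 1 / t + 1 ≤ Real.exp (1 / t) := Real.add_one_le_exp _
    have h2 : r * Real.exp (1 / t) = 1 := by
      rw [hr, ← Real.exp_add, neg_div, neg_add_cancel, Real.exp_zero]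
    have h3 : r * (1 / t + 1) ≤ 1 :=
      (mul_le_mul_of_nonneg_left h1 hr0).trans h2.le
    have h4 : r * (1 + t) ≤ t := by
      have := mul_le_mul_of_nonneg_right h3 ht0.le
      have e : r * (1 / t + 1) * t = r * (1 + t) := by field_simp
      linarith
    rw [inv_le_comm₀ (by linarith) (by linarith)]
    rw [inv_le_iff_one_le_mul₀ (by linarith)]
    nlinarith
  have hb : ∀ k : ℤ, ENNReal.ofReal (Real.exp (-|(k : ℝ)| / t)) = ENNReal.ofReal (r ^ k.natAbs) := by
    intro k
    rw [hr, ← Real.exp_nat_mul]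
    congr 2
    rw [Nat.cast_natAbs]
    push_cast
    ring
  simp_rw [hb]
  have hsplit : ∑' k : ℤ, ENNReal.ofReal (r ^ k.natAbs) ≤
      (∑' n : ℕ, ENNReal.ofReal (r ^ n)) + ∑' n : ℕ, ENNReal.ofReal (r ^ n) := by
    rw [← Equiv.intEquivNatSumNat.symm.tsum_eq, Summable.tsum_sum (by simp) (by simp)]
    refine add_le_add (ENNReal.tsum_le_tsum fun n => le_of_eq rfl) (ENNReal.tsum_le_tsum fun n => ?_)
    · change ENNReal.ofReal (r ^ (Int.negSucc n).natAbs) ≤ _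
      rw [Int.natAbs_negSucc]
      exact ENNReal.ofReal_le_ofReal (pow_le_pow_of_le_one hr0 hr1.le (Nat.le_succ n))
  calc _ ≤ _ := hsplit
    _ ≤ ENNReal.ofReal (2 * t) + ENNReal.ofReal (2 * t) := add_le_add hgeo hgeo
    _ = _ := by rw [← ENNReal.ofReal_add (by positivity) (by positivity)]; congr 1; ring

/-- An exponentially decaying weight at spatial scale `t`. -/
noncomputable def expWeight (t : ℝ) (y : Site d) : ℝ≥0∞ :=
  ∏ i, ENNReal.ofReal (Real.exp (-|(y i : ℝ)| / t))

theorem expWeight_zero (t : ℝ) : expWeight t (0 : Site d) = 1 := by simp [expWeight]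

theorem tsum_expWeight_le {t : ℝ} (ht : 1 ≤ t) :
    ∑' y : Site d, expWeight t y ≤ ENNReal.ofReal ((4 * t) ^ d) := by
  have := tsum_pi_prod d fun k : ℤ => ENNReal.ofReal (Real.exp (-|(k : ℝ)| / t))
  simp only [expWeight]
  rw [this, ENNReal.ofReal_pow (by positivity)]
  gcongr
  exact tsum_exp_neg_abs_le ht

theorem expWeight_add_le {t : ℝ} (ht : 0 < t) (y z : Site d) :
    expWeight t (y + z) ≤ ENNReal.ofReal (Real.exp (d * ‖z‖ / t)) * expWeight t y := by
  have h1 : ENNReal.ofReal (Real.exp (d * ‖z‖ / t)) =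
      ∏ _i : Fin d, ENNReal.ofReal (Real.exp (‖z‖ / t)) := by
    rw [Finset.prod_const, Finset.card_univ, Fintype.card_fin,
      ← ENNReal.ofReal_pow (Real.exp_pos _).le, ← Real.exp_nat_mul, mul_div_assoc]
  rw [h1, expWeight, expWeight, ← Finset.prod_mul_distrib]
  refine Finset.prod_le_prod' fun i _ => ?_
  rw [← ENNReal.ofReal_mul (Real.exp_pos _).le, ← Real.exp_add, ← add_div]
  apply ENNReal.ofReal_le_ofReal
  gcongr
  have h2 : |(z i : ℝ)| ≤ ‖z‖ := by
    have := norm_le_pi_norm z i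
    rwa [Int.norm_eq_abs] at this
  have h3 : |(y i : ℝ)| ≤ |((y + z) i : ℝ)| + |(z i : ℝ)| := by
    have := abs_sub ((y + z) i : ℝ) (z i : ℝ)
    simpa using this
  linarith

/-- The iterates of the exponential weight under the long jumps. -/
noncomputable def longJumpWeight (ν : Site d → ℝ≥0∞) (κ : ℝ≥0∞) (t : ℝ) : ℕ → Site d → ℝ≥0∞
  | 0, y => expWeight t y
  | k + 1, y => κ * ∑' z, {z | t < ‖z‖}.indicator ν z * longJumpWeight ν κ t k (y + z)

/-- The recursion is positive, linear and translation invariant, so this Harnack-type bound passes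
from the exponential weight to every iterate. -/
theorem longJumpWeight_add_le (ν : Site d → ℝ≥0∞) (κ : ℝ≥0∞) {t : ℝ} (ht : 0 < t) (k : ℕ)
    (y z : Site d) : longJumpWeight ν κ t k (y + z) ≤
      ENNReal.ofReal (Real.exp (d * ‖z‖ / t)) * longJumpWeight ν κ t k y := by
  induction k generalizing y with
  | zero => exact expWeight_add_le ht y z
  | succ k ih =>
    simp only [longJumpWeight]
    rw [mul_left_comm (ENNReal.ofReal _)]
    gcongr κ * ?_
    rw [← ENNReal.tsum_mul_left]
    refine ENNReal.tsum_le_tsum fun z' => ?_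
    rw [mul_left_comm (ENNReal.ofReal _), add_right_comm]
    gcongr
    exact ih _

/-- Summed over the lattice, one step of the long-jump recursion multiplies the mass by `κ ∑_{‖z‖>t}
ν z ≤ 1/2`. -/
theorem tsum_longJumpWeight_le (ν : Site d → ℝ≥0∞) {κ : ℝ≥0∞} {t : ℝ}
    (hκ : κ * ∑' z, {z | t < ‖z‖}.indicator ν z ≤ 2⁻¹) (k : ℕ) :
    ∑' y, longJumpWeight ν κ t k y ≤ 2⁻¹ ^ k * ∑' y : Site d, expWeight t y := by
  induction k with
  | zero => simp [longJumpWeight]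
  | succ k ih =>
    simp only [longJumpWeight]
    rw [ENNReal.tsum_mul_left, ENNReal.tsum_comm]
    have h1 : ∀ z : Site d, ∑' y, {z | t < ‖z‖}.indicator ν z * longJumpWeight ν κ t k (y + z) =
        {z | t < ‖z‖}.indicator ν z * ∑' y, longJumpWeight ν κ t k y := by
      intro z
      rw [ENNReal.tsum_mul_left]
      congr 1
      exact (Equiv.addRight z).tsum_eq _
    simp_rw [h1]
    rw [ENNReal.tsum_mul_right, ← mul_assoc, pow_succ', mul_assoc 2⁻¹]
    exact mul_le_mul' hκ ih

/-- A weight at spatial scale `t` that is nearly superharmonic, at rate `C / t`, for every random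
walk whose jump rates are dominated by `ν`. -/
theorem exists_superharmonic_weight {ν : Site d → ℝ≥0∞} {m : ℝ} (hm0 : 0 ≤ m)
    (hm : ∑' z, ENNReal.ofReal ‖z‖ * ν z ≤ ENNReal.ofReal m) {t : ℝ} (ht : 1 ≤ t) :
    ∃ w : Site d → ℝ≥0∞, 1 ≤ w 0 ∧ ∑' y, w y ≤ ENNReal.ofReal (2 * (4 * t) ^ d) ∧
      ∀ (b : Site d → ℝ≥0∞) (L : ℝ≥0∞), ∑' z, b z ≤ L → (∀ z, z ≠ 0 → b z ≤ ν z) → ∀ y,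
        ∑' z, b z * w (y + z) ≤
          (L + ENNReal.ofReal ((d * Real.exp d * m + 2 * (m + 1)) / t)) * w y := by
  have ht0 : 0 < t := by linarith
  -- Markov's inequality bounds the mass of jumps longer than `t` by `m/t`; times `κ` this is at
  -- most `m/(2(m+1)) ≤ 1/2`. The `+ 1` covers `m = 0`.
  set κ : ℝ≥0∞ := ENNReal.ofReal (t / (2 * (m + 1))) with hκdef
  have hκ0 : κ ≠ 0 := by rw [hκdef, Ne, ENNReal.ofReal_eq_zero, not_le]; positivity
  have hκ1 : κ⁻¹ = ENNReal.ofReal (2 * (m + 1) / t) := by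
    rw [hκdef, ← ENNReal.ofReal_inv_of_pos (by positivity), inv_div]
  have hκ : κ * ∑' z, {z : Site d | t < ‖z‖}.indicator ν z ≤ 2⁻¹ := by
    calc κ * ∑' z, {z : Site d | t < ‖z‖}.indicator ν z
        = ∑' z : Site d, κ * {z : Site d | t < ‖z‖}.indicator ν z := ENNReal.tsum_mul_left.symm
      _ ≤ ∑' z : Site d, ENNReal.ofReal (1 / (2 * (m + 1))) * (ENNReal.ofReal ‖z‖ * ν z) := by
          refine ENNReal.tsum_le_tsum fun z => ?_
          by_cases hz : t < ‖z‖
          · rw [Set.indicator_of_mem (by exact hz), ← mul_assoc,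
              ← ENNReal.ofReal_mul (by positivity)]
            gcongr
            rw [hκdef, one_div, div_eq_inv_mul]
            gcongr
          · rw [Set.indicator_of_notMem (by exact hz)]; simp
      _ ≤ ENNReal.ofReal (1 / (2 * (m + 1))) * ENNReal.ofReal m := by
          rw [ENNReal.tsum_mul_left]; gcongr
      _ ≤ ENNReal.ofReal 2⁻¹ := by
          rw [← ENNReal.ofReal_mul (by positivity)]
          apply ENNReal.ofReal_le_ofReal
          rw [one_div, inv_mul_le_iff₀ (by positivity)]
          linarith
      _ = 2⁻¹ := by rw [ENNReal.ofReal_inv_of_pos (by norm_num)]; simp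
  -- The exponential weight alone would require exponential moments. Applying the long-jump
  -- operator, scaled by `κ`, to the sum of the iterates only shifts the series by one index, so
  -- long jumps cost at most `κ⁻¹ w`.
  let w : Site d → ℝ≥0∞ := fun y => ∑' k, longJumpWeight ν κ t k y
  have hadd : ∀ y z, w (y + z) ≤ ENNReal.ofReal (Real.exp (d * ‖z‖ / t)) * w y := by
    intro y z
    simp only [w]
    rw [← ENNReal.tsum_mul_left]
    exact ENNReal.tsum_le_tsum fun k => longJumpWeight_add_le ν κ ht0 k y z
  have hlong : ∀ y, ∑' z, {z | t < ‖z‖}.indicator ν z * w (y + z) ≤ κ⁻¹ * w y := by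
    intro y
    rw [← ENNReal.mul_le_iff_le_inv hκ0 (by rw [hκdef]; exact ENNReal.ofReal_ne_top)]
    simp only [w]
    simp_rw [← ENNReal.tsum_mul_left]
    rw [ENNReal.tsum_comm]
    have e : ∀ k, ∑' z, κ * ({z | t < ‖z‖}.indicator ν z * longJumpWeight ν κ t k (y + z)) =
        longJumpWeight ν κ t (k + 1) y := by
      intro k
      rw [longJumpWeight, ENNReal.tsum_mul_left]
    simp_rw [e]
    conv_rhs => rw [tsum_eq_zero_add' ENNReal.summable]
    exact le_add_self
  refine ⟨w, ?_, ?_, ?_⟩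
  · calc (1 : ℝ≥0∞) = longJumpWeight ν κ t 0 (0 : Site d) := by
          rw [longJumpWeight, expWeight_zero]
      _ ≤ _ := ENNReal.le_tsum (f := fun k => longJumpWeight ν κ t k (0 : Site d)) 0
  · simp only [w]
    rw [ENNReal.tsum_comm]
    calc ∑' k, ∑' y, longJumpWeight ν κ t k y
        ≤ ∑' k : ℕ, 2⁻¹ ^ k * ∑' y : Site d, expWeight t y :=
          ENNReal.tsum_le_tsum fun k => tsum_longJumpWeight_le ν hκ k
      _ = 2 * ∑' y : Site d, expWeight t y := by
          rw [ENNReal.tsum_mul_right, ENNReal.tsum_geometric]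
          simp
      _ ≤ 2 * ENNReal.ofReal ((4 * t) ^ d) := by gcongr; exact tsum_expWeight_le ht
      _ = _ := by rw [ENNReal.ofReal_mul (by norm_num)]; simp
  · intro b L hL hb y
    have hterm : ∀ z, b z * w (y + z) ≤ b z * w y +
        (ENNReal.ofReal (d * Real.exp d / t) * (ENNReal.ofReal ‖z‖ * ν z) * w y +
        {z | t < ‖z‖}.indicator ν z * w (y + z)) := by
      intro z
      by_cases hz0 : z = 0
      · subst hz0; simp
      by_cases hz : t < ‖z‖
      · rw [Set.indicator_of_mem (by exact hz)]
        refine le_add_of_nonneg_of_le (zero_le) (le_add_of_nonneg_of_le zero_le ?_)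
        gcongr
        exact hb z hz0
      · rw [Set.indicator_of_notMem (by exact hz), zero_mul, add_zero]
        rw [not_lt] at hz
        -- With `x = d‖z‖/t ≤ d`, the inequality `e^x (1 - x) ≤ 1` gives `e^x ≤ 1 + x e^d`. This is
        -- linear in `‖z‖`, so the first moment controls short jumps.
        have hx : Real.exp (d * ‖z‖ / t) ≤ 1 + d * Real.exp d / t * ‖z‖ := by
          have hd : (d : ℝ) * ‖z‖ / t ≤ d := by
            rw [div_le_iff₀ ht0]; gcongr
          have h1 : Real.exp (d * ‖z‖ / t) * (1 - d * ‖z‖ / t) ≤ 1 := by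
            have := Real.add_one_le_exp (-(d * ‖z‖ / t))
            calc Real.exp (d * ‖z‖ / t) * (1 - d * ‖z‖ / t)
                ≤ Real.exp (d * ‖z‖ / t) * Real.exp (-(d * ‖z‖ / t)) := by
                  gcongr; linarith
              _ = 1 := by rw [← Real.exp_add, add_neg_cancel, Real.exp_zero]
          have h2 : Real.exp (d * ‖z‖ / t) * (d * ‖z‖ / t) ≤ Real.exp d * (d * ‖z‖ / t) := by
            gcongr
          have e : d * Real.exp d / t * ‖z‖ = Real.exp d * (d * ‖z‖ / t) := by ring
          rw [e]; linarith
        calc b z * w (y + z) ≤ b z * (ENNReal.ofReal (1 + d * Real.exp d / t * ‖z‖) * w y) := by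
              gcongr
              exact (hadd y z).trans (by gcongr)
          _ = b z * w y + ENNReal.ofReal (d * Real.exp d / t) * (ENNReal.ofReal ‖z‖ * b z) * w y := by
              rw [ENNReal.ofReal_add (by norm_num) (by positivity), ENNReal.ofReal_one,
                ENNReal.ofReal_mul (by positivity)]
              ring
          _ ≤ _ := by gcongr; exact hb z hz0
    calc ∑' z, b z * w (y + z) ≤ ∑' z, (b z * w y +
        (ENNReal.ofReal (d * Real.exp d / t) * (ENNReal.ofReal ‖z‖ * ν z) * w y +
        {z | t < ‖z‖}.indicator ν z * w (y + z))) := ENNReal.tsum_le_tsum hterm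
      _ = (∑' z, b z) * w y +
        (ENNReal.ofReal (d * Real.exp d / t) * (∑' z, ENNReal.ofReal ‖z‖ * ν z) * w y +
        ∑' z, {z | t < ‖z‖}.indicator ν z * w (y + z)) := by
          rw [ENNReal.tsum_add, ENNReal.tsum_add, ENNReal.tsum_mul_right, ENNReal.tsum_mul_right,
            ENNReal.tsum_mul_left]
      _ ≤ L * w y + (ENNReal.ofReal (d * Real.exp d / t) * ENNReal.ofReal m * w y +
          κ⁻¹ * w y) := by gcongr; exact hlong y
      _ = _ := by
          rw [hκ1, ← ENNReal.ofReal_mul (by positivity), ← add_mul, ← add_mul,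
            ← ENNReal.ofReal_add (by positivity) (by positivity)]
          congr 3
          ring

end Weight

/-! ### The killed walk in given rates and its growth bounds. -/

section WalkMass

variable {d : ℕ} {W : Type*} [MeasurableSpace W]

/-- For a walk on `ℤ^d` started at time `a` in the origin, which rings at rate `Λ` and jumps from
`y` to `y + z` at rate `b y z` (and is killed at the remaining rate), the probability that at time
`u` it is alive, at `y`, and has made exactly `n` jumps. The rates may depend on time and on a
random parameter `ω`. -/
noncomputable def walkMass (Λ a : ℝ) (b : Site d → Site d → ℝ × W → ℝ≥0∞) :
    ℕ → Site d → ℝ × W → ℝ≥0∞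
  | 0, y, p => if y = 0 then ENNReal.ofReal (Real.exp (-Λ * (p.1 - a))) else 0
  | n + 1, y, p => ∫⁻ v in Set.Ioc a p.1, ENNReal.ofReal (Real.exp (-Λ * (p.1 - v))) *
      ∑' z, walkMass Λ a b n (y - z) (v, p.2) * b (y - z) z (v, p.2)

/-- The density of the arrival at `y` with the `n + 1`-st jump. -/
noncomputable def arrival (Λ a : ℝ) (b : Site d → Site d → ℝ × W → ℝ≥0∞) (n : ℕ) (y : Site d)
    (p : ℝ × W) : ℝ≥0∞ :=
  ∑' z, walkMass Λ a b n (y - z) p * b (y - z) z p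

variable {Λ a : ℝ} {b : Site d → Site d → ℝ × W → ℝ≥0∞}

theorem walkMass_succ (n : ℕ) (y : Site d) (p : ℝ × W) :
    walkMass Λ a b (n + 1) y p = ∫⁻ v in Set.Ioc a p.1,
      ENNReal.ofReal (Real.exp (-Λ * (p.1 - v))) * arrival Λ a b n y (v, p.2) := rfl

theorem measurable_setLIntegral_Ioc {F : ℝ → ℝ × W → ℝ≥0∞}
    (hF : Measurable fun q : (ℝ × W) × ℝ => F q.2 q.1) :
    Measurable fun p : ℝ × W => ∫⁻ v in Set.Ioc a p.1, F v p := by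
  have h1 : (fun p : ℝ × W => ∫⁻ v in Set.Ioc a p.1, F v p) = fun p => ∫⁻ v,
      {q : (ℝ × W) × ℝ | a < q.2 ∧ q.2 ≤ q.1.1}.indicator (fun q => F q.2 q.1) (p, v) := by
    funext p
    rw [← lintegral_indicator measurableSet_Ioc]
    rfl
  rw [h1]
  refine Measurable.lintegral_prod_right' (f := {q : (ℝ × W) × ℝ | a < q.2 ∧ q.2 ≤ q.1.1}.indicator
    (fun q => F q.2 q.1)) (hF.indicator ?_)
  exact (measurableSet_lt measurable_const measurable_snd).inter
    (measurableSet_le measurable_snd measurable_fst.fst)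

theorem measurable_arrival_of (hb : ∀ y z, Measurable (b y z)) {n : ℕ}
    (h : ∀ y, Measurable (walkMass Λ a b n y)) (y : Site d) : Measurable (arrival Λ a b n y) :=
  Measurable.tsum fun z => (h (y - z)).mul (hb _ z)

theorem measurable_walkMass (hb : ∀ y z, Measurable (b y z)) (n : ℕ) (y : Site d) :
    Measurable (walkMass Λ a b n y) := by
  induction n generalizing y with
  | zero =>
    by_cases hy : y = 0
    · simp only [walkMass, hy, if_true]; fun_prop
    · simp only [walkMass, hy, if_false]; fun_prop
  | succ n ih =>
    refine measurable_setLIntegral_Ioc (F := fun v p =>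
      ENNReal.ofReal (Real.exp (-Λ * (p.1 - v))) * arrival Λ a b n y (v, p.2)) ?_
    refine Measurable.mul (by fun_prop) ?_
    exact (measurable_arrival_of hb ih y).comp (measurable_snd.prodMk measurable_fst.snd)

theorem measurable_arrival (hb : ∀ y z, Measurable (b y z)) (n : ℕ) (y : Site d) :
    Measurable (arrival Λ a b n y) :=
  measurable_arrival_of hb (measurable_walkMass hb n) y

/-- The walk up to time `v` depends only on the rates up to time `v`. -/
theorem walkMass_congr {v : ℝ} {ω ω' : W} (h : ∀ u ≤ v, ∀ y z, b y z (u, ω) = b y z (u, ω'))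
    (n : ℕ) (y : Site d) {u : ℝ} (hu : u ≤ v) :
    walkMass Λ a b n y (u, ω) = walkMass Λ a b n y (u, ω') := by
  induction n generalizing y u with
  | zero => rfl
  | succ n ih =>
    refine setLIntegral_congr_fun measurableSet_Ioc fun r hr => ?_
    have hr' := hr.2.trans hu
    simp only [ih _ hr', h r hr']

theorem arrival_congr {v : ℝ} {ω ω' : W} (h : ∀ u ≤ v, ∀ y z, b y z (u, ω) = b y z (u, ω'))
    (n : ℕ) (y : Site d) : arrival Λ a b n y (v, ω) = arrival Λ a b n y (v, ω') := by
  simp only [arrival, walkMass_congr h n _ le_rfl, h v le_rfl]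

/-- The substitution `y = x + z` moves the jump from the density to the test weight, where
superharmonicity can act. -/
theorem tsum_arrival_mul (n : ℕ) (p : ℝ × W) (w : Site d → ℝ≥0∞) :
    ∑' y, arrival Λ a b n y p * w y =
      ∑' x, walkMass Λ a b n x p * ∑' z, b x z p * w (x + z) := by
  simp only [arrival]
  simp_rw [← ENNReal.tsum_mul_right, ← ENNReal.tsum_mul_left]
  rw [ENNReal.tsum_comm]
  conv_rhs => rw [ENNReal.tsum_comm]
  refine tsum_congr fun z => ?_
  rw [← (Equiv.addRight z).tsum_eq]
  simp [mul_assoc]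

/-- The integrand is the derivative of `v ↦ e^{-Λ(u-v)+C(v-a)}`. The subtracted exponential is
exactly the no-jump term, so the bound `e^{C(u-a)}` reproduces itself under the recursion of the
walk. -/
theorem lintegral_exp_Ioc {C : ℝ} (hΛ : 0 ≤ Λ) (hC : 0 ≤ C) {u : ℝ} (hu : a ≤ u) :
    ∫⁻ v in Set.Ioc a u, ENNReal.ofReal (Real.exp (-Λ * (u - v))) *
      (ENNReal.ofReal (Λ + C) * ENNReal.ofReal (Real.exp (C * (v - a)))) =
      ENNReal.ofReal (Real.exp (C * (u - a)) - Real.exp (-Λ * (u - a))) := by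
  have hd : ∀ v, HasDerivAt (fun v => Real.exp (-Λ * (u - v) + C * (v - a)))
      (Real.exp (-Λ * (u - v)) * ((Λ + C) * Real.exp (C * (v - a)))) v := by
    intro v
    have h := ((((hasDerivAt_id v).const_sub u).const_mul (-Λ)).add
      (((hasDerivAt_id v).sub_const a).const_mul C)).exp
    refine h.congr_deriv ?_
    simp only [Pi.add_apply, id]
    rw [Real.exp_add]; ring
  have hc : Continuous fun v => Real.exp (-Λ * (u - v)) * ((Λ + C) * Real.exp (C * (v - a))) := by
    fun_prop
  have hi := intervalIntegral.integral_eq_sub_of_hasDerivAt (fun v _ => hd v)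
    (hc.intervalIntegrable a u)
  rw [intervalIntegral.integral_of_le hu] at hi
  simp only [sub_self, mul_zero, zero_add, add_zero] at hi
  rw [← hi, ofReal_integral_eq_lintegral_ofReal]
  · refine lintegral_congr fun v => ?_
    rw [ENNReal.ofReal_mul (Real.exp_pos _).le, ENNReal.ofReal_mul (by positivity)]
  · exact (hc.intervalIntegrable a u).1
  · exact Eventually.of_forall fun v => by positivity

/-- A weight that is superharmonic up to the rate `C` grows in mean at most like `exp (C t)`. -/
theorem sum_walkMass_mul_le (hΛ : 0 ≤ Λ) {C : ℝ} (hC : 0 ≤ C) (hb : ∀ y z, Measurable (b y z))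
    {w : Site d → ℝ≥0∞} {ω : W}
    (hw : ∀ u y, ∑' z, b y z (u, ω) * w (y + z) ≤ ENNReal.ofReal (Λ + C) * w y) (N : ℕ) {u : ℝ}
    (hu : a ≤ u) :
    ∑ n ∈ Finset.range N, ∑' y, walkMass Λ a b n y (u, ω) * w y ≤
      ENNReal.ofReal (Real.exp (C * (u - a))) * w 0 := by
  have hm : ∀ n y, Measurable fun v => arrival Λ a b n y (v, ω) := fun n y =>
    (measurable_arrival hb n y).comp (measurable_id.prodMk measurable_const)
  have hmw : ∀ n y, Measurable fun v => walkMass Λ a b n y (v, ω) := fun n y =>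
    (measurable_walkMass hb n y).comp (measurable_id.prodMk measurable_const)
  induction N generalizing u with
  | zero => simp
  | succ N ih =>
    -- The no-jump term is split off. Every other term is an integral over the last jump time, where
    -- superharmonicity replaces the jump by the factor `Λ + C`.
    rw [Finset.sum_range_succ']
    have h0 : ∑' y, walkMass Λ a b 0 y (u, ω) * w y =
        ENNReal.ofReal (Real.exp (-Λ * (u - a))) * w 0 := by
      rw [tsum_eq_single 0 fun y hy => by simp [walkMass, hy]]
      simp [walkMass]
    have h1 : ∀ n, ∑' y, walkMass Λ a b (n + 1) y (u, ω) * w y ≤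
        ∫⁻ v in Set.Ioc a u, ENNReal.ofReal (Real.exp (-Λ * (u - v))) * (ENNReal.ofReal (Λ + C) *
          ∑' y, walkMass Λ a b n y (v, ω) * w y) := by
      intro n
      calc ∑' y, walkMass Λ a b (n + 1) y (u, ω) * w y
          = ∑' y, ∫⁻ v in Set.Ioc a u, ENNReal.ofReal (Real.exp (-Λ * (u - v))) *
              arrival Λ a b n y (v, ω) * w y := by
            refine tsum_congr fun y => ?_
            rw [walkMass_succ, lintegral_mul_const]
            have := hm n y
            fun_prop
        _ = ∫⁻ v in Set.Ioc a u, ∑' y, ENNReal.ofReal (Real.exp (-Λ * (u - v))) *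
              arrival Λ a b n y (v, ω) * w y := by
            rw [lintegral_tsum]
            intro y
            have := hm n y
            fun_prop
        _ ≤ _ := by
            refine lintegral_mono fun v => ?_
            simp_rw [mul_assoc]
            rw [ENNReal.tsum_mul_left]
            gcongr
            rw [tsum_arrival_mul, ← ENNReal.tsum_mul_left]
            refine ENNReal.tsum_le_tsum fun x => ?_
            rw [mul_left_comm]
            gcongr
            exact hw v x
    calc _ ≤ (∑ n ∈ Finset.range N, ∫⁻ v in Set.Ioc a u,
          ENNReal.ofReal (Real.exp (-Λ * (u - v))) * (ENNReal.ofReal (Λ + C) *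
          ∑' y, walkMass Λ a b n y (v, ω) * w y)) +
          ENNReal.ofReal (Real.exp (-Λ * (u - a))) * w 0 := by
          rw [h0]; gcongr with n; exact h1 n
      _ = (∫⁻ v in Set.Ioc a u, ENNReal.ofReal (Real.exp (-Λ * (u - v))) *
            (ENNReal.ofReal (Λ + C) * ∑ n ∈ Finset.range N,
            ∑' y, walkMass Λ a b n y (v, ω) * w y)) +
          ENNReal.ofReal (Real.exp (-Λ * (u - a))) * w 0 := by
          rw [← lintegral_finsetSum]
          · simp_rw [Finset.mul_sum]
          · intro n _
            refine Measurable.mul (by fun_prop) (Measurable.mul (by fun_prop) ?_)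
            exact Measurable.tsum fun y => (hmw n y).mul_const _
      _ ≤ (∫⁻ v in Set.Ioc a u, ENNReal.ofReal (Real.exp (-Λ * (u - v))) *
            (ENNReal.ofReal (Λ + C) * ENNReal.ofReal (Real.exp (C * (v - a)))) * w 0) +
          ENNReal.ofReal (Real.exp (-Λ * (u - a))) * w 0 := by
          gcongr ?_ + _
          refine setLIntegral_mono' measurableSet_Ioc fun v hv => ?_
          rw [mul_assoc, mul_assoc]
          gcongr
          exact ih hv.1.le
      _ = _ := by
          rw [lintegral_mul_const _ (by fun_prop), lintegral_exp_Ioc hΛ hC hu, ← add_mul,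
            ← ENNReal.ofReal_add _ (Real.exp_pos _).le, sub_add_cancel]
          rw [sub_nonneg, Real.exp_le_exp]
          have : 0 ≤ u - a := sub_nonneg.2 hu
          nlinarith [mul_nonneg hΛ this, mul_nonneg hC this]

theorem tsum_walkMass_mul_le (hΛ : 0 ≤ Λ) {C : ℝ} (hC : 0 ≤ C) (hb : ∀ y z, Measurable (b y z))
    {w : Site d → ℝ≥0∞} {ω : W}
    (hw : ∀ u y, ∑' z, b y z (u, ω) * w (y + z) ≤ ENNReal.ofReal (Λ + C) * w y) {u : ℝ}
    (hu : a ≤ u) :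
    ∑' n, ∑' y, walkMass Λ a b n y (u, ω) * w y ≤
      ENNReal.ofReal (Real.exp (C * (u - a))) * w 0 :=
  ENNReal.tsum_le_of_sum_range_le fun N => sum_walkMass_mul_le hΛ hC hb hw N hu

theorem tsum_walkMass_le_one (hΛ : 0 ≤ Λ) (hb : ∀ y z, Measurable (b y z)) {ω : W}
    (hbΛ : ∀ u y, ∑' z, b y z (u, ω) ≤ ENNReal.ofReal Λ) {u : ℝ} (hu : a ≤ u) :
    ∑' n, ∑' y, walkMass Λ a b n y (u, ω) ≤ 1 := by
  have := tsum_walkMass_mul_le (w := fun _ => 1) (C := 0) hΛ le_rfl hb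
    (fun u y => by simpa using hbΛ u y) hu
  simpa using this

/-- The probability of being at `x`, uniformly in the rates. -/
theorem tsum_walkMass_apply_le (hΛ : 0 ≤ Λ) {C : ℝ} (hC : 0 ≤ C) (hb : ∀ y z, Measurable (b y z))
    {w : Site d → ℝ≥0∞} (hw0 : 1 ≤ w 0) {ω : W}
    (hw : ∀ u y x, ∑' z, b y z (u, ω) * w (x + z) ≤ ENNReal.ofReal (Λ + C) * w x) {u : ℝ}
    (hu : a ≤ u) (x : Site d) :
    ∑' n, walkMass Λ a b n x (u, ω) ≤ ENNReal.ofReal (Real.exp (C * (u - a))) * w (-x) := by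
  -- The weight is centred at `x`: mass at `x` carries `w 0 ≥ 1`, and the starting point carries `w
  -- (-x)`.
  have h := tsum_walkMass_mul_le (w := fun y => w (y - x)) hΛ hC hb (ω := ω)
    (fun u y => by simpa only [add_sub_right_comm] using hw u y (y - x)) hu
  rw [zero_sub] at h
  refine le_trans (ENNReal.tsum_le_tsum fun n => ?_) h
  refine le_trans ?_ (ENNReal.le_tsum x)
  rw [sub_self]
  exact le_mul_of_one_le_right zero_le hw0

end WalkMass

/-! ### Transport of a density along the environment until the next ring. -/

theorem lintegral_swap_of_measurable {α β : Type*} [MeasurableSpace α] [MeasurableSpace β]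
    {μ : Measure α} {ν : Measure β} [SFinite μ] [SFinite ν] (f : α → β → ℝ≥0∞)
    (hf : Measurable fun q : α × β => f q.1 q.2) :
    ∫⁻ x, ∫⁻ y, f x y ∂ν ∂μ = ∫⁻ y, ∫⁻ x, f x y ∂μ ∂ν :=
  lintegral_lintegral_swap hf.aemeasurable

theorem lintegral_triangle {Φ : ℝ × ℝ → ℝ≥0∞} (hΦ : Measurable Φ) (a b : ℝ) :
    ∫⁻ v in Set.Ioc a b, ∫⁻ u in Set.Ioc v b, Φ (v, u) =
      ∫⁻ u in Set.Ioc a b, ∫⁻ v in Set.Ioc a u, Φ (v, u) := by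
  have hD : MeasurableSet {p : ℝ × ℝ | p.1 ≤ p.2} := measurableSet_le measurable_fst measurable_snd
  have h1 : ∀ v ∈ Set.Ioc a b, ∫⁻ u in Set.Ioc v b, Φ (v, u) =
      ∫⁻ u in Set.Ioc a b, {p : ℝ × ℝ | p.1 ≤ p.2}.indicator Φ (v, u) := by
    intro v hv
    have e : ∀ u, {p : ℝ × ℝ | p.1 ≤ p.2}.indicator Φ (v, u) =
        (Set.Ici v).indicator (fun u => Φ (v, u)) u := fun u => rfl
    simp_rw [e]
    rw [setLIntegral_indicator measurableSet_Ici, setLIntegral_congr Ioc_ae_eq_Icc]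
    congr 2
    ext u
    simp only [Set.mem_Icc, Set.mem_inter_iff, Set.mem_Ici, Set.mem_Ioc]
    exact ⟨fun h => ⟨h.1, hv.1.trans_le h.1, h.2⟩, fun h => ⟨h.1, h.2.2⟩⟩
  have h2 : ∀ u ∈ Set.Ioc a b, ∫⁻ v in Set.Ioc a u, Φ (v, u) =
      ∫⁻ v in Set.Ioc a b, {p : ℝ × ℝ | p.1 ≤ p.2}.indicator Φ (v, u) := by
    intro u hu
    have e : ∀ v, {p : ℝ × ℝ | p.1 ≤ p.2}.indicator Φ (v, u) =
        (Set.Iic u).indicator (fun v => Φ (v, u)) v := fun u => rfl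
    simp_rw [e]
    rw [setLIntegral_indicator measurableSet_Iic]
    congr 2
    ext v
    simp only [Set.mem_inter_iff, Set.mem_Iic, Set.mem_Ioc]
    exact ⟨fun h => ⟨h.2, h.1, h.2.trans hu.2⟩, fun h => ⟨h.2.1, h.1⟩⟩
  rw [setLIntegral_congr_fun measurableSet_Ioc h1, setLIntegral_congr_fun measurableSet_Ioc h2]
  exact lintegral_lintegral_swap (hΦ.indicator hD).aemeasurable

theorem measurable_eval_stronglyMeasurable {Y Z : Type*} [TopologicalSpace Y] [CompactSpace Y]
    [TopologicalSpace.PseudoMetrizableSpace Y] [SecondCountableTopology Y] [MeasurableSpace Y]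
    [BorelSpace Y] [MeasurableSpace Z] {R : Z → C(Y, ℝ)} (hR : StronglyMeasurable R) {g : Z → Y}
    (hg : Measurable g) : Measurable fun z => R z (g z) := by
  have hc : Continuous fun p : C(Y, ℝ) × Y => p.1 p.2 := by fun_prop
  exact (hc.comp_stronglyMeasurable (hR.prodMk hg.stronglyMeasurable)).measurable

section Transport

variable {d : ℕ} {E : Type*} [MetricSpace E] [CompactSpace E] [SecondCountableTopology E]
  [MeasurableSpace E] [BorelSpace E]

/-- The configuration `π(ω_u)` as seen from `y`, for a path `ω` and a real time `u`. -/
def seenFrom {X : Type*} [TopologicalSpace X] (π : C(X, Config d E)) (y : Site d)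
    (p : ℝ × CadlagPath X) : Config d E :=
  shift (-y) (π (CadlagPath.at p.1.toNNReal p.2))

variable {X : Type*} [TopologicalSpace X] [TopologicalSpace.PseudoMetrizableSpace X]
  [MeasurableSpace X] [BorelSpace X]

theorem measurable_seenFrom (π : C(X, Config d E)) (y : Site d) :
    Measurable (seenFrom π y) := by
  have h1 : Measurable fun p : ℝ × CadlagPath X => CadlagPath.at p.1.toNNReal p.2 :=
    CadlagPath.measurable_eval.comp (measurable_fst.real_toNNReal.prodMk measurable_snd)
  exact ((shift (-y)).continuous.comp π.continuous).measurable.comp h1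

theorem seenFrom_add (π : C(X, Config d E)) (y z : Site d) (p : ℝ × CadlagPath X) :
    seenFrom π (y + z) p = shift (-z) (seenFrom π y p) := by
  ext x
  simp only [seenFrom, shift_apply, sub_neg_eq_add]
  rw [add_assoc, add_comm z y]

variable {S : FellerSemigroup (Config d E)} {P : Measure (CadlagPath X)} [IsProbabilityMeasure P]
  {π : C(X, Config d E)} {Λ a b : ℝ} {H R : ℝ → C(Config d E, ℝ)}

/-- The Markov property for the environment seen from `y`. -/
theorem lintegral_mul_seenFrom (hM : IsMarginallyMarkov S P π)
    (hS : ∀ x t f, S.op t (f.comp (shift x)) = (S.op t f).comp (shift x)) {v u : ℝ} (hv : 0 ≤ v)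
    (hvu : v ≤ u) (y : Site d) {f : C(Config d E, ℝ)} (hf : 0 ≤ f) {Q : CadlagPath X → ℝ≥0∞}
    (hQ : Measurable[canonicalFiltration X v.toNNReal] Q) :
    ∫⁻ ω, Q ω * ENNReal.ofReal (S.op (u - v).toNNReal f (seenFrom π y (v, ω))) ∂P =
      ∫⁻ ω, Q ω * ENNReal.ofReal (f (seenFrom π y (u, ω))) ∂P := by
  have h := hM.lintegral_mul (Real.toNNReal_le_toNNReal hvu) (f := f.comp (shift (-y)))
    (fun x => hf (shift (-y) x)) hQ
  have e : u.toNNReal - v.toNNReal = (u - v).toNNReal := by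
    rw [NNReal.sub_def, Real.coe_toNNReal _ hv, Real.coe_toNNReal _ (hv.trans hvu)]
  rw [hS, e] at h
  exact h.symm

/-- The environment part of `lintegral_transport` for a fixed starting time. -/
theorem lintegral_mul_eq_of_mild (hM : IsMarginallyMarkov S P π)
    (hS : ∀ x t f, S.op t (f.comp (shift x)) = (S.op t f).comp (shift x)) {e : ℝ × ℝ → ℝ≥0∞}
    (he : Measurable e) (hR : StronglyMeasurable R) (hR0 : ∀ u, 0 ≤ R u) {v : ℝ} (hv : 0 ≤ v)
    {h : C(Config d E, ℝ)}
    (hh : ∀ x, ENNReal.ofReal (h x) = ∫⁻ u in Set.Ioc v b,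
      e (v, u) * ENNReal.ofReal (S.op (u - v).toNNReal (R u) x)) (y : Site d)
    {Q : CadlagPath X → ℝ≥0∞} (hQa : Measurable[canonicalFiltration X v.toNNReal] Q) :
    ∫⁻ ω, Q ω * ENNReal.ofReal (h (seenFrom π y (v, ω))) ∂P =
      ∫⁻ u in Set.Ioc v b, e (v, u) *
        ∫⁻ ω, Q ω * ENNReal.ofReal (R u (seenFrom π y (u, ω))) ∂P := by
  have hQ : Measurable Q := hQa.mono ((canonicalFiltration X).le _) le_rfl
  have hm : Measurable fun q : CadlagPath X × ℝ => ENNReal.ofReal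
      (S.op (q.2 - v).toNNReal (R q.2) (seenFrom π y (v, q.1))) := by
    have h1 : StronglyMeasurable fun q : CadlagPath X × ℝ => R q.2 :=
      hR.comp_measurable measurable_snd
    have h2 : Measurable fun q : CadlagPath X × ℝ => q.2 - v := measurable_snd.sub_const v
    have h3 : Measurable fun q : CadlagPath X × ℝ => seenFrom π y (v, q.1) :=
      (measurable_seenFrom π y).comp (measurable_const.prodMk measurable_fst)
    exact (measurable_eval_stronglyMeasurable (S.stronglyMeasurable_op h2 h1) h3).ennreal_ofReal
  have hev : Measurable fun u => e (v, u) := he.comp measurable_prodMk_left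
  have h1 : ∀ ω, Q ω * ENNReal.ofReal (h (seenFrom π y (v, ω))) =
      ∫⁻ u in Set.Ioc v b, Q ω * (e (v, u) *
        ENNReal.ofReal (S.op (u - v).toNNReal (R u) (seenFrom π y (v, ω)))) := by
    intro ω
    have h2 := hm.comp (measurable_prodMk_left (x := ω))
    simp only [Function.comp_def] at h2
    rw [hh, ← lintegral_const_mul _ (hev.fun_mul h2)]
  simp_rw [h1]
  have h2 : Measurable fun q : CadlagPath X × ℝ => Q q.1 * (e (v, q.2) *
        ENNReal.ofReal (S.op (q.2 - v).toNNReal (R q.2) (seenFrom π y (v, q.1)))) :=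
    (hQ.comp measurable_fst).fun_mul ((hev.comp measurable_snd).fun_mul hm)
  refine (lintegral_swap_of_measurable (fun ω u => Q ω * (e (v, u) *
    ENNReal.ofReal (S.op (u - v).toNNReal (R u) (seenFrom π y (v, ω))))) h2).trans ?_
  refine setLIntegral_congr_fun measurableSet_Ioc fun u hu => ?_
  have h3 := hm.comp (measurable_prodMk_right (y := u))
  simp only [Function.comp_def] at h3
  simp_rw [mul_left_comm (Q _)]
  rw [lintegral_const_mul _ (hQ.fun_mul h3), lintegral_mul_seenFrom hM hS hv hu.1.le y (hR0 u) hQa]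

/-- Transport of a density of arrivals at `y` along the environment and up to the next jump. -/
theorem lintegral_transport (hM : IsMarginallyMarkov S P π)
    (hS : ∀ x t f, S.op t (f.comp (shift x)) = (S.op t f).comp (shift x)) (ha : 0 ≤ a)
    {e : ℝ × ℝ → ℝ≥0∞} (he : Measurable e)
    (hR : StronglyMeasurable R) (hR0 : ∀ u, 0 ≤ R u)
    (hHR : ∀ v ∈ Set.Ioc a b, ∀ x, ENNReal.ofReal (H v x) = ∫⁻ u in Set.Ioc v b,
      e (v, u) * ENNReal.ofReal (S.op (u - v).toNNReal (R u) x)) (y : Site d)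
    {Q : ℝ × CadlagPath X → ℝ≥0∞} (hQ : Measurable Q)
    (hQa : ∀ v, Measurable[canonicalFiltration X v.toNNReal] fun ω => Q (v, ω)) :
    ∫⁻ v in Set.Ioc a b, ∫⁻ ω, Q (v, ω) * ENNReal.ofReal (H v (seenFrom π y (v, ω))) ∂P =
      ∫⁻ u in Set.Ioc a b, ∫⁻ ω, (∫⁻ v in Set.Ioc a u, e (v, u) *
        Q (v, ω)) * ENNReal.ofReal (R u (seenFrom π y (u, ω))) ∂P := by
  have hRm : Measurable fun q : ℝ × CadlagPath X => ENNReal.ofReal (R q.1 (seenFrom π y q)) := by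
    have h1 : StronglyMeasurable fun q : ℝ × CadlagPath X => R q.1 :=
      hR.comp_measurable measurable_fst
    exact (measurable_eval_stronglyMeasurable h1 (measurable_seenFrom π y)).ennreal_ofReal
  have hm3 : Measurable fun q : (ℝ × ℝ) × CadlagPath X =>
      Q (q.1.1, q.2) * ENNReal.ofReal (R q.1.2 (seenFrom π y (q.1.2, q.2))) := by
    have h1 : Measurable fun q : (ℝ × ℝ) × CadlagPath X => Q (q.1.1, q.2) :=
      hQ.comp (measurable_fst.fst.prodMk measurable_snd)
    have h2 : Measurable fun q : (ℝ × ℝ) × CadlagPath X =>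
        ENNReal.ofReal (R q.1.2 (seenFrom π y (q.1.2, q.2))) :=
      hRm.comp (measurable_fst.snd.prodMk measurable_snd)
    exact h1.fun_mul h2
  have hΦ : Measurable fun p : ℝ × ℝ => e p *
      ∫⁻ ω, Q (p.1, ω) * ENNReal.ofReal (R p.2 (seenFrom π y (p.2, ω))) ∂P :=
    he.fun_mul (Measurable.lintegral_prod_right' hm3)
  rw [setLIntegral_congr_fun measurableSet_Ioc fun v hv => lintegral_mul_eq_of_mild hM hS he hR hR0
    (ha.trans hv.1.le) (hHR v hv) y (hQa v), lintegral_triangle hΦ]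
  refine lintegral_congr fun u => ?_
  have hRu : Measurable fun ω => ENNReal.ofReal (R u (seenFrom π y (u, ω))) :=
    hRm.comp measurable_prodMk_left
  have hQe : Measurable fun q : ℝ × CadlagPath X => e (q.1, u) * Q q :=
    (he.comp (measurable_fst.prodMk measurable_const)).fun_mul hQ
  have h1 : ∀ v, e (v, u) * ∫⁻ ω, Q (v, ω) * ENNReal.ofReal (R u (seenFrom π y (u, ω))) ∂P =
      ∫⁻ ω, e (v, u) * Q (v, ω) * ENNReal.ofReal (R u (seenFrom π y (u, ω))) ∂P := by
    intro v
    have h2 : Measurable fun ω => Q (v, ω) := hQ.comp measurable_prodMk_left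
    rw [← lintegral_const_mul _ (h2.fun_mul hRu)]
    simp_rw [mul_assoc]
  simp_rw [h1]
  have h3 : Measurable fun q : ℝ × CadlagPath X => e (q.1, u) * Q (q.1, q.2) *
      ENNReal.ofReal (R u (seenFrom π y (u, q.2))) := hQe.fun_mul (hRu.comp measurable_snd)
  refine (lintegral_swap_of_measurable (fun v ω => e (v, u) * Q (v, ω) *
    ENNReal.ofReal (R u (seenFrom π y (u, ω)))) h3).trans ?_
  refine lintegral_congr fun ω => ?_
  have h4 : Measurable fun v => e (v, u) * Q (v, ω) :=
    hQe.comp measurable_prodMk_right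
  rw [lintegral_mul_const _ h4]

end Transport

/-! ### Expansion of the backward solution along the jumps of the walk. -/

theorem apply_nonneg {X : Type*} [TopologicalSpace X] {f : C(X, ℝ)} (hf : 0 ≤ f) (x : X) :
    (0 : ℝ) ≤ f x := hf x

/-- The mild backward equation in terms of lower integrals. -/
theorem ofReal_backward_apply {X : Type*} [TopologicalSpace X] [CompactSpace X]
    {S T : FellerSemigroup X} {ζ : ℝ → C(X, ℝ)} {c b : ℝ} {K : C(X, ℝ) →L[ℝ] C(X, ℝ)} {Λ : ℝ}
    (hΛ : 0 ≤ Λ)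
    (hT : ∀ f h : C(X, ℝ), T.Generates f h → S.Generates f (h - (K f - Λ • f)))
    (hζ : StronglyMeasurable ζ) (hc : ∀ r, ‖ζ r‖ ≤ c)
    (hR : ∀ u, 0 ≤ ζ u + K (T.backward ζ b u)) {v : ℝ} (hv : 0 ≤ v) (x : X) :
    ENNReal.ofReal (T.backward ζ b v x) = ∫⁻ u in Set.Ioc v b,
      ENNReal.ofReal (Real.exp (-Λ * (u - v))) *
        ENNReal.ofReal (S.op (u - v).toNNReal (ζ u + K (T.backward ζ b u)) x) := by
  have hi := FellerSemigroup.integrable_mild (S := S) (T := T) (b := b) (K := K) hΛ hζ hc hv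
  have h1 : T.backward ζ b v x = ∫ u in Set.Ioc v b, Real.exp (-Λ * (u - v)) *
      S.op (u - v).toNNReal (ζ u + K (T.backward ζ b u)) x := by
    rw [FellerSemigroup.backward_eq hΛ hT hζ hc v]
    exact ((ContinuousMap.evalCLM ℝ x).integral_comp_comm hi).symm
  have h2 : Integrable (fun u => Real.exp (-Λ * (u - v)) *
      S.op (u - v).toNNReal (ζ u + K (T.backward ζ b u)) x) (volume.restrict (Set.Ioc v b)) :=
    (ContinuousMap.evalCLM ℝ x).integrable_comp hi
  rw [h1, ofReal_integral_eq_lintegral_ofReal h2 (Eventually.of_forall fun u =>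
    mul_nonneg (Real.exp_pos _).le (S.op_nonneg _ _ (hR u) x))]
  refine lintegral_congr fun u => ?_
  rw [ENNReal.ofReal_mul (Real.exp_pos _).le]

theorem backward_nonneg {X : Type*} [TopologicalSpace X] [CompactSpace X]
    {T : FellerSemigroup X} {ζ : ℝ → C(X, ℝ)} {c b : ℝ}
    (hζ : StronglyMeasurable ζ) (hc : ∀ r, ‖ζ r‖ ≤ c) (hζ0 : ∀ r, 0 ≤ ζ r) (s : ℝ) :
    0 ≤ T.backward ζ b s := by
  intro x
  change (0 : ℝ) ≤ T.backward ζ b s x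
  rw [FellerSemigroup.backward_apply hζ hc]
  exact integral_nonneg fun r => T.op_nonneg _ _ (hζ0 r) x

section Core

variable {d : ℕ} {E : Type*} [MetricSpace E] [CompactSpace E] [SecondCountableTopology E]
  [MeasurableSpace E] [BorelSpace E]
  {X : Type*} [TopologicalSpace X] [TopologicalSpace.PseudoMetrizableSpace X]
  [MeasurableSpace X] [BorelSpace X]

theorem seenFrom_stopAt (π : C(X, Config d E)) (y : Site d) {u v : ℝ} (huv : u ≤ v)
    (ω : CadlagPath X) :
    seenFrom π y (u, CadlagPath.stopAt v.toNNReal ω) = seenFrom π y (u, ω) := by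
  simp only [seenFrom, CadlagPath.at_stopAt, min_eq_left (Real.toNNReal_le_toNNReal huv)]

theorem ofReal_jumpOp {A : Site d → C(Config d E, ℝ)} (hA0 : ∀ z η, 0 ≤ A z η)
    (hA : Summable fun z => ‖A z‖) {f : C(Config d E, ℝ)} (hf : 0 ≤ f) (η : Config d E) :
    ENNReal.ofReal (jumpOp A f η) =
      ∑' z, ENNReal.ofReal (A z η) * ENNReal.ofReal (f (shift (-z) η)) := by
  have h := hasSum_jumpOp hA f η
  rw [← h.tsum_eq, ENNReal.ofReal_tsum_of_nonneg (fun z => mul_nonneg (hA0 z η) (apply_nonneg hf _)) h.summable]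
  simp_rw [ENNReal.ofReal_mul (hA0 _ η)]

theorem jumpOp_nonneg {A : Site d → C(Config d E, ℝ)} (hA0 : ∀ z η, 0 ≤ A z η)
    (hA : Summable fun z => ‖A z‖) {f : C(Config d E, ℝ)} (hf : 0 ≤ f) : 0 ≤ jumpOp A f :=
  fun η => (hasSum_jumpOp hA f η).nonneg fun z => mul_nonneg (hA0 z η) (hf _)

variable {A : Site d → C(Config d E, ℝ)} {Λ a t : ℝ} {ζ H : ℝ → C(Config d E, ℝ)}
  {b c : Site d → Site d → ℝ × CadlagPath X → ℝ≥0∞}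
  {S : FellerSemigroup (Config d E)} {P : Measure (CadlagPath X)} [IsProbabilityMeasure P]
  {π : C(X, Config d E)}

/-- What is collected at `y` by the common walk: the source, and the value of the backward solution
when the walk is killed. -/
noncomputable def gain (π : C(X, Config d E)) (ζ H : ℝ → C(Config d E, ℝ))
    (c : Site d → Site d → ℝ × CadlagPath X → ℝ≥0∞) (y : Site d) (p : ℝ × CadlagPath X) : ℝ≥0∞ :=
  ENNReal.ofReal (ζ p.1 (seenFrom π y p)) +
    ∑' z, c y z p * ENNReal.ofReal (H p.1 (seenFrom π (y + z) p))

theorem measurable_ofReal_seenFrom {F : ℝ → C(Config d E, ℝ)} (hF : StronglyMeasurable F)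
    (π : C(X, Config d E)) (y : Site d) :
    Measurable fun p : ℝ × CadlagPath X => ENNReal.ofReal (F p.1 (seenFrom π y p)) := by
  have h1 : StronglyMeasurable fun q : ℝ × CadlagPath X => F q.1 :=
    hF.comp_measurable measurable_fst
  exact (measurable_eval_stronglyMeasurable h1 (measurable_seenFrom π y)).ennreal_ofReal

theorem measurable_gain (hζ : StronglyMeasurable ζ) (hH : StronglyMeasurable H)
    (hc : ∀ y z, Measurable (c y z)) (y : Site d) : Measurable (gain π ζ H c y) :=
  (measurable_ofReal_seenFrom hζ π y).fun_add
    (Measurable.tsum fun z => (hc y z).fun_mul (measurable_ofReal_seenFrom hH π (y + z)))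

/-- The full jump rate splits into the common part `b`, which feeds the next arrivals, and the
killed part `c`, which is paid out at once with the value of `H` at the target. -/
theorem tsum_walkMass_mul_eq (hA0 : ∀ z η, 0 ≤ A z η) (hA : Summable fun z => ‖A z‖)
    (hζ0 : ∀ u, 0 ≤ ζ u) (hH0 : ∀ u, 0 ≤ H u)
    (hbc : ∀ y z p, ENNReal.ofReal (A z (seenFrom π y p)) = b y z p + c y z p) (n : ℕ)
    (p : ℝ × CadlagPath X) :
    ∑' y, walkMass Λ a b n y p * ENNReal.ofReal ((ζ p.1 + jumpOp A (H p.1)) (seenFrom π y p)) =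
      ∑' y, walkMass Λ a b n y p * gain π ζ H c y p +
        ∑' y, arrival Λ a b n y p * ENNReal.ofReal (H p.1 (seenFrom π y p)) := by
  rw [tsum_arrival_mul, ← ENNReal.tsum_add]
  refine tsum_congr fun y => ?_
  rw [← mul_add, ContinuousMap.add_apply, ENNReal.ofReal_add (apply_nonneg (hζ0 _) _)
    (apply_nonneg (jumpOp_nonneg hA0 hA (hH0 _)) _), ofReal_jumpOp hA0 hA (hH0 _), gain, add_assoc,
    ← ENNReal.tsum_add]
  congr 2
  refine tsum_congr fun z => ?_
  rw [hbc, seenFrom_add, add_comm (b y z p), add_mul]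

/-- Collected gain along the common walk with exactly `n` jumps. -/
noncomputable def gainIntegral (P : Measure (CadlagPath X)) (Λ a t : ℝ)
    (b : Site d → Site d → ℝ × CadlagPath X → ℝ≥0∞) (g : Site d → ℝ × CadlagPath X → ℝ≥0∞)
    (n : ℕ) : ℝ≥0∞ :=
  ∫⁻ u in Set.Ioc a t, ∫⁻ ω, ∑' y, walkMass Λ a b n y (u, ω) * g y (u, ω) ∂P

/-- Expected value at the `n + 1`-st jump. -/
noncomputable def arrivalIntegral (P : Measure (CadlagPath X)) (Λ a t : ℝ)
    (b : Site d → Site d → ℝ × CadlagPath X → ℝ≥0∞) (g : Site d → ℝ × CadlagPath X → ℝ≥0∞)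
    (n : ℕ) : ℝ≥0∞ :=
  ∫⁻ u in Set.Ioc a t, ∫⁻ ω, ∑' y, arrival Λ a b n y (u, ω) * g y (u, ω) ∂P

theorem lintegral_lintegral_add {f g : ℝ × CadlagPath X → ℝ≥0∞} (hf : Measurable f) (a t : ℝ) :
    ∫⁻ u in Set.Ioc a t, ∫⁻ ω, f (u, ω) + g (u, ω) ∂P =
      (∫⁻ u in Set.Ioc a t, ∫⁻ ω, f (u, ω) ∂P) + ∫⁻ u in Set.Ioc a t, ∫⁻ ω, g (u, ω) ∂P := by
  have h1 : ∀ u, ∫⁻ ω, f (u, ω) + g (u, ω) ∂P = ∫⁻ ω, f (u, ω) ∂P + ∫⁻ ω, g (u, ω) ∂P :=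
    fun u => lintegral_add_left (hf.comp (measurable_prodMk_left (x := u))) _
  simp_rw [h1]
  exact lintegral_add_left (Measurable.lintegral_prod_right' hf) _

theorem lintegral_lintegral_tsum {ι : Type*} [Countable ι] {f : ι → ℝ × CadlagPath X → ℝ≥0∞}
    (hf : ∀ i, Measurable (f i)) (a t : ℝ) :
    ∫⁻ u in Set.Ioc a t, ∫⁻ ω, ∑' i, f i (u, ω) ∂P =
      ∑' i, ∫⁻ u in Set.Ioc a t, ∫⁻ ω, f i (u, ω) ∂P := by
  have h1 : ∀ u, ∫⁻ ω, ∑' i, f i (u, ω) ∂P = ∑' i, ∫⁻ ω, f i (u, ω) ∂P :=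
    fun u => lintegral_tsum fun i =>
      ((hf i).comp (measurable_prodMk_left (x := u))).aemeasurable
  simp_rw [h1]
  exact lintegral_tsum fun i => (Measurable.lintegral_prod_right' (hf i)).aemeasurable

theorem gainIntegral_add_arrivalIntegral (hA0 : ∀ z η, 0 ≤ A z η) (hA : Summable fun z => ‖A z‖)
    (hζ0 : ∀ u, 0 ≤ ζ u) (hH0 : ∀ u, 0 ≤ H u) (hζ : StronglyMeasurable ζ)
    (hH : StronglyMeasurable H) (hb : ∀ y z, Measurable (b y z)) (hc : ∀ y z, Measurable (c y z))
    (hbc : ∀ y z p, ENNReal.ofReal (A z (seenFrom π y p)) = b y z p + c y z p) (n : ℕ) :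
    gainIntegral P Λ a t b (gain π ζ H c) n +
      arrivalIntegral P Λ a t b (fun y p => ENNReal.ofReal (H p.1 (seenFrom π y p))) n =
    ∑' y, ∫⁻ u in Set.Ioc a t, ∫⁻ ω, walkMass Λ a b n y (u, ω) *
      ENNReal.ofReal ((ζ u + jumpOp A (H u)) (seenFrom π y (u, ω))) ∂P := by
  have hR : StronglyMeasurable fun u => ζ u + jumpOp A (H u) :=
    hζ.add ((jumpOp A).continuous.comp_stronglyMeasurable hH)
  rw [← lintegral_lintegral_tsum (f := fun y p => walkMass Λ a b n y p *
    ENNReal.ofReal ((ζ p.1 + jumpOp A (H p.1)) (seenFrom π y p))) fun y =>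
    (measurable_walkMass hb n y).fun_mul (measurable_ofReal_seenFrom hR π y)]
  rw [gainIntegral, arrivalIntegral, ← lintegral_lintegral_add
    (f := fun p => ∑' y, walkMass Λ a b n y p * gain π ζ H c y p)
    (g := fun p => ∑' y, arrival Λ a b n y p * ENNReal.ofReal (H p.1 (seenFrom π y p)))]
  · refine lintegral_congr fun u => lintegral_congr fun ω => ?_
    exact (tsum_walkMass_mul_eq hA0 hA hζ0 hH0 hbc n (u, ω)).symm
  · exact Measurable.tsum fun y => (measurable_walkMass hb n y).fun_mul
      (measurable_gain hζ hH hc y)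

/-- The first step of the expansion along the jumps of the common walk. -/
theorem lintegral_eq_gain_add (hM : IsMarginallyMarkov S P π)
    (hS : ∀ x t f, S.op t (f.comp (shift x)) = (S.op t f).comp (shift x)) (ha : 0 ≤ a)
    (hA0 : ∀ z η, 0 ≤ A z η) (hA : Summable fun z => ‖A z‖)
    (hζ0 : ∀ u, 0 ≤ ζ u) (hH0 : ∀ u, 0 ≤ H u) (hζ : StronglyMeasurable ζ)
    (hH : StronglyMeasurable H) (hb : ∀ y z, Measurable (b y z)) (hc : ∀ y z, Measurable (c y z))
    (hbc : ∀ y z p, ENNReal.ofReal (A z (seenFrom π y p)) = b y z p + c y z p)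
    (hHR : ∀ v, 0 ≤ v → ∀ x, ENNReal.ofReal (H v x) = ∫⁻ u in Set.Ioc v t,
      ENNReal.ofReal (Real.exp (-Λ * (u - v))) *
        ENNReal.ofReal (S.op (u - v).toNNReal (ζ u + jumpOp A (H u)) x)) :
    ∫⁻ ω, ENNReal.ofReal (H a (seenFrom π 0 (a, ω))) ∂P =
      gainIntegral P Λ a t b (gain π ζ H c) 0 +
      arrivalIntegral P Λ a t b (fun y p => ENNReal.ofReal (H p.1 (seenFrom π y p))) 0 := by
  have hR : StronglyMeasurable fun u => ζ u + jumpOp A (H u) :=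
    hζ.add ((jumpOp A).continuous.comp_stronglyMeasurable hH)
  rw [gainIntegral_add_arrivalIntegral hA0 hA hζ0 hH0 hζ hH hb hc hbc, tsum_eq_single 0]
  · have he : Measurable fun q : ℝ × ℝ => ENNReal.ofReal (Real.exp (-Λ * (q.2 - q.1))) := by fun_prop
    have h := lintegral_mul_eq_of_mild (b := t) hM hS he hR
      (fun u => add_nonneg (hζ0 u) (jumpOp_nonneg hA0 hA (hH0 u))) ha (hHR a ha) 0
      (Q := fun _ => 1) measurable_const
    simp only [one_mul] at h
    rw [h]
    refine lintegral_congr fun u => ?_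
    simp only [walkMass, if_true]
    rw [lintegral_const_mul]
    exact (measurable_ofReal_seenFrom hR π 0).comp (measurable_prodMk_left (x := u))
  · intro y hy
    simp [walkMass, hy]

/-- By `hbs` the arrival density at time `v` depends only on the path up to `v`, so the Markov
property carries `H v` along the environment to the next ring. Integrating the density against
`e^{-Λ(u-v)}` yields the mass of the walk with `n + 1` jumps. -/
theorem arrivalIntegral_eq_succ (hM : IsMarginallyMarkov S P π)
    (hS : ∀ x t f, S.op t (f.comp (shift x)) = (S.op t f).comp (shift x)) (ha : 0 ≤ a)
    (hA0 : ∀ z η, 0 ≤ A z η) (hA : Summable fun z => ‖A z‖)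
    (hζ0 : ∀ u, 0 ≤ ζ u) (hH0 : ∀ u, 0 ≤ H u) (hζ : StronglyMeasurable ζ)
    (hH : StronglyMeasurable H) (hb : ∀ y z, Measurable (b y z)) (hc : ∀ y z, Measurable (c y z))
    (hbs : ∀ y z u v ω, u ≤ v → b y z (u, CadlagPath.stopAt v.toNNReal ω) = b y z (u, ω))
    (hbc : ∀ y z p, ENNReal.ofReal (A z (seenFrom π y p)) = b y z p + c y z p)
    (hHR : ∀ v, 0 ≤ v → ∀ x, ENNReal.ofReal (H v x) = ∫⁻ u in Set.Ioc v t,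
      ENNReal.ofReal (Real.exp (-Λ * (u - v))) *
        ENNReal.ofReal (S.op (u - v).toNNReal (ζ u + jumpOp A (H u)) x)) (n : ℕ) :
    arrivalIntegral P Λ a t b (fun y p => ENNReal.ofReal (H p.1 (seenFrom π y p))) n =
      gainIntegral P Λ a t b (gain π ζ H c) (n + 1) +
      arrivalIntegral P Λ a t b (fun y p => ENNReal.ofReal (H p.1 (seenFrom π y p))) (n + 1) := by
  have hR : StronglyMeasurable fun u => ζ u + jumpOp A (H u) :=
    hζ.add ((jumpOp A).continuous.comp_stronglyMeasurable hH)
  have he : Measurable fun q : ℝ × ℝ => ENNReal.ofReal (Real.exp (-Λ * (q.2 - q.1))) := by fun_prop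
  rw [gainIntegral_add_arrivalIntegral hA0 hA hζ0 hH0 hζ hH hb hc hbc, arrivalIntegral,
    lintegral_lintegral_tsum (f := fun y p => arrival Λ a b n y p *
      ENNReal.ofReal (H p.1 (seenFrom π y p))) fun y =>
      (measurable_arrival hb n y).fun_mul (measurable_ofReal_seenFrom hH π y)]
  refine tsum_congr fun y => ?_
  have hQa : ∀ v : ℝ, Measurable[canonicalFiltration X v.toNNReal]
      fun ω => arrival Λ a b n y (v, ω) := by
    intro v
    have hm : Measurable fun ω => arrival Λ a b n y (v, ω) :=
      (measurable_arrival hb n y).comp (measurable_prodMk_left (x := v))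
    exact CadlagPath.measurable_of_stopAt hm fun ω =>
      arrival_congr (fun u hu y z => hbs y z u v ω hu) n y
  exact lintegral_transport hM hS ha he hR
    (fun u => add_nonneg (hζ0 u) (jumpOp_nonneg hA0 hA (hH0 u)))
    (fun v hv => hHR v (ha.trans hv.1.le)) y (measurable_arrival hb n y) hQa

end Core

/-! ### Comparing two marginal expansions along one walk. -/

section Comparison

variable {d : ℕ} {E : Type*} [MetricSpace E] [CompactSpace E] [SecondCountableTopology E]
  [MeasurableSpace E] [BorelSpace E]
  {X : Type*} [TopologicalSpace X] [TopologicalSpace.PseudoMetrizableSpace X]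
  [MeasurableSpace X] [BorelSpace X]
  {A : Site d → C(Config d E, ℝ)} {Λ a t : ℝ} {ζ H : ℝ → C(Config d E, ℝ)}
  {b c₁ c₂ : Site d → Site d → ℝ × CadlagPath X → ℝ≥0∞}
  {S : FellerSemigroup (Config d E)} {P : Measure (CadlagPath X)} [IsProbabilityMeasure P]
  {π₁ π₂ : C(X, Config d E)}

/-- The walk has mass at most `1` and rings at rate `Λ`, so the sum over `n` is at most `Λ B (t -
a)`. The terms of a finite sum tend to `0`, so the remainder of the expansion vanishes. -/
theorem tendsto_arrivalIntegral (hΛ : 0 ≤ Λ) (hb : ∀ y z, Measurable (b y z))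
    (hbΛ : ∀ y p, ∑' z, b y z p ≤ ENNReal.ofReal Λ) {g : Site d → ℝ × CadlagPath X → ℝ≥0∞}
    {B : ℝ≥0∞} (hB : B ≠ ∞) (hg : ∀ y p, a < p.1 → g y p ≤ B) :
    Tendsto (arrivalIntegral P Λ a t b g) atTop (𝓝 0) := by
  refine ENNReal.tendsto_atTop_zero_of_tsum_ne_top ?_
  have h1 : ∀ n, arrivalIntegral P Λ a t b g n ≤
      ∫⁻ u in Set.Ioc a t, ∫⁻ ω, (∑' y, walkMass Λ a b n y (u, ω)) *
        (ENNReal.ofReal Λ * B) ∂P := by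
    intro n
    refine setLIntegral_mono' measurableSet_Ioc fun u hu => lintegral_mono fun ω => ?_
    calc ∑' y, arrival Λ a b n y (u, ω) * g y (u, ω)
        ≤ ∑' y, arrival Λ a b n y (u, ω) * B := by
          gcongr with y
          exact hg y (u, ω) hu.1
      _ ≤ _ := by
          rw [tsum_arrival_mul, ← ENNReal.tsum_mul_right]
          gcongr with y
          rw [ENNReal.tsum_mul_right]
          gcongr
          exact hbΛ y (u, ω)
  have hm : ∀ n, Measurable fun p : ℝ × CadlagPath X =>
      (∑' y, walkMass Λ a b n y p) * (ENNReal.ofReal Λ * B) := fun n =>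
    (Measurable.tsum fun y => measurable_walkMass hb n y).mul_const _
  have h2 : ∑' n, arrivalIntegral P Λ a t b g n ≤ ENNReal.ofReal Λ * B * ENNReal.ofReal (t - a) := by
    refine (ENNReal.tsum_le_tsum h1).trans ?_
    rw [← lintegral_lintegral_tsum (f := fun n p =>
      (∑' y, walkMass Λ a b n y p) * (ENNReal.ofReal Λ * B)) hm]
    calc ∫⁻ u in Set.Ioc a t, ∫⁻ ω, ∑' n, (∑' y, walkMass Λ a b n y (u, ω)) *
          (ENNReal.ofReal Λ * B) ∂P
        ≤ ∫⁻ _ in Set.Ioc a t, ∫⁻ _, ENNReal.ofReal Λ * B ∂P := by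
          refine setLIntegral_mono' measurableSet_Ioc fun u hu => lintegral_mono fun ω => ?_
          rw [ENNReal.tsum_mul_right]
          exact mul_le_of_le_one_left zero_le
            (tsum_walkMass_le_one hΛ hb (fun u y => hbΛ y (u, ω)) hu.1.le)
      _ = _ := by simp
  exact ne_top_of_le_ne_top (ENNReal.mul_ne_top (ENNReal.mul_ne_top ENNReal.ofReal_ne_top hB)
    ENNReal.ofReal_ne_top) h2

/-- Comparison of the two marginal expansions along the same common walk. -/
theorem lintegral_le_of_gain_le (hM₁ : IsMarginallyMarkov S P π₁)
    (hM₂ : IsMarginallyMarkov S P π₂)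
    (hS : ∀ x t f, S.op t (f.comp (shift x)) = (S.op t f).comp (shift x)) (ha : 0 ≤ a)
    (hΛ : 0 ≤ Λ) (hA0 : ∀ z η, 0 ≤ A z η) (hA : Summable fun z => ‖A z‖)
    (hζ0 : ∀ u, 0 ≤ ζ u) (hH0 : ∀ u, 0 ≤ H u) (hζ : StronglyMeasurable ζ)
    (hH : StronglyMeasurable H) {B : ℝ} (hB : ∀ u, a < u → ‖H u‖ ≤ B)
    (hb : ∀ y z, Measurable (b y z)) (hbΛ : ∀ y p, ∑' z, b y z p ≤ ENNReal.ofReal Λ)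
    (hbs : ∀ y z u v ω, u ≤ v → b y z (u, CadlagPath.stopAt v.toNNReal ω) = b y z (u, ω))
    (hc₁ : ∀ y z, Measurable (c₁ y z)) (hc₂ : ∀ y z, Measurable (c₂ y z))
    (hbc₁ : ∀ y z p, ENNReal.ofReal (A z (seenFrom π₁ y p)) = b y z p + c₁ y z p)
    (hbc₂ : ∀ y z p, ENNReal.ofReal (A z (seenFrom π₂ y p)) = b y z p + c₂ y z p)
    (hHR : ∀ v, 0 ≤ v → ∀ x, ENNReal.ofReal (H v x) = ∫⁻ u in Set.Ioc v t,
      ENNReal.ofReal (Real.exp (-Λ * (u - v))) *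
        ENNReal.ofReal (S.op (u - v).toNNReal (ζ u + jumpOp A (H u)) x))
    {err : Site d → ℝ × CadlagPath X → ℝ≥0∞} (herr : ∀ y, Measurable (err y))
    (hgain : ∀ y p, a < p.1 → gain π₁ ζ H c₁ y p ≤ gain π₂ ζ H c₂ y p + err y p) :
    ∫⁻ ω, ENNReal.ofReal (H a (seenFrom π₁ 0 (a, ω))) ∂P ≤
      ∫⁻ ω, ENNReal.ofReal (H a (seenFrom π₂ 0 (a, ω))) ∂P +
        ∫⁻ u in Set.Ioc a t, ∫⁻ ω, ∑' y, (∑' n, walkMass Λ a b n y (u, ω)) * err y (u, ω) ∂P := by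
  set I₁ := gainIntegral P Λ a t b (gain π₁ ζ H c₁)
  set I₂ := gainIntegral P Λ a t b (gain π₂ ζ H c₂)
  set J₁ := arrivalIntegral P Λ a t b (fun y p => ENNReal.ofReal (H p.1 (seenFrom π₁ y p)))
    with hJ₁
  set J₂ := arrivalIntegral P Λ a t b (fun y p => ENNReal.ofReal (H p.1 (seenFrom π₂ y p)))
  set Er := gainIntegral P Λ a t b err
  have e₁ : ∀ N, ∫⁻ ω, ENNReal.ofReal (H a (seenFrom π₁ 0 (a, ω))) ∂P =
      ∑ n ∈ Finset.range (N + 1), I₁ n + J₁ N := by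
    intro N
    induction N with
    | zero =>
      rw [zero_add, Finset.sum_range_one]
      exact lintegral_eq_gain_add hM₁ hS ha hA0 hA hζ0 hH0 hζ hH hb hc₁ hbc₁ hHR
    | succ N ih =>
      rw [ih, Finset.sum_range_succ _ (N + 1), add_assoc]
      congr 1
      exact arrivalIntegral_eq_succ hM₁ hS ha hA0 hA hζ0 hH0 hζ hH hb hc₁ hbs hbc₁ hHR N
  have e₂ : ∀ N, ∫⁻ ω, ENNReal.ofReal (H a (seenFrom π₂ 0 (a, ω))) ∂P =
      ∑ n ∈ Finset.range (N + 1), I₂ n + J₂ N := by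
    intro N
    induction N with
    | zero =>
      rw [zero_add, Finset.sum_range_one]
      exact lintegral_eq_gain_add hM₂ hS ha hA0 hA hζ0 hH0 hζ hH hb hc₂ hbc₂ hHR
    | succ N ih =>
      rw [ih, Finset.sum_range_succ _ (N + 1), add_assoc]
      congr 1
      exact arrivalIntegral_eq_succ hM₂ hS ha hA0 hA hζ0 hH0 hζ hH hb hc₂ hbs hbc₂ hHR N
  have hI : ∀ n, I₁ n ≤ I₂ n + Er n := by
    intro n
    have h1 : Measurable fun p => ∑' y, walkMass Λ a b n y p * gain π₂ ζ H c₂ y p :=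
      Measurable.tsum fun y => (measurable_walkMass hb n y).fun_mul (measurable_gain hζ hH hc₂ y)
    have h2 := lintegral_lintegral_add (P := P) (g := fun p =>
      ∑' y, walkMass Λ a b n y p * err y p) h1 a t
    refine le_of_le_of_eq ?_ h2
    refine setLIntegral_mono' measurableSet_Ioc fun u hu => lintegral_mono fun ω => ?_
    simp only
    rw [← ENNReal.tsum_add]
    refine ENNReal.tsum_le_tsum fun y => ?_
    rw [← mul_add]
    gcongr
    exact hgain y (u, ω) hu.1
  have hEr : ∑' n, Er n = ∫⁻ u in Set.Ioc a t, ∫⁻ ω,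
      ∑' y, (∑' n, walkMass Λ a b n y (u, ω)) * err y (u, ω) ∂P := by
    have h1 := lintegral_lintegral_tsum (P := P) (f := fun n p =>
      ∑' y, walkMass Λ a b n y p * err y p) (fun n => Measurable.tsum fun y =>
        (measurable_walkMass hb n y).fun_mul (herr y)) a t
    refine h1.symm.trans (lintegral_congr fun u => lintegral_congr fun ω => ?_)
    rw [ENNReal.tsum_comm]
    refine tsum_congr fun y => ?_
    rw [ENNReal.tsum_mul_right]
  have hJ : Tendsto J₁ atTop (𝓝 0) := by
    refine tendsto_arrivalIntegral hΛ hb hbΛ (B := ENNReal.ofReal B) ENNReal.ofReal_ne_top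
      fun y p hp => ?_
    exact ENNReal.ofReal_le_ofReal ((le_abs_self _).trans
      (((H p.1).norm_coe_le_norm _).trans (hB _ hp)))
  -- Only the remainder of the first expansion has to vanish; that of the second is nonnegative and
  -- is dropped.
  have hN : ∀ N, ∫⁻ ω, ENNReal.ofReal (H a (seenFrom π₁ 0 (a, ω))) ∂P ≤
      (∫⁻ ω, ENNReal.ofReal (H a (seenFrom π₂ 0 (a, ω))) ∂P + ∑' n, Er n) + J₁ N := by
    intro N
    rw [e₁ N]
    gcongr
    calc ∑ n ∈ Finset.range (N + 1), I₁ n ≤ ∑ n ∈ Finset.range (N + 1), (I₂ n + Er n) := by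
          gcongr with n; exact hI n
      _ = ∑ n ∈ Finset.range (N + 1), I₂ n + ∑ n ∈ Finset.range (N + 1), Er n :=
          Finset.sum_add_distrib
      _ ≤ _ := by
          gcongr
          · rw [e₂ N]; exact le_self_add
          · exact ENNReal.sum_le_tsum _
  have hlim := (tendsto_const_nhds (x := ∫⁻ ω, ENNReal.ofReal (H a (seenFrom π₂ 0 (a, ω))) ∂P +
    ∑' n, Er n)).add hJ
  rw [add_zero] at hlim
  rw [← hEr]
  exact ge_of_tendsto' hlim hN

/-- The residual rates have equal total mass and `h` compares arbitrary targets, so the residual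
jumps need not be matched: `h₁` is compared with the infimum of `h₂`. -/
theorem tsum_sub_min_mul_le {ι : Type*} {r₁ r₂ h₁ h₂ : ι → ℝ≥0∞} {Ψ : ℝ≥0∞}
    (hsum : ∑' z, (r₁ z - min (r₁ z) (r₂ z)) = ∑' z, (r₂ z - min (r₁ z) (r₂ z)))
    (h : ∀ z z', h₁ z ≤ h₂ z' + Ψ) :
    ∑' z, (r₁ z - min (r₁ z) (r₂ z)) * h₁ z ≤ ∑' z, (r₂ z - min (r₁ z) (r₂ z)) * h₂ z +
      Ψ * ∑' z, (r₁ z - min (r₁ z) (r₂ z)) := by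
  calc ∑' z, (r₁ z - min (r₁ z) (r₂ z)) * h₁ z
      ≤ ∑' z, (r₁ z - min (r₁ z) (r₂ z)) * ((⨅ z', h₂ z') + Ψ) := by
        gcongr with z
        rw [ENNReal.iInf_add]
        exact le_iInf fun z' => h z z'
    _ = (∑' z, (r₂ z - min (r₁ z) (r₂ z)) * ⨅ z', h₂ z') +
        Ψ * ∑' z, (r₁ z - min (r₁ z) (r₂ z)) := by
        rw [ENNReal.tsum_mul_right, ENNReal.tsum_mul_right, mul_add, ← hsum, mul_comm Ψ]
    _ ≤ _ := by
        gcongr with z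
        exact iInf_le _ _

theorem tsum_sub_min_eq {ι : Type*} {r₁ r₂ : ι → ℝ≥0∞} {L : ℝ≥0∞} (hL : L ≠ ∞)
    (h₁ : ∑' z, r₁ z = L) (h₂ : ∑' z, r₂ z = L) :
    ∑' z, (r₁ z - min (r₁ z) (r₂ z)) = ∑' z, (r₂ z - min (r₁ z) (r₂ z)) := by
  have hm : ∑' z, min (r₁ z) (r₂ z) ≠ ∞ :=
    ne_top_of_le_ne_top hL (h₁ ▸ ENNReal.tsum_le_tsum fun z => min_le_left _ _)
  rw [← ENNReal.add_left_inj hm, ← ENNReal.tsum_add, ← ENNReal.tsum_add]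
  simp_rw [tsub_add_cancel_of_le (min_le_left _ _), tsub_add_cancel_of_le (min_le_right _ _)]
  rw [h₁, h₂]

theorem ofReal_sub_min (x y : ℝ) (hy : 0 ≤ y) :
    ENNReal.ofReal x - min (ENNReal.ofReal x) (ENNReal.ofReal y) = ENNReal.ofReal (x - y) := by
  rcases le_total x y with h | h
  · rw [min_eq_left (ENNReal.ofReal_le_ofReal h), tsub_self, ENNReal.ofReal_of_nonpos (by linarith)]
  · rw [min_eq_right (ENNReal.ofReal_le_ofReal h), ENNReal.ofReal_sub _ hy]

end Comparison

/-! ### Occupation bounds uniform over the rates. -/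

section CoreEstimate

variable {d : ℕ} {E : Type*} [MetricSpace E] [CompactSpace E] [SecondCountableTopology E]
  [MeasurableSpace E] [BorelSpace E]

/-- Uniform bounds on the law of a walk with rates dominated by `α`. -/
theorem exists_site_bound {α : Site d → C(Config d E, ℝ)}
    (hα : Summable fun z : Site d => ‖z‖ * ‖α z‖) :
    ∃ (C : ℝ) (n : ℝ → Site d → ℝ≥0∞), 0 ≤ C ∧
      (∀ u, ∑' x, n u x ≤ ENNReal.ofReal (C * (max 1 u) ^ d)) ∧
      ∀ (W : Type _) [MeasurableSpace W] (b : Site d → Site d → ℝ × W → ℝ≥0∞) (a : ℝ),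
        0 ≤ a → (∀ y z, Measurable (b y z)) →
        (∀ y p, ∑' z, b y z p ≤ ENNReal.ofReal (clockRate α)) →
        (∀ y z p, z ≠ 0 → b y z p ≤ ENNReal.ofReal ‖α z‖) →
        ∀ x u ω, a ≤ u → ∑' n, walkMass (clockRate α) a b n x (u, ω) ≤ n u x := by
  set m : ℝ := ∑' z : Site d, ‖z‖ * ‖α z‖ with hmdef
  have hm0 : 0 ≤ m := tsum_nonneg fun z => by positivity
  have hm : ∑' z : Site d, ENNReal.ofReal ‖z‖ * ENNReal.ofReal ‖α z‖ ≤ ENNReal.ofReal m := by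
    rw [hmdef, ENNReal.ofReal_tsum_of_nonneg (fun z => by positivity) hα]
    simp_rw [ENNReal.ofReal_mul (norm_nonneg _)]
    exact le_rfl
  set C₀ : ℝ := d * Real.exp d * m + 2 * (m + 1) with hC₀
  have hC₀0 : 0 ≤ C₀ := by positivity
  choose! w hw0 hw1 hw2 using fun (t : ℝ) (ht : 1 ≤ t) =>
    exists_superharmonic_weight (d := d) hm0 hm ht
  -- At time `u` the weight of scale `max 1 u` is used. Its growth rate `C₀ / max 1 u`, over a
  -- duration of at most `max 1 u`, costs the factor `e^{C₀}`; the rest of the constant is from its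
  -- total mass `2 (4 max 1 u)^d`.
  refine ⟨Real.exp C₀ * (2 * 4 ^ d), fun u x => ENNReal.ofReal (Real.exp C₀) * w (max 1 u) (-x),
    by positivity, fun u => ?_, ?_⟩
  · have h1 : (1 : ℝ) ≤ max 1 u := le_max_left _ _
    rw [ENNReal.tsum_mul_left]
    have h2 : ∑' x : Site d, w (max 1 u) (-x) = ∑' x, w (max 1 u) x :=
      (Equiv.neg (Site d)).tsum_eq (w (max 1 u))
    rw [h2, mul_assoc (Real.exp C₀), ENNReal.ofReal_mul (Real.exp_pos _).le]
    gcongr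
    refine (hw1 _ h1).trans (le_of_eq ?_)
    rw [mul_pow]
    congr 1
    ring
  · intro W _ b a ha hb hbΛ hbν x u ω hu
    have h1 : (1 : ℝ) ≤ max 1 u := le_max_left _ _
    have h0 : (0 : ℝ) < max 1 u := by linarith
    have hΛ : 0 ≤ clockRate α := tsum_nonneg fun z => norm_nonneg _
    have hle := tsum_walkMass_apply_le (C := C₀ / max 1 u) (a := a) (u := u) (ω := ω) hΛ
      (by positivity) hb (hw0 _ h1)
      (fun u' y x' => by
        have := hw2 _ h1 (fun z => b y z (u', ω)) _ (hbΛ y (u', ω)) (fun z hz => hbν y z _ hz) x'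
        rwa [← ENNReal.ofReal_add hΛ (by positivity)] at this) hu x
    refine hle.trans (mul_le_mul_left (ENNReal.ofReal_le_ofReal (Real.exp_le_exp.2 ?_)) _)
    rw [div_mul_eq_mul_div, div_le_iff₀ h0]
    exact mul_le_mul_of_nonneg_left ((sub_le_self _ ha).trans (le_max_right _ _)) hC₀0

end CoreEstimate

/-! ### Tilted sources and the fluctuation. -/

section TiltedSource

variable {X : Type*} [TopologicalSpace X] [CompactSpace X]

/-- The nonnegative source `φ(t) f + ‖f‖`. -/
noncomputable def tiltedSource (f : C(X, ℝ)) (φ : ℝ → ℝ) (t : ℝ) : C(X, ℝ) :=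
  φ t • f + ContinuousMap.const X ‖f‖

/-- The largest value of `∫_0^t |T_s f(η) - T_s f(ξ)| ds`. -/
noncomputable def fluctuation (T : FellerSemigroup X) (f : C(X, ℝ)) (t : ℝ) : ℝ≥0∞ :=
  ⨆ η : X, ⨆ ξ : X, ∫⁻ s in Set.Ioc 0 t,
    ENNReal.ofReal |T.op s.toNNReal f η - T.op s.toNNReal f ξ|

variable {T : FellerSemigroup X} {f : C(X, ℝ)} {φ : ℝ → ℝ} {t : ℝ}

theorem stronglyMeasurable_tiltedSource (hφ : Measurable φ) :
    StronglyMeasurable (tiltedSource f φ) :=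
  (hφ.stronglyMeasurable.smul_const f).add_const _

theorem tiltedSource_apply (s : ℝ) (x : X) : tiltedSource f φ s x = φ s * f x + ‖f‖ := rfl

theorem tiltedSource_nonneg (hφ1 : ∀ s, |φ s| ≤ 1) (s : ℝ) : 0 ≤ tiltedSource f φ s := by
  intro x
  change 0 ≤ φ s * f x + ‖f‖
  have h1 : |φ s * f x| ≤ 1 * ‖f‖ := by
    rw [abs_mul]
    exact mul_le_mul (hφ1 s) (f.norm_coe_le_norm x) (abs_nonneg _) zero_le_one
  linarith [neg_abs_le (φ s * f x)]

theorem norm_tiltedSource_le (hφ1 : ∀ s, |φ s| ≤ 1) (s : ℝ) : ‖tiltedSource f φ s‖ ≤ 2 * ‖f‖ := by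
  rw [ContinuousMap.norm_le _ (by positivity)]
  intro x
  rw [tiltedSource_apply]
  have h1 : |φ s * f x| ≤ 1 * ‖f‖ := by
    rw [abs_mul]
    exact mul_le_mul (hφ1 s) (f.norm_coe_le_norm x) (abs_nonneg _) zero_le_one
  rw [Real.norm_eq_abs]
  refine (abs_add_le _ _).trans ?_
  rw [abs_of_nonneg (norm_nonneg f)]
  linarith

theorem op_tiltedSource_apply (r : ℝ≥0) (s : ℝ) (x : X) :
    T.op r (tiltedSource f φ s) x = φ s * T.op r f x + ‖f‖ := by
  rw [tiltedSource, map_add, map_smul, FellerSemigroup.op_const]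
  rfl

theorem measurable_op_apply_toNNReal (T : FellerSemigroup X) (f : C(X, ℝ)) (s : ℝ) (x : X) :
    Measurable fun r : ℝ => T.op (r - s).toNNReal f x := by
  have h1 := (T.stronglyMeasurable_op (measurable_id.sub_const s)
    (stronglyMeasurable_const (b := f)))
  exact ((ContinuousMap.evalCLM ℝ x).continuous.comp_stronglyMeasurable h1).measurable

/-- The constant `‖f‖`, present only for positivity, is preserved by `T` and cancels in differences.
-/
theorem backward_tiltedSource_sub (hφ : Measurable φ) (hφ1 : ∀ s, |φ s| ≤ 1) (s : ℝ) (x y : X) :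
    T.backward (tiltedSource f φ) t s x - T.backward (tiltedSource f φ) t s y =
      ∫ r in Set.Ioc s t, φ r * (T.op (r - s).toNNReal f x - T.op (r - s).toNNReal f y) := by
  have hζ := stronglyMeasurable_tiltedSource (f := f) hφ
  have hc := norm_tiltedSource_le (f := f) hφ1
  have hi := FellerSemigroup.integrable_op_source (T := T) hζ hc s s (b := t)
  rw [FellerSemigroup.backward_apply hζ hc, FellerSemigroup.backward_apply hζ hc, ← integral_sub]
  · simp only [op_tiltedSource_apply]
    refine integral_congr_ae (Eventually.of_forall fun r => ?_)
    ring
  · exact (ContinuousMap.evalCLM ℝ x).integrable_comp hi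
  · exact (ContinuousMap.evalCLM ℝ y).integrable_comp hi

/-- The tilt is removed by `|φ| ≤ 1`, and the substitution `r ↦ r - s` leads to `(0, t - s]`, which
lies in `(0, t]` as `s ≥ 0`. One number thus bounds the oscillation at all times and for all tilts.
-/
theorem ofReal_backward_sub_le (hφ : Measurable φ) (hφ1 : ∀ s, |φ s| ≤ 1) {s : ℝ} (hs : 0 ≤ s)
    (x y : X) :
    ENNReal.ofReal (T.backward (tiltedSource f φ) t s x - T.backward (tiltedSource f φ) t s y) ≤
      fluctuation T f t := by
  rw [backward_tiltedSource_sub hφ hφ1]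
  calc _ ≤ ENNReal.ofReal ‖∫ r in Set.Ioc s t,
          φ r * (T.op (r - s).toNNReal f x - T.op (r - s).toNNReal f y)‖ :=
        ENNReal.ofReal_le_ofReal (le_abs_self _)
    _ ≤ ∫⁻ r in Set.Ioc s t, ‖φ r * (T.op (r - s).toNNReal f x - T.op (r - s).toNNReal f y)‖ₑ := by
        rw [ofReal_norm]
        exact enorm_integral_le_lintegral_enorm _
    _ ≤ ∫⁻ r in Set.Ioc s t,
          ENNReal.ofReal |T.op (r - s).toNNReal f x - T.op (r - s).toNNReal f y| := by
        refine lintegral_mono fun r => ?_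
        rw [← ofReal_norm, Real.norm_eq_abs, abs_mul]
        exact ENNReal.ofReal_le_ofReal (mul_le_of_le_one_left (abs_nonneg _) (hφ1 r))
    _ = ∫⁻ r in Set.Ioc 0 (t - s),
          ENNReal.ofReal |T.op r.toNNReal f x - T.op r.toNNReal f y| := by
        have h := (measurePreserving_sub_right (volume : Measure ℝ) s).setLIntegral_comp_preimage
          (s := Set.Ioc 0 (t - s)) measurableSet_Ioc
          (f := fun r => ENNReal.ofReal |T.op r.toNNReal f x - T.op r.toNNReal f y|) (by
            have h1 := measurable_op_apply_toNNReal T f 0 x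
            have h2 := measurable_op_apply_toNNReal T f 0 y
            simp only [sub_zero] at h1 h2
            exact (h1.sub h2).abs.ennreal_ofReal)
        rw [← h]
        simp
    _ ≤ ∫⁻ r in Set.Ioc 0 t, ENNReal.ofReal |T.op r.toNNReal f x - T.op r.toNNReal f y| :=
        lintegral_mono_set (Set.Ioc_subset_Ioc_right (by linarith))
    _ ≤ _ := le_iSup₂ (f := fun x y => ∫⁻ r in Set.Ioc 0 t,
        ENNReal.ofReal |T.op r.toNNReal f x - T.op r.toNNReal f y|) x y

/-- The sign of the difference is the extremal tilt. -/
theorem exists_tilt (T : FellerSemigroup X) (f : C(X, ℝ)) (x y : X) :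
    ∃ φ : ℝ → ℝ, Measurable φ ∧ (∀ s, |φ s| ≤ 1) ∧ ∀ t,
      ∫⁻ s in Set.Ioc 0 t, ENNReal.ofReal |T.op s.toNNReal f x - T.op s.toNNReal f y| =
        ENNReal.ofReal (T.backward (tiltedSource f φ) t 0 x -
          T.backward (tiltedSource f φ) t 0 y) := by
  have h1 := measurable_op_apply_toNNReal T f 0 x
  have h2 := measurable_op_apply_toNNReal T f 0 y
  simp only [sub_zero] at h1 h2
  have hd : Measurable fun s : ℝ => T.op s.toNNReal f x - T.op s.toNNReal f y := h1.sub h2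
  set D := fun s : ℝ => T.op s.toNNReal f x - T.op s.toNNReal f y with hD
  refine ⟨fun s => if 0 ≤ D s then 1 else -1, Measurable.ite (measurableSet_le measurable_const hd)
    measurable_const measurable_const, fun s => ?_, fun t => ?_⟩
  · simp only; split_ifs <;> simp
  · rw [backward_tiltedSource_sub (Measurable.ite (measurableSet_le measurable_const hd)
      measurable_const measurable_const) (fun s => by split_ifs <;> simp)]
    have he : ∀ s, (if 0 ≤ D s then (1 : ℝ) else -1) * D s = |D s| := by
      intro s
      split_ifs with h
      · rw [one_mul, abs_of_nonneg h]
      · rw [abs_of_neg (not_le.1 h)]; ring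
    simp only [sub_zero]
    rw [integral_congr_ae (g := fun s => |D s|) (Eventually.of_forall he),
      ofReal_integral_eq_lintegral_ofReal]
    · refine Measure.integrableOn_of_bounded (M := 2 * ‖f‖) (by simp) hd.abs.aestronglyMeasurable ?_
      refine Eventually.of_forall fun s => ?_
      rw [Real.norm_eq_abs, abs_abs]
      refine (abs_sub _ _).trans ?_
      have h3 := ((T.op s.toNNReal f).norm_coe_le_norm x).trans (T.norm_op_apply_le _ _)
      have h4 := ((T.op s.toNNReal f).norm_coe_le_norm y).trans (T.norm_op_apply_le _ _)
      rw [Real.norm_eq_abs] at h3 h4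
      linarith
    · exact Eventually.of_forall fun s => abs_nonneg _

/-- The bound `2‖f‖t` is not uniform in `t`; its role is to make the fluctuation finite, so that a
fraction of it can be absorbed. -/
theorem fluctuation_ne_top : fluctuation T f t ≠ ∞ := by
  refine ne_top_of_le_ne_top (b := ENNReal.ofReal (2 * ‖f‖) * ENNReal.ofReal t)
    (ENNReal.mul_ne_top ENNReal.ofReal_ne_top ENNReal.ofReal_ne_top)
    (iSup_le fun x => iSup_le fun y => ?_)
  calc _ ≤ ∫⁻ _ in Set.Ioc 0 t, ENNReal.ofReal (2 * ‖f‖) := by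
        refine lintegral_mono fun s => ENNReal.ofReal_le_ofReal ?_
        refine (abs_sub _ _).trans ?_
        have h3 := ((T.op s.toNNReal f).norm_coe_le_norm x).trans (T.norm_op_apply_le _ _)
        have h4 := ((T.op s.toNNReal f).norm_coe_le_norm y).trans (T.norm_op_apply_le _ _)
        rw [Real.norm_eq_abs] at h3 h4
        linarith
    _ = _ := by simp

end TiltedSource

/-! ### Comparison in the coupled environment. -/

section CoupledComparison

variable {d : ℕ} {E : Type*} [MetricSpace E] [CompactSpace E] [SecondCountableTopology E]
  [MeasurableSpace E] [BorelSpace E] {α : Site d → C(Config d E, ℝ)}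

theorem tsum_ofReal_uniformRate (hα0 : ∀ z η, 0 ≤ α z η)
    (hα : Summable fun z : Site d => ‖z‖ * ‖α z‖) (η : Config d E) :
    ∑' z, ENNReal.ofReal (uniformRate α z η) = ENNReal.ofReal (clockRate α) := by
  have h := hasSum_uniformRate hα η
  rw [← h.tsum_eq, ENNReal.ofReal_tsum_of_nonneg (fun z => uniformRate_nonneg hα0 hα z η) h.summable]

theorem uniformRate_le_norm {z : Site d} (hz : z ≠ 0) (η : Config d E) :
    uniformRate α z η ≤ ‖α z‖ := by
  simp only [uniformRate, properRate, hz, if_false, add_zero]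
  exact (le_abs_self _).trans ((α z).norm_coe_le_norm η)

theorem ofReal_tiltedSource_le {f : C(Config d E, ℝ)} {φ : ℝ → ℝ} (hφ1 : ∀ s, |φ s| ≤ 1) (s : ℝ)
    (η ξ : Config d E) :
    ENNReal.ofReal (tiltedSource f φ s η) ≤ ENNReal.ofReal (tiltedSource f φ s ξ) +
      ∑' x, lipConst f x * edist (η x) (ξ x) := by
  have h1 : ENNReal.ofReal |f η - f ξ| ≤ ∑' x, lipConst f x * edist (η x) (ξ x) := by
    rcases le_total (f ξ) (f η) with h | h
    · rw [abs_of_nonneg (sub_nonneg.2 h)]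
      exact ofReal_sub_le_tsum_lipConst f.continuous η ξ
    · rw [abs_sub_comm, abs_of_nonneg (sub_nonneg.2 h)]
      simpa only [edist_comm] using ofReal_sub_le_tsum_lipConst f.continuous ξ η
  have h2 : tiltedSource f φ s η ≤ tiltedSource f φ s ξ + |f η - f ξ| := by
    rw [tiltedSource_apply, tiltedSource_apply]
    have h3 : φ s * (f η - f ξ) ≤ |f η - f ξ| := by
      refine (le_abs_self _).trans ?_
      rw [abs_mul]
      exact mul_le_of_le_one_left (abs_nonneg _) (hφ1 s)
    linarith
  calc _ ≤ ENNReal.ofReal (tiltedSource f φ s ξ + |f η - f ξ|) := ENNReal.ofReal_le_ofReal h2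
    _ ≤ _ := ENNReal.ofReal_add_le.trans (by gcongr)

/-- The Lipschitz weights of the error made at a site when the comparison fails there. -/
noncomputable def errorWeight (α : Site d → C(Config d E, ℝ)) (f : C(Config d E, ℝ)) (Ψ : ℝ≥0∞)
    (x : Site d) : ℝ≥0∞ :=
  lipConst f x + Ψ * rateWeight α x

variable {env : Environment d E} {cpl : Coupling env} {T : FellerSemigroup (Config d E)}

/-- The difference of the two marginals of a backward solution is controlled by the discrepancies
of the coupled environment along the common walk. -/
theorem ofReal_op_backward_sub_le (hα0 : ∀ z η, 0 ≤ α z η)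
    (hα : Summable fun z : Site d => ‖z‖ * ‖α z‖) (henv : env.IsTranslationInvariant)
    (hT : IsEnvironmentProcessSemigroup env.semigroup α T) (hM : cpl.StrongMarginalMarkov)
    {n : ℝ → Site d → ℝ≥0∞}
    (hn : ∀ (b : Site d → Site d → ℝ × CadlagPath (Config d E × Config d E) → ℝ≥0∞) (a : ℝ),
        0 ≤ a → (∀ y z, Measurable (b y z)) →
        (∀ y p, ∑' z, b y z p ≤ ENNReal.ofReal (clockRate α)) →
        (∀ y z p, z ≠ 0 → b y z p ≤ ENNReal.ofReal ‖α z‖) →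
        ∀ x u ω, a ≤ u → ∑' n, walkMass (clockRate α) a b n x (u, ω) ≤ n u x)
    {f : C(Config d E, ℝ)} {φ : ℝ → ℝ} (hφ : Measurable φ) (hφ1 : ∀ s, |φ s| ≤ 1) {a t : ℝ}
    (ha : 0 ≤ a) (η ξ : Config d E) :
    ENNReal.ofReal (env.semigroup.op a.toNNReal (T.backward (tiltedSource f φ) t a) η -
        env.semigroup.op a.toNNReal (T.backward (tiltedSource f φ) t a) ξ) ≤
      ∫⁻ u in Set.Ioc a t, ∑' y, n u y *
        ∑' x, errorWeight α f (fluctuation T f t) x * cpl.meanDist η ξ u.toNNReal (x + y) := by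
  have hP := cpl.isProbabilityMeasure η ξ
  have hζ := stronglyMeasurable_tiltedSource (f := f) hφ
  have hc := norm_tiltedSource_le (f := f) hφ1
  have hζ0 := tiltedSource_nonneg (f := f) hφ1
  have hH0 := fun s => backward_nonneg (T := T) (b := t) hζ hc hζ0 s
  have hA0 := uniformRate_nonneg hα0 hα
  have hA := summable_norm_uniformRate hα
  have hΛ : 0 ≤ clockRate α := tsum_nonneg fun z => norm_nonneg _
  set H := T.backward (tiltedSource f φ) t with hHdef
  set Ψ := fluctuation T f t with hΨ
  set S := env.semigroup with hS
  set P := cpl.law η ξ with hPdef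
  set r₁ : Site d → Site d → ℝ × CadlagPath (Config d E × Config d E) → ℝ≥0∞ :=
    fun y z p => ENNReal.ofReal (uniformRate α z (seenFrom ContinuousMap.fst y p)) with hr₁
  set r₂ : Site d → Site d → ℝ × CadlagPath (Config d E × Config d E) → ℝ≥0∞ :=
    fun y z p => ENNReal.ofReal (uniformRate α z (seenFrom ContinuousMap.snd y p)) with hr₂
  have hr₁m : ∀ y z, Measurable (r₁ y z) := fun y z =>
    ((uniformRate α z).continuous.measurable.comp (measurable_seenFrom _ y)).ennreal_ofReal
  have hr₂m : ∀ y z, Measurable (r₂ y z) := fun y z =>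
    ((uniformRate α z).continuous.measurable.comp (measurable_seenFrom _ y)).ennreal_ofReal
  -- The walk shared by both marginals jumps at the smaller of the two rates; the excess on either
  -- side is killing.
  set b : Site d → Site d → ℝ × CadlagPath (Config d E × Config d E) → ℝ≥0∞ :=
    fun y z p => min (r₁ y z p) (r₂ y z p) with hb
  have hbm : ∀ y z, Measurable (b y z) := fun y z => (hr₁m y z).min (hr₂m y z)
  have hr₁s : ∀ y p, ∑' z, r₁ y z p = ENNReal.ofReal (clockRate α) := fun y p =>
    tsum_ofReal_uniformRate hα0 hα _
  have hr₂s : ∀ y p, ∑' z, r₂ y z p = ENNReal.ofReal (clockRate α) := fun y p =>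
    tsum_ofReal_uniformRate hα0 hα _
  have hbΛ : ∀ y p, ∑' z, b y z p ≤ ENNReal.ofReal (clockRate α) := fun y p =>
    (ENNReal.tsum_le_tsum fun z => min_le_left _ _).trans (hr₁s y p).le
  have hbα : ∀ y z p, z ≠ 0 → b y z p ≤ ENNReal.ofReal ‖α z‖ := fun y z p hz =>
    (min_le_left _ _).trans (ENNReal.ofReal_le_ofReal (uniformRate_le_norm hz _))
  set err : Site d → ℝ × CadlagPath (Config d E × Config d E) → ℝ≥0∞ := fun y p =>
    ∑' x, errorWeight α f Ψ x * edist (seenFrom ContinuousMap.fst y p x)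
      (seenFrom ContinuousMap.snd y p x) with herrdef
  have herr : ∀ y, Measurable (err y) := by
    intro y
    refine Measurable.tsum fun x => Measurable.const_mul ?_ _
    exact ((measurable_pi_apply x).comp (measurable_seenFrom _ y)).edist
      ((measurable_pi_apply x).comp (measurable_seenFrom _ y))
  have hosc : ∀ u, 0 ≤ u → ∀ p q, ENNReal.ofReal (H u p) ≤ ENNReal.ofReal (H u q) + Ψ := by
    intro u hu p q
    calc ENNReal.ofReal (H u p) = ENNReal.ofReal (H u q + (H u p - H u q)) := by
          rw [add_sub_cancel]
      _ ≤ _ := ENNReal.ofReal_add_le.trans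
          (by gcongr; exact ofReal_backward_sub_le hφ hφ1 hu p q)
  have hmain := lintegral_le_of_gain_le (P := P) (S := S) (t := t) (B := 2 * ‖f‖ * |t|)
    (b := b) (c₁ := fun y z p => r₁ y z p - b y z p) (c₂ := fun y z p => r₂ y z p - b y z p)
    (err := err) (hM.fst η ξ) (hM.snd η ξ) (henv.op_comp_shift) ha hΛ hA0 hA hζ0 hH0 hζ
    (FellerSemigroup.stronglyMeasurable_backward hζ)
    (fun u hu => FellerSemigroup.norm_backward_le hc (ha.trans hu.le)) hbm hbΛ
    (fun y z u v ω huv => by simp only [hb, hr₁, hr₂, seenFrom_stopAt _ _ huv])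
    (fun y z => (hr₁m y z).sub (hbm y z)) (fun y z => (hr₂m y z).sub (hbm y z))
    (fun y z p => (add_tsub_cancel_of_le (min_le_left _ _)).symm)
    (fun y z p => (add_tsub_cancel_of_le (min_le_right _ _)).symm)
    (fun v hv x => ofReal_backward_apply hΛ (generates_sub hT hα) hζ hc
      (fun u => add_nonneg (hζ0 u) (jumpOp_nonneg hA0 hA (hH0 u))) hv x)
    herr ?_
  · have e₁ : ∫⁻ ω, ENNReal.ofReal (H a (seenFrom ContinuousMap.fst 0 (a, ω))) ∂P =
        ENNReal.ofReal (S.op a.toNNReal (H a) η) := by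
      rw [← cpl.lintegral_fst η ξ _ (hH0 a)]
      refine lintegral_congr fun ω => ?_
      congr 2
      ext x; simp [seenFrom]
    have e₂ : ∫⁻ ω, ENNReal.ofReal (H a (seenFrom ContinuousMap.snd 0 (a, ω))) ∂P =
        ENNReal.ofReal (S.op a.toNNReal (H a) ξ) := by
      rw [← cpl.lintegral_snd η ξ _ (hH0 a)]
      refine lintegral_congr fun ω => ?_
      congr 2
      ext x; simp [seenFrom]
    rw [e₁, e₂] at hmain
    rw [ENNReal.ofReal_sub _ (apply_nonneg (S.op_nonneg _ _ (hH0 a)) ξ), tsub_le_iff_left]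
    refine hmain.trans (add_le_add_right ?_ _)
    refine setLIntegral_mono' measurableSet_Ioc fun u hu => ?_
    have herru : ∀ y, Measurable fun ω => err y (u, ω) := fun y =>
      (herr y).comp (measurable_prodMk_left (x := u))
    -- The walk and the discrepancies depend on the same path. Replacing the mass of the walk by the
    -- deterministic `n u y` leaves only mean discrepancies.
    calc ∫⁻ ω, ∑' y, (∑' n, walkMass (clockRate α) a b n y (u, ω)) * err y (u, ω) ∂P
        ≤ ∫⁻ ω, ∑' y, n u y * err y (u, ω) ∂P := by
          refine lintegral_mono fun ω => ENNReal.tsum_le_tsum fun y => ?_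
          gcongr
          exact hn b a ha hbm hbΛ hbα y u ω hu.1.le
      _ = ∑' y, n u y * ∫⁻ ω, err y (u, ω) ∂P := by
          rw [lintegral_tsum fun y => ((herru y).const_mul _).aemeasurable]
          exact tsum_congr fun y => lintegral_const_mul _ (herru y)
      _ = _ := by
          refine tsum_congr fun y => ?_
          congr 1
          have hx : ∀ x, Measurable fun ω : CadlagPath (Config d E × Config d E) =>
              edist (seenFrom ContinuousMap.fst y (u, ω) x)
                (seenFrom ContinuousMap.snd y (u, ω) x) := by
            intro x
            have h1 := ((measurable_pi_apply x).comp (measurable_seenFrom (d := d) (E := E)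
              (X := Config d E × Config d E) ContinuousMap.fst y)).edist
              ((measurable_pi_apply x).comp (measurable_seenFrom ContinuousMap.snd y))
            exact h1.comp (measurable_prodMk_left (x := u))
          simp only [herrdef]
          rw [lintegral_tsum fun x => ((hx x).const_mul _).aemeasurable]
          refine tsum_congr fun x => ?_
          rw [lintegral_const_mul _ (hx x), Coupling.meanDist]
          congr 1
          refine lintegral_congr fun ω => ?_
          simp only [seenFrom, shift_apply, sub_neg_eq_add]
          rfl
  -- Both marginals have the same killing rate (`hsum`), at most the weighted discrepancy (`h2`).
  -- Each killing costs at most the oscillation `Ψ` of `H`, and the source costs its Lipschitz bound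
  -- (`h3`).
  · intro y p hp
    have hsum := tsum_sub_min_eq ENNReal.ofReal_ne_top (hr₁s y p) (hr₂s y p)
    have h1 := tsum_sub_min_mul_le (Ψ := Ψ) hsum
      (h₁ := fun z => ENNReal.ofReal (H p.1 (seenFrom ContinuousMap.fst (y + z) p)))
      (h₂ := fun z => ENNReal.ofReal (H p.1 (seenFrom ContinuousMap.snd (y + z) p)))
      (fun z z' => hosc p.1 (ha.trans hp.le) _ _)
    have h2 : ∑' z, (r₁ y z p - min (r₁ y z p) (r₂ y z p)) ≤
        ∑' x, rateWeight α x * edist (seenFrom ContinuousMap.fst y p x)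
          (seenFrom ContinuousMap.snd y p x) := by
      refine le_trans (le_of_eq (tsum_congr fun z => ?_)) (tsum_uniformRate_sub_le hα _ _)
      exact ofReal_sub_min _ _ (hA0 z _)
    have h3 := ofReal_tiltedSource_le (f := f) hφ1 p.1 (seenFrom ContinuousMap.fst y p)
      (seenFrom ContinuousMap.snd y p)
    have h4 : err y p = (∑' x, lipConst f x * edist (seenFrom ContinuousMap.fst y p x)
          (seenFrom ContinuousMap.snd y p x)) + Ψ * ∑' x, rateWeight α x *
          edist (seenFrom ContinuousMap.fst y p x) (seenFrom ContinuousMap.snd y p x) := by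
      simp only [herrdef, errorWeight]
      rw [← ENNReal.tsum_mul_left, ← ENNReal.tsum_add]
      simp_rw [add_mul, mul_assoc]
    rw [h4, gain, gain]
    refine (add_le_add h3 (h1.trans (add_le_add_right (mul_le_mul_right h2 Ψ) _))).trans
      (le_of_eq ?_)
    ring

end CoupledComparison

/-! ### Absorption of the fluctuation. -/

section Fluctuation

theorem FellerSemigroup.op_sub_op_le {X : Type*} [TopologicalSpace X] [CompactSpace X]
    (S : FellerSemigroup X) (t : ℝ≥0) {h : C(X, ℝ)} {c : ℝ} (hc : ∀ p q, h p - h q ≤ c) (p q : X) :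
    S.op t h p - S.op t h q ≤ c := by
  have : Nonempty X := ⟨p⟩
  obtain ⟨m, -, hm⟩ := isCompact_univ.exists_isMinOn Set.univ_nonempty h.continuous.continuousOn
  have h1 := S.op_apply_le t (f := h) (c := h m + c) (fun x => by linarith [hc x m]) p
  have h2 := S.le_op_apply t (f := h) (c := h m) (fun x => hm (Set.mem_univ x)) q
  linarith

variable {d : ℕ} {E : Type*} [MetricSpace E] [CompactSpace E] {α : Site d → C(Config d E, ℝ)}

/-- The values of `h` lie in `[h m, h m + c]` for a minimiser `m`, and the jump operator has the
same total mass `Λ` at every configuration. -/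
theorem jumpOp_sub_le (hα0 : ∀ z η, 0 ≤ α z η)
    (hα : Summable fun z : Site d => ‖z‖ * ‖α z‖) {h : C(Config d E, ℝ)} {c : ℝ}
    (hc : ∀ p q, h p - h q ≤ c) (p q : Config d E) :
    jumpOp (uniformRate α) h p - jumpOp (uniformRate α) h q ≤ clockRate α * c := by
  have : Nonempty (Config d E) := ⟨p⟩
  obtain ⟨m, -, hm⟩ := isCompact_univ.exists_isMinOn Set.univ_nonempty h.continuous.continuousOn
  have hA := summable_norm_uniformRate hα
  have h1 : jumpOp (uniformRate α) h p ≤ clockRate α * (h m + c) :=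
    hasSum_le (fun z => mul_le_mul_of_nonneg_left (by linarith [hc (shift (-z) p) m])
      (uniformRate_nonneg hα0 hα z p)) (hasSum_jumpOp hA h p)
      ((hasSum_uniformRate hα p).mul_right (h m + c))
  have h2 : clockRate α * h m ≤ jumpOp (uniformRate α) h q :=
    hasSum_le (fun z => mul_le_mul_of_nonneg_left (hm (Set.mem_univ _))
      (uniformRate_nonneg hα0 hα z q)) ((hasSum_uniformRate hα q).mul_right (h m))
      (hasSum_jumpOp hA h q)
  linarith

variable {S T : FellerSemigroup (Config d E)} {f : C(Config d E, ℝ)} {φ : ℝ → ℝ} {a t : ℝ}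

/-- No coupling is used before time `a`. The source contributes at most `N` per unit time; a ring
before `a`, of probability `1 - e^{-Λa}`, costs `Ψ`; without a ring the problem restarts at `a`
after the environment alone has evolved. -/
theorem backward_tiltedSource_sub_le (hα0 : ∀ z η, 0 ≤ α z η)
    (hα : Summable fun z : Site d => ‖z‖ * ‖α z‖) (hT : IsEnvironmentProcessSemigroup S α T)
    (hφ : Measurable φ) (hφ1 : ∀ s, |φ s| ≤ 1) (ha : 0 ≤ a) (hat : a ≤ t) {N Ψ : ℝ}
    (hN : ∀ p q, f p - f q ≤ N)
    (hΨ : ∀ s, 0 ≤ s → ∀ p q, T.backward (tiltedSource f φ) t s p -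
      T.backward (tiltedSource f φ) t s q ≤ Ψ) (η ξ : Config d E) :
    T.backward (tiltedSource f φ) t 0 η - T.backward (tiltedSource f φ) t 0 ξ ≤
      a * N + (1 - Real.exp (-clockRate α * a)) * Ψ + Real.exp (-clockRate α * a) *
        (S.op a.toNNReal (T.backward (tiltedSource f φ) t a) η -
          S.op a.toNNReal (T.backward (tiltedSource f φ) t a) ξ) := by
  have hζ := stronglyMeasurable_tiltedSource (f := f) hφ
  have hc := norm_tiltedSource_le (f := f) hφ1
  have hΛ : 0 ≤ clockRate α := tsum_nonneg fun z => norm_nonneg _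
  have hN0 : 0 ≤ N := by simpa using hN η η
  have hsplit := FellerSemigroup.backward_split hΛ (generates_sub hT hα) hζ hc ha hat
  have hint := FellerSemigroup.integrable_mild (S := S) (T := T) (b := t)
    (K := jumpOp (uniformRate α)) hΛ hζ hc le_rfl
  simp only [sub_zero] at hint
  replace hint := hint.mono_set (Set.Ioc_subset_Ioc_right hat)
  set H := T.backward (tiltedSource f φ) t with hH
  set R := fun u => tiltedSource f φ u + jumpOp (uniformRate α) (H u) with hR
  have happ : ∀ p, H 0 p = (∫ u in Set.Ioc 0 a, Real.exp (-clockRate α * u) *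
      S.op u.toNNReal (R u) p) + Real.exp (-clockRate α * a) * S.op a.toNNReal (H a) p := by
    intro p
    have h1 := (ContinuousMap.evalCLM ℝ p).integral_comp_comm hint
    rw [hsplit]
    exact congrArg₂ (· + ·) h1.symm rfl
  have hip : ∀ p, IntegrableOn (fun u => Real.exp (-clockRate α * u) *
      S.op u.toNNReal (R u) p) (Set.Ioc 0 a) := by
    intro p
    have h1 := (ContinuousMap.evalCLM ℝ p : C(Config d E, ℝ) →L[ℝ] ℝ).integrable_comp hint
    exact h1
  have hRu : ∀ u, 0 ≤ u → ∀ p q, R u p - R u q ≤ N + clockRate α * Ψ := by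
    intro u hu p q
    have h1 := jumpOp_sub_le hα0 hα (hΨ u hu) p q
    have h2 : φ u * (f p - f q) ≤ N := by
      rcases le_total 0 (φ u) with h | h
      · nlinarith [hN p q, (abs_le.1 (hφ1 u)).2]
      · nlinarith [hN q p, (abs_le.1 (hφ1 u)).1]
    simp only [hR, ContinuousMap.add_apply, tiltedSource_apply]
    linarith
  have hexp : ∫ u in Set.Ioc 0 a, Real.exp (-clockRate α * u) * clockRate α =
      1 - Real.exp (-clockRate α * a) := by
    have hd : ∀ u : ℝ, HasDerivAt (fun u => -Real.exp (-clockRate α * u))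
        (Real.exp (-clockRate α * u) * clockRate α) u := by
      intro u
      refine (((hasDerivAt_id u).const_mul (-clockRate α)).exp.neg).congr_deriv ?_
      simp
    have hcont : Continuous fun u => Real.exp (-clockRate α * u) * clockRate α := by fun_prop
    have h := intervalIntegral.integral_eq_sub_of_hasDerivAt (fun u _ => hd u)
      (hcont.intervalIntegrable 0 a)
    rw [intervalIntegral.integral_of_le ha] at h
    rw [h]; simp; ring
  have hcont : Continuous fun u => Real.exp (-clockRate α * u) * clockRate α * Ψ := by fun_prop
  have hi1 : IntegrableOn (fun _ : ℝ => N) (Set.Ioc 0 a) :=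
    continuous_const.integrableOn_Ioc
  have hi2 : IntegrableOn (fun u => Real.exp (-clockRate α * u) * clockRate α * Ψ)
      (Set.Ioc 0 a) := hcont.integrableOn_Ioc
  have hI : (∫ u in Set.Ioc 0 a, Real.exp (-clockRate α * u) * S.op u.toNNReal (R u) η) -
      ∫ u in Set.Ioc 0 a, Real.exp (-clockRate α * u) * S.op u.toNNReal (R u) ξ ≤
      a * N + (1 - Real.exp (-clockRate α * a)) * Ψ := by
    rw [← integral_sub (hip η) (hip ξ)]
    calc _ ≤ ∫ u in Set.Ioc 0 a, (N + Real.exp (-clockRate α * u) * clockRate α * Ψ) := by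
          refine setIntegral_mono_on ((hip η).sub (hip ξ)) (hi1.add hi2) measurableSet_Ioc
            fun u hu => ?_
          rw [← mul_sub]
          have h1 := S.op_sub_op_le u.toNNReal (hRu u hu.1.le) η ξ
          have h2 : Real.exp (-clockRate α * u) ≤ 1 :=
            Real.exp_le_one_iff.2 (by nlinarith [hu.1])
          have h3 := mul_le_mul_of_nonneg_left h1 (Real.exp_pos (-clockRate α * u)).le
          nlinarith [mul_le_mul_of_nonneg_right h2 hN0]
      _ = _ := by
          rw [integral_add hi1 hi2, integral_mul_const, hexp]
          simp [ha]
  rw [happ η, happ ξ]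
  linarith

/-- If the fluctuation after time `a` is half absorbed, the fluctuation is bounded. -/
theorem fluctuation_le_of_half (hα0 : ∀ z η, 0 ≤ α z η)
    (hα : Summable fun z : Site d => ‖z‖ * ‖α z‖) (hT : IsEnvironmentProcessSemigroup S α T)
    (ha : 0 ≤ a) (hat : a ≤ t) {N B : ℝ≥0∞} (hN : ∀ p q, ENNReal.ofReal (f p - f q) ≤ N)
    (hN_top : N ≠ ∞) (hB : B ≠ ∞)
    (h : ∀ φ, Measurable φ → (∀ s, |φ s| ≤ 1) → ∀ η ξ,
      ENNReal.ofReal (S.op a.toNNReal (T.backward (tiltedSource f φ) t a) η -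
        S.op a.toNNReal (T.backward (tiltedSource f φ) t a) ξ) ≤ B + fluctuation T f t / 2) :
    fluctuation T f t ≤ ENNReal.ofReal (2 * Real.exp (clockRate α * a) * a) * N + 2 * B := by
  have hΛ : 0 ≤ clockRate α := tsum_nonneg fun z => norm_nonneg _
  have hΨ_top := fluctuation_ne_top (T := T) (f := f) (t := t)
  set Ψ := fluctuation T f t with hΨ
  set e := Real.exp (-clockRate α * a) with he
  have he0 : 0 < e := Real.exp_pos _
  have he1 : e ≤ 1 := Real.exp_le_one_iff.2 (by nlinarith)
  have hle : ∀ {x : ℝ} {y : ℝ≥0∞}, y ≠ ∞ → ENNReal.ofReal x ≤ y → x ≤ y.toReal :=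
    fun hy hxy => (ENNReal.ofReal_le_iff_le_toReal hy).1 hxy
  have hR0 : 0 ≤ a * N.toReal + (1 - e) * Ψ.toReal + e * (B.toReal + Ψ.toReal / 2) := by
    have := sub_nonneg.2 he1
    positivity
  have h1 : Ψ ≤ ENNReal.ofReal
      (a * N.toReal + (1 - e) * Ψ.toReal + e * (B.toReal + Ψ.toReal / 2)) := by
    refine iSup_le fun η => iSup_le fun ξ => ?_
    obtain ⟨φ, hφ, hφ1, hφt⟩ := exists_tilt T f η ξ
    rw [hφt]
    refine ENNReal.ofReal_le_ofReal ?_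
    have h2 := backward_tiltedSource_sub_le hα0 hα hT hφ hφ1 ha hat
      (fun p q => hle hN_top (hN p q))
      (fun s hs p q => hle hΨ_top (ofReal_backward_sub_le hφ hφ1 hs p q)) η ξ
    have h3 := hle (ENNReal.add_ne_top.2 ⟨hB, ENNReal.div_ne_top hΨ_top two_ne_zero⟩)
      (h φ hφ hφ1 η ξ)
    rw [ENNReal.toReal_add hB (ENNReal.div_ne_top hΨ_top two_ne_zero), ENNReal.toReal_div] at h3
    have h4 := mul_le_mul_of_nonneg_left h3 he0.le
    simp only [ENNReal.toReal_ofNat] at h4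
    linarith
  have h2 : Ψ.toReal ≤ a * N.toReal + (1 - e) * Ψ.toReal + e * (B.toReal + Ψ.toReal / 2) :=
    ENNReal.toReal_le_of_le_ofReal hR0 h1
  have h3 : Ψ.toReal ≤ 2 * Real.exp (clockRate α * a) * a * N.toReal + 2 * B.toReal := by
    have h4 : Real.exp (clockRate α * a) * e = 1 := by
      rw [he, ← Real.exp_add]; simp
    -- The term `(1 - e) Ψ` and half of `e Ψ` move to the left, leaving `e Ψ / 2`; multiplication by
    -- `e^{Λa} = 1/e` then isolates `Ψ`.
    have h5 : e * Ψ.toReal ≤ 2 * (a * N.toReal) + 2 * (e * B.toReal) := by linarith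
    have h6 := mul_le_mul_of_nonneg_left h5 (Real.exp_pos (clockRate α * a)).le
    calc Ψ.toReal = Real.exp (clockRate α * a) * e * Ψ.toReal := by rw [h4, one_mul]
      _ ≤ 2 * Real.exp (clockRate α * a) * a * N.toReal +
          2 * (Real.exp (clockRate α * a) * e) * B.toReal := by linarith
      _ = _ := by rw [h4, mul_one]
  rw [← ENNReal.ofReal_toReal hΨ_top]
  refine (ENNReal.ofReal_le_ofReal h3).trans (ENNReal.ofReal_add_le.trans (le_of_eq ?_))
  rw [ENNReal.ofReal_mul (by positivity), ENNReal.ofReal_toReal hN_top,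
    ENNReal.ofReal_mul zero_le_two, ENNReal.ofReal_toReal hB, ENNReal.ofReal_ofNat]

theorem lintegral_Ioi_eq_iSup (F : ℝ → ℝ≥0∞) (a : ℝ) :
    ∫⁻ u in Set.Ioi a, F u = ⨆ n : ℕ, ∫⁻ u in Set.Ioc a n, F u := by
  have h : ⋃ n : ℕ, Set.Ioc a (n : ℝ) = Set.Ioi a := by
    ext u
    simp only [Set.mem_iUnion, Set.mem_Ioc, Set.mem_Ioi]
    exact ⟨fun ⟨n, h⟩ => h.1, fun h => (exists_nat_ge u).imp fun n hn => ⟨h, hn⟩⟩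
  rw [← h]
  refine setLIntegral_iUnion_of_directed F (Monotone.directed_le fun m n hmn => ?_)
  exact Set.Ioc_subset_Ioc_right (Nat.cast_le.2 hmn)

theorem lintegral_abs_le_of_fluctuation_le {K : ℝ≥0∞} (h : ∀ t, fluctuation T f t ≤ K)
    (η ξ : Config d E) :
    ∫⁻ t in Set.Ioi (0 : ℝ), ENNReal.ofReal |T.op t.toNNReal f η - T.op t.toNNReal f ξ| ≤ K := by
  rw [lintegral_Ioi_eq_iSup]
  exact iSup_le fun n => (le_iSup₂ (f := fun η ξ => ∫⁻ t in Set.Ioc 0 (n : ℝ),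
    ENNReal.ofReal |T.op t.toNNReal f η - T.op t.toNNReal f ξ|) η ξ).trans (h n)

theorem fluctuation_mono {s t : ℝ} (h : s ≤ t) : fluctuation T f s ≤ fluctuation T f t :=
  iSup₂_mono fun _ _ => lintegral_mono_set (Set.Ioc_subset_Ioc_right h)

/-- Tails of a convergent integral are small. -/
theorem exists_lintegral_Ioi_le {F : ℝ → ℝ≥0∞} (hF : ∫⁻ u in Set.Ioi (0 : ℝ), F u ≠ ∞)
    {ε : ℝ≥0∞} (hε : ε ≠ 0) : ∃ a : ℝ, 1 ≤ a ∧ ∫⁻ u in Set.Ioi a, F u ≤ ε := by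
  by_cases h0 : ∫⁻ u in Set.Ioi (0 : ℝ), F u = 0
  · exact ⟨1, le_rfl, (lintegral_mono_set (Set.Ioi_subset_Ioi zero_le_one)).trans (by simp [h0])⟩
  have h1 := ENNReal.sub_lt_self hF h0 hε
  rw [lintegral_Ioi_eq_iSup] at h1
  obtain ⟨n, hn⟩ := lt_iSup_iff.1 h1
  rw [← lintegral_Ioi_eq_iSup] at hn
  have h2 : ∀ m : ℝ, 0 ≤ m → ∫⁻ u in Set.Ioi (0 : ℝ), F u =
      (∫⁻ u in Set.Ioc 0 m, F u) + ∫⁻ u in Set.Ioi m, F u := by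
    intro m hm
    have h := lintegral_union (μ := volume) (f := F) (measurableSet_Ioi (a := m))
      (Set.Ioc_disjoint_Ioi (a := 0) le_rfl)
    rwa [Set.Ioc_union_Ioi_eq_Ioi hm] at h
  have hm : (0 : ℝ) ≤ max 1 (n : ℝ) := zero_le_one.trans (le_max_left _ _)
  refine ⟨max 1 n, le_max_left _ _, ?_⟩
  have h3 : (∫⁻ u in Set.Ioi (0 : ℝ), F u) - ε ≤ ∫⁻ u in Set.Ioc 0 (max 1 (n : ℝ)), F u :=
    hn.le.trans (lintegral_mono_set (Set.Ioc_subset_Ioc_right (le_max_right _ _)))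
  have h4 := h2 _ hm
  have h5 : ∫⁻ u in Set.Ioc 0 (max 1 (n : ℝ)), F u ≠ ∞ :=
    ne_top_of_le_ne_top hF (lintegral_mono_set Set.Ioc_subset_Ioi_self)
  rw [tsub_le_iff_right, h4] at h3
  exact (ENNReal.add_le_add_iff_left h5).1 h3

end Fluctuation

/-! ### Summing discrepancies over sites. -/

section Discrepancy

variable {d : ℕ} {E : Type*} [MetricSpace E] [CompactSpace E] [SecondCountableTopology E]
  [MeasurableSpace E] [BorelSpace E] {env : Environment d E} {cpl : Coupling env}

/-- The lower integral is superadditive without measurability, so integrands containing suprema over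
all pairs of configurations are admissible. -/
theorem tsum_lintegral_le {β ι : Type*} [MeasurableSpace β] {μ : Measure β} (F : ι → β → ℝ≥0∞) :
    ∑' i, ∫⁻ u, F i u ∂μ ≤ ∫⁻ u, ∑' i, F i u ∂μ := by
  rw [ENNReal.tsum_eq_iSup_sum]
  refine iSup_le fun s => ?_
  have h : ∀ s : Finset ι, ∑ i ∈ s, ∫⁻ u, F i u ∂μ ≤ ∫⁻ u, ∑ i ∈ s, F i u ∂μ := by
    classical
    intro s
    induction s using Finset.induction_on with
    | empty => simp
    | insert i s hi ih =>
      simp_rw [Finset.sum_insert hi]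
      exact (add_le_add_right ih _).trans (le_lintegral_add _ _)
  exact (h s).trans (lintegral_mono fun u => ENNReal.sum_le_tsum s)

/-- For fixed `y` and `z`, summing over the initial position `x` lets `z + y - x` run through the
whole group, so the triple sum factors. -/
theorem tsum_mul_tsum_mul_add {G : Type*} [AddCommGroup G] (n w D : G → ℝ≥0∞) :
    ∑' x, ∑' y, n y * ∑' z, w z * D (z + y - x) = (∑' y, n y) * (∑' z, w z) * ∑' x, D x := by
  rw [ENNReal.tsum_comm, mul_assoc, ← ENNReal.tsum_mul_right]
  refine tsum_congr fun y => ?_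
  rw [ENNReal.tsum_mul_left, ENNReal.tsum_comm, ← ENNReal.tsum_mul_right]
  congr 1
  refine tsum_congr fun z => ?_
  rw [ENNReal.tsum_mul_left]
  congr 1
  exact (Equiv.subLeft (z + y)).tsum_eq D

theorem Coupling.IsTranslationInvariant.meanDist_le_iSup (h : cpl.IsTranslationInvariant)
    (η ξ : Config d E) (t : ℝ≥0) (x : Site d) :
    cpl.meanDist η ξ t x ≤ ⨆ η : Config d E, ⨆ ξ : Config d E, cpl.meanDist η ξ t 0 := by
  have h1 := h.meanDist_shift η ξ t 0 (-x)
  rw [zero_sub, neg_neg] at h1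
  rw [← h1]
  exact le_iSup₂ (f := fun η ξ => cpl.meanDist η ξ t 0) _ _

theorem Coupling.IsTranslationInvariant.meanDist_le_iSup_diffAt (h : cpl.IsTranslationInvariant)
    {x : Site d} {p : Config d E × Config d E} (hp : p ∈ diffAt (E := E) x) (t : ℝ≥0)
    (y : Site d) :
    cpl.meanDist p.1 p.2 t y ≤
      ⨆ q ∈ diffAt (E := E) (0 : Site d), cpl.meanDist q.1 q.2 t (y - x) := by
  have h1 := h.meanDist_shift p.1 p.2 t (y - x) (-x)
  rw [sub_neg_eq_add, sub_add_cancel] at h1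
  rw [← h1]
  refine le_iSup₂ (f := fun (q : Config d E × Config d E) (_ : q ∈ diffAt (E := E) (0 : Site d)) =>
    cpl.meanDist q.1 q.2 t (y - x)) (shift (-x) p.1, shift (-x) p.2) ⟨?_, fun z hz => ?_⟩
  · simpa using hp.1
  · simp only [shift_apply, sub_neg_eq_add]
    exact hp.2 _ (by simpa using hz)

/-- Summing over the position of the initial discrepancy. -/
theorem tsum_iSup_diffAt_le (h : cpl.IsTranslationInvariant) {F : Config d E × Config d E → ℝ≥0∞}
    {s : Set ℝ} {n : ℝ → Site d → ℝ≥0∞} {w : Site d → ℝ≥0∞}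
    (hF : ∀ p, F p ≤ ∫⁻ u in s, ∑' y, n u y *
      ∑' x, w x * cpl.meanDist p.1 p.2 u.toNNReal (x + y)) :
    ∑' x, ⨆ p ∈ diffAt (E := E) x, F p ≤
      ∫⁻ u in s, (∑' y, n u y) * (∑' x, w x) * cpl.totalDiscrepancy u.toNNReal := by
  calc ∑' x, ⨆ p ∈ diffAt (E := E) x, F p
      ≤ ∑' x, ∫⁻ u in s, ∑' y, n u y * ∑' z, w z *
          ⨆ q ∈ diffAt (E := E) (0 : Site d), cpl.meanDist q.1 q.2 u.toNNReal (z + y - x) := by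
        refine ENNReal.tsum_le_tsum fun x => iSup₂_le fun p hp => (hF p).trans ?_
        refine lintegral_mono fun u => ENNReal.tsum_le_tsum fun y => mul_le_mul_right
          (ENNReal.tsum_le_tsum fun z => mul_le_mul_right ?_ _) _
        exact h.meanDist_le_iSup_diffAt hp _ _
    _ ≤ _ := tsum_lintegral_le _
    _ = _ := by
        refine lintegral_congr fun u => ?_
        exact tsum_mul_tsum_mul_add (n u) w fun x =>
          ⨆ q ∈ diffAt (E := E) (0 : Site d), cpl.meanDist q.1 q.2 u.toNNReal x

end Discrepancy

/-! ### Uniform bounds in time. -/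

section Conclusion

variable {d : ℕ} {E : Type*} [MetricSpace E] [CompactSpace E] [SecondCountableTopology E]
  [MeasurableSpace E] [BorelSpace E] {α : Site d → C(Config d E, ℝ)}
  {env : Environment d E} {cpl : Coupling env} {T : FellerSemigroup (Config d E)}
  {C : ℝ} {n : ℝ → Site d → ℝ≥0∞}

theorem tsum_errorWeight (f : C(Config d E, ℝ)) (Ψ : ℝ≥0∞) :
    ∑' x, errorWeight α f Ψ x = tripleNorm f + Ψ * ∑' x, rateWeight α x := by
  simp only [errorWeight]
  rw [ENNReal.tsum_add, ENNReal.tsum_mul_left, tripleNorm]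

/-- The fluctuation is bounded as soon as its contribution after time `a` is controlled by an
integrable discrepancy. -/
theorem exists_fluctuation_le (hρ : ∀ a b : E, dist a b ≤ 1) (hα0 : ∀ z η, 0 ≤ α z η)
    (hα : Summable fun z : Site d => ‖z‖ * ‖α z‖) (hR : ∑' x, rateWeight α x ≠ ∞)
    (hT : IsEnvironmentProcessSemigroup env.semigroup α T)
    (hC : 0 ≤ C) (hn : ∀ u, ∑' x, n u x ≤ ENNReal.ofReal (C * (max 1 u) ^ d))
    {g : ℝ → ℝ≥0∞} (hg : ∫⁻ u in Set.Ioi (0 : ℝ), ENNReal.ofReal (u ^ d) * g u ≠ ∞)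
    (h : ∀ (f : C(Config d E, ℝ)) (φ : ℝ → ℝ), Measurable φ → (∀ s, |φ s| ≤ 1) →
      ∀ a t, 0 ≤ a → ∀ η ξ,
      ENNReal.ofReal (env.semigroup.op a.toNNReal (T.backward (tiltedSource f φ) t a) η -
        env.semigroup.op a.toNNReal (T.backward (tiltedSource f φ) t a) ξ) ≤
      ∫⁻ u in Set.Ioc a t, (∑' y, n u y) * (∑' x, errorWeight α f (fluctuation T f t) x) * g u) :
    ∃ K : ℝ≥0∞, K ≠ ∞ ∧ ∀ f : C(Config d E, ℝ), tripleNorm f ≠ ∞ →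
      ∀ t, fluctuation T f t ≤ K * tripleNorm f := by
  set R := ∑' x, rateWeight α x with hRdef
  set c := ENNReal.ofReal C with hc
  have hc_top : c ≠ ∞ := ENNReal.ofReal_ne_top
  have hcR : c * R + 1 ≠ ∞ := ENNReal.add_ne_top.2 ⟨ENNReal.mul_ne_top hc_top hR, ENNReal.one_ne_top⟩
  -- A tail below this level makes the coefficient `c * R * τ` of the fluctuation at most `1/2`; the
  -- `+ 1` covers `c * R = 0`.
  have hε : (c * R + 1)⁻¹ / 2 ≠ 0 := ENNReal.div_ne_zero.2 ⟨ENNReal.inv_ne_zero.2 hcR, by simp⟩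
  obtain ⟨a, ha1, ha⟩ := exists_lintegral_Ioi_le hg hε
  set τ := ∫⁻ u in Set.Ioi a, ENNReal.ofReal (u ^ d) * g u with hτ
  have hτ_top : τ ≠ ∞ := ne_top_of_le_ne_top hg (lintegral_mono_set
    (Set.Ioi_subset_Ioi (zero_le_one.trans ha1)))
  have hhalf : c * R * τ ≤ 2⁻¹ := by
    calc c * R * τ ≤ (c * R + 1) * ((c * R + 1)⁻¹ / 2) := by
          gcongr; exact le_self_add
      _ = 2⁻¹ := by
          rw [div_eq_mul_inv, ← mul_assoc, ENNReal.mul_inv_cancel (by simp) hcR, one_mul]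
  have ha0 : 0 ≤ a := zero_le_one.trans ha1
  refine ⟨ENNReal.ofReal (2 * Real.exp (clockRate α * a) * a) + 2 * (c * τ),
    ENNReal.add_ne_top.2 ⟨ENNReal.ofReal_ne_top, ENNReal.mul_ne_top (by simp)
      (ENNReal.mul_ne_top hc_top hτ_top)⟩, fun f hf t => ?_⟩
  -- Enlarging `t` to `max t a` only increases the fluctuation and places `a` before the final time.
  refine (fluctuation_mono (le_max_left t a)).trans ?_
  refine (fluctuation_le_of_half hα0 hα hT ha0 (le_max_right t a) (N := tripleNorm f)
    (B := c * τ * tripleNorm f) (fun p q => ofReal_sub_le_tripleNorm hρ f.continuous p q) hf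
    (ENNReal.mul_ne_top (ENNReal.mul_ne_top hc_top hτ_top) hf) ?_).trans (le_of_eq (by ring))
  intro φ hφ hφ1 η ξ
  refine (h f φ hφ hφ1 a _ ha0 η ξ).trans ?_
  have hΨ := fluctuation_ne_top (T := T) (f := f) (t := max t a)
  set Ψ := fluctuation T f (max t a)
  rw [tsum_errorWeight]
  have hW : c * (tripleNorm f + Ψ * R) ≠ ∞ :=
    ENNReal.mul_ne_top hc_top (ENNReal.add_ne_top.2 ⟨hf, ENNReal.mul_ne_top hΨ hR⟩)
  calc ∫⁻ u in Set.Ioc a (max t a), (∑' y, n u y) * (tripleNorm f + Ψ * R) * g u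
      ≤ ∫⁻ u in Set.Ioc a (max t a), c * (tripleNorm f + Ψ * R) *
          (ENNReal.ofReal (u ^ d) * g u) := by
        refine setLIntegral_mono' measurableSet_Ioc fun u hu => ?_
        -- Since `u > a ≥ 1`, the site bound is `C u^d`; small times play no role in the absorption.
        have h1 := hn u
        rw [max_eq_right (ha1.trans hu.1.le), ENNReal.ofReal_mul hC] at h1
        calc _ ≤ c * ENNReal.ofReal (u ^ d) * (tripleNorm f + Ψ * R) * g u := by gcongr
          _ = _ := by ring
    _ ≤ c * (tripleNorm f + Ψ * R) * τ := by
        rw [lintegral_const_mul' _ _ hW]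
        gcongr
        exact lintegral_mono_set Set.Ioc_subset_Ioi_self
    _ = c * τ * tripleNorm f + Ψ * (c * R * τ) := by ring
    _ ≤ _ := by
        rw [ENNReal.div_eq_inv_mul, mul_comm _ Ψ]
        gcongr

theorem exists_pos_mul_le {K : ℝ≥0∞} (hK : K ≠ ∞) : ∃ c : ℝ≥0, 0 < c ∧ ∀ N : ℝ≥0∞, K * N ≤ c * N :=
  ⟨K.toNNReal + 1, by positivity, fun N => by
    gcongr
    rw [ENNReal.coe_add, ENNReal.coe_toNNReal hK]
    exact le_self_add⟩

theorem tsum_mul_tsum_mul_le (hcpl : cpl.IsTranslationInvariant) (η ξ : Config d E) (t : ℝ≥0)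
    (m w : Site d → ℝ≥0∞) :
    ∑' y, m y * ∑' x, w x * cpl.meanDist η ξ t (x + y) ≤ (∑' y, m y) * (∑' x, w x) *
      ⨆ η : Config d E, ⨆ ξ : Config d E, cpl.meanDist η ξ t 0 := by
  rw [mul_assoc, ← ENNReal.tsum_mul_right]
  gcongr with y
  rw [← ENNReal.tsum_mul_right]
  gcongr with x
  exact hcpl.meanDist_le_iSup η ξ t _

theorem errorWeight_mono {f : C(Config d E, ℝ)} {Ψ Ψ' : ℝ≥0∞} (h : Ψ ≤ Ψ') (x : Site d) :
    errorWeight α f Ψ x ≤ errorWeight α f Ψ' x := by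
  unfold errorWeight; gcongr

/-- The site bound does not vanish at small times whereas `u^d` does for `d ≥ 1`, so the interval
`(0, 1]` needs its own hypothesis. -/
theorem lintegral_max_pow_mul_ne_top {g : ℝ → ℝ≥0∞}
    (hg : ∫⁻ u in Set.Ioi (0 : ℝ), ENNReal.ofReal (u ^ d) * g u ≠ ∞)
    (hg1 : ∫⁻ u in Set.Ioc (0 : ℝ) 1, g u ≠ ∞) :
    ∫⁻ u in Set.Ioi (0 : ℝ), ENNReal.ofReal ((max 1 u) ^ d) * g u ≠ ∞ := by
  have h := lintegral_union (μ := volume)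
    (f := fun u : ℝ => ENNReal.ofReal ((max 1 u) ^ d) * g u) (measurableSet_Ioi (a := (1 : ℝ)))
      (Set.Ioc_disjoint_Ioi (a := 0) le_rfl)
  rw [Set.Ioc_union_Ioi_eq_Ioi zero_le_one] at h
  rw [h]
  refine ENNReal.add_ne_top.2 ⟨?_, ?_⟩
  · refine ne_top_of_le_ne_top hg1 (setLIntegral_mono' measurableSet_Ioc fun u hu => ?_)
    rw [max_eq_left hu.2]
    simp
  · refine ne_top_of_le_ne_top hg (le_trans ?_ (lintegral_mono_set
      (Set.Ioi_subset_Ioi zero_le_one)))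
    refine setLIntegral_mono' measurableSet_Ioi fun u hu => ?_
    rw [max_eq_right (le_of_lt hu)]

/-- The integrated difference between two initial configurations. -/
theorem lintegral_abs_sub_le (hα0 : ∀ z η, 0 ≤ α z η)
    (hα : Summable fun z : Site d => ‖z‖ * ‖α z‖) (henv : env.IsTranslationInvariant)
    (hT : IsEnvironmentProcessSemigroup env.semigroup α T) (hM : cpl.StrongMarginalMarkov)
    (hn : ∀ (b : Site d → Site d → ℝ × CadlagPath (Config d E × Config d E) → ℝ≥0∞) (a : ℝ),
        0 ≤ a → (∀ y z, Measurable (b y z)) →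
        (∀ y p, ∑' z, b y z p ≤ ENNReal.ofReal (clockRate α)) →
        (∀ y z p, z ≠ 0 → b y z p ≤ ENNReal.ofReal ‖α z‖) →
        ∀ x u ω, a ≤ u → ∑' n, walkMass (clockRate α) a b n x (u, ω) ≤ n u x)
    {f : C(Config d E, ℝ)} {Ψ : ℝ≥0∞} (hΨ : ∀ t, fluctuation T f t ≤ Ψ) (η ξ : Config d E) :
    ∫⁻ t in Set.Ioi (0 : ℝ), ENNReal.ofReal |T.op t.toNNReal f η - T.op t.toNNReal f ξ| ≤
      ∫⁻ u in Set.Ioi (0 : ℝ), ∑' y, n u y *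
        ∑' x, errorWeight α f Ψ x * cpl.meanDist η ξ u.toNNReal (x + y) := by
  obtain ⟨φ, hφ, hφ1, hφt⟩ := exists_tilt T f η ξ
  rw [lintegral_Ioi_eq_iSup]
  refine iSup_le fun N => ?_
  -- The comparison starts at time `0`, where `S_0` is the identity; no smallness is needed because
  -- the fluctuation is already bounded.
  have h := ofReal_op_backward_sub_le hα0 hα henv hT hM hn (f := f) hφ hφ1 (t := N) le_rfl η ξ
  rw [Real.toNNReal_zero, env.semigroup.op_zero] at h
  rw [hφt]
  refine h.trans ((lintegral_mono_set Set.Ioc_subset_Ioi_self).trans (lintegral_mono fun u =>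
    ENNReal.tsum_le_tsum fun y => ?_))
  gcongr with x
  exact errorWeight_mono (hΨ _) x

end Conclusion

end RWDRE

/-! ### Proof of the theorem. -/

theorem mainTheorem1 {d : ℕ} {E : Type*} [MetricSpace E] [CompactSpace E]
    [MeasurableSpace E] [BorelSpace E]
    (hρ : ∀ a b : E, dist a b ≤ 1)
    (env : RWDRE.Environment d E) (henv : env.IsTranslationInvariant)
    (α : RWDRE.Site d → C(RWDRE.Config d E, ℝ))
    (hα_nonneg : ∀ z η, 0 ≤ α z η)
    (hα_moment : Summable fun z : RWDRE.Site d => ‖z‖ * ‖α z‖)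
    (hα_lip : ∑' z : RWDRE.Site d, RWDRE.tripleNorm (α z) < ∞)
    (SEP : RWDRE.FellerSemigroup (RWDRE.Config d E))
    (hSEP : RWDRE.IsEnvironmentProcessSemigroup env.semigroup α SEP)
    (cpl : RWDRE.Coupling env) (hcpl_inv : cpl.IsTranslationInvariant)
    (hcpl_markov : cpl.StrongMarginalMarkov) :
    (cpl.Assumption1a →
      ∃ Ca : ℝ≥0, 0 < Ca ∧ ∀ f : C(RWDRE.Config d E, ℝ), RWDRE.tripleNorm f < ∞ →
        (⨆ η : RWDRE.Config d E, ⨆ ξ : RWDRE.Config d E,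
          ∫⁻ t in Set.Ioi (0 : ℝ),
            ENNReal.ofReal |SEP.op t.toNNReal f η - SEP.op t.toNNReal f ξ|)
          ≤ Ca * RWDRE.tripleNorm f) ∧
    (cpl.Assumption1b → cpl.SmallTimeIntegrable →
      ∃ Cb : ℝ≥0, 0 < Cb ∧ ∀ f : C(RWDRE.Config d E, ℝ), RWDRE.tripleNorm f < ∞ →
        (∑' x : RWDRE.Site d, ⨆ p ∈ RWDRE.diffAt (E := E) x,
          ∫⁻ t in Set.Ioi (0 : ℝ),
            ENNReal.ofReal |SEP.op t.toNNReal f p.1 - SEP.op t.toNNReal f p.2|)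
          ≤ Cb * RWDRE.tripleNorm f) := by
  have hsc : SecondCountableTopology E := EMetric.secondCountable_of_sigmaCompact E
  have hR : ∑' x, RWDRE.rateWeight α x ≠ ∞ := by
    rw [RWDRE.tsum_rateWeight]
    exact ENNReal.mul_ne_top (by simp) hα_lip.ne
  obtain ⟨C, n, hC, hn, hnb⟩ := RWDRE.exists_site_bound hα_moment
  replace hnb := hnb (RWDRE.CadlagPath (RWDRE.Config d E × RWDRE.Config d E))
  refine ⟨fun h1a => ?_, fun h1b hsmall => ?_⟩
  -- Here the discrepancy is the supremum at the origin, which by translation invariance bounds that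
  -- at every site. The uniform bound on the fluctuation is already the claim.
  · obtain ⟨K, hK, hf⟩ := RWDRE.exists_fluctuation_le hρ hα_nonneg hα_moment hR hSEP hC hn h1a.ne
      fun f φ hφ hφ1 a t ha η ξ =>
        (RWDRE.ofReal_op_backward_sub_le hα_nonneg hα_moment henv hSEP hcpl_markov hnb hφ hφ1 ha
          η ξ).trans (lintegral_mono fun u => RWDRE.tsum_mul_tsum_mul_le hcpl_inv η ξ _ _ _)
    obtain ⟨Ca, hCa, hle⟩ := RWDRE.exists_pos_mul_le hK
    exact ⟨Ca, hCa, fun f hfN => iSup₂_le fun η ξ =>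
      (RWDRE.lintegral_abs_le_of_fluctuation_le (hf f hfN.ne) η ξ).trans (hle _)⟩
  -- An arbitrary pair is joined by single-site changes; summing the comparison over their locations
  -- produces the total discrepancy.
  · obtain ⟨K, hK, hf⟩ := RWDRE.exists_fluctuation_le hρ hα_nonneg hα_moment hR hSEP hC hn h1b.ne
      fun f φ hφ hφ1 a t ha η ξ =>
        (RWDRE.ofReal_sub_le_tsum_iSup (ContinuousMap.continuous _) η ξ).trans
          (RWDRE.tsum_iSup_diffAt_le hcpl_inv fun p => RWDRE.ofReal_op_backward_sub_le hα_nonneg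
            hα_moment henv hSEP hcpl_markov hnb hφ hφ1 ha p.1 p.2)
    set I := ∫⁻ u in Set.Ioi (0 : ℝ),
      ENNReal.ofReal ((max 1 u) ^ d) * cpl.totalDiscrepancy u.toNNReal with hIdef
    have hI : I ≠ ∞ := RWDRE.lintegral_max_pow_mul_ne_top h1b.ne hsmall.ne
    -- With the fluctuation at most `K |||f|||`, the error weights sum to `|||f||| (1 + K ∑
    -- rateWeight)`. The factors `C` and `I` come from the site bound and the integrated
    -- discrepancy.
    have hK' : ENNReal.ofReal C * I * (1 + K * ∑' x, RWDRE.rateWeight α x) ≠ ∞ :=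
      ENNReal.mul_ne_top (ENNReal.mul_ne_top ENNReal.ofReal_ne_top hI)
        (ENNReal.add_ne_top.2 ⟨ENNReal.one_ne_top, ENNReal.mul_ne_top hK hR⟩)
    obtain ⟨Cb, hCb, hle⟩ := RWDRE.exists_pos_mul_le hK'
    refine ⟨Cb, hCb, fun f hfN => le_trans ?_ (hle _)⟩
    refine (RWDRE.tsum_iSup_diffAt_le hcpl_inv fun p => RWDRE.lintegral_abs_sub_le hα_nonneg
      hα_moment henv hSEP hcpl_markov hnb (hf f hfN.ne) p.1 p.2).trans ?_
    rw [RWDRE.tsum_errorWeight]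
    set W := RWDRE.tripleNorm f + K * RWDRE.tripleNorm f * ∑' x, RWDRE.rateWeight α x with hW
    have hW_top : ENNReal.ofReal C * W ≠ ∞ := ENNReal.mul_ne_top ENNReal.ofReal_ne_top
      (ENNReal.add_ne_top.2 ⟨hfN.ne, ENNReal.mul_ne_top (ENNReal.mul_ne_top hK hfN.ne) hR⟩)
    calc _ ≤ ∫⁻ u in Set.Ioi (0 : ℝ), ENNReal.ofReal C * W *
          (ENNReal.ofReal ((max 1 u) ^ d) * cpl.totalDiscrepancy u.toNNReal) := by
          refine lintegral_mono fun u => ?_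
          have h1 := hn u
          rw [ENNReal.ofReal_mul hC] at h1
          calc _ ≤ ENNReal.ofReal C * ENNReal.ofReal ((max 1 u) ^ d) * W *
                cpl.totalDiscrepancy u.toNNReal := by gcongr
            _ = _ := by ring
      _ = ENNReal.ofReal C * W * I := lintegral_const_mul' _ _ hW_top
      _ = _ := by rw [hW]; ring
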